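/- **Setting.** Let $R$ be a commutative ring with $1$, $\upsilon\in R^\times$, $q=\upsilon^2$, and let $m,n,r\ge 0$ be integers. Let $W=\mathfrak S_r$ with basic transpositions $s_k=(k,k+1)$ and length function $\ell$. Let $\mathcal H_R$ be the Hecke algebra: the free $R$-module with basis $T_w$ $(w\in W)$ and multiplication determined by $T_wT_s=T_{ws}$ if $\ell(ws)>\ell(w)$ and $T_wT_s=(q-1)T_w+qT_{ws}$ otherwise, for $s$ a basic transposition. Let $\Lambda(m|n,r)$ be the set of compositions $\lambda=(\lambda_1,\dots,\lambda_{m+n})\in\mathbb N^{m+n}$ of $r$. For such $\lambda$ let $\mathbb N^\lambda_i=\{\lambda_1+\cdots+\lambda_{i-1}+1,\dots,\lambda_1+\cdots+\lambda_i\}$, let $W_\lambda\le W$ be the subgroup leaving every $\mathbb N^\lambda_i$ invariant, and let $W_{\lambda^{(0)}}$ (resp. $W_{\lambda^{(1)}}$) be the subgroup of $W_\lambda$ fixing every letter $>\lambda_1+\cdots+\lambda_m$ (resp. every letter $\le\lambda_1+\cdots+\lambda_m$). Put $$[xy]_\lambda=\sum_{w\in W_{\lambda^{(0)}}}T_w\cdot\sum_{w\in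 W_{\lambda^{(1)}}}(-q)^{-\ell(w)}T_w .$$ The $q$-Schur superalgebra is $\mathcal S_R(m|n,r)=\mathrm{End}_{\mathcal H_R}\big(\bigoplus_{\lambda\in\Lambda(m|n,r)}[xy]_\lambda\mathcal H_R\big)$ (endomorphisms of right modules). For a subgroup $P\le W$ let $\mathcal D_P$ be the set of shortest representatives of the right cosets $Pw$, and for $d\in W$ let $P^d=d^{-1}Pd$. For $\lambda,\mu\in\Lambda(m|n,r)$ let $\mathcal D^\circ_{\lambda\mu}$ be the set of $d\in\mathcal D_{W_\lambda}\cap\mathcal D_{W_\mu}^{-1}$ with $W_{\lambda^{(0)}}^d\cap W_{\mu^{(1)}}=1$ and $W_{\lambda^{(1)}}^d\cap W_{\mu^{(0)}}=1$. Let $M(m|n,r)$ be the set of all matrices $A=\big(|\mathbb N^\lambda_i\cap d(\mathbb N^\mu_j)|\big)_{1\le i,j\le m+n}$ with $\lambda,\mu\in\Lambda(m|n,r)$ and $d\in\mathcal D^\circ_{\lambda\mu}$. For such $A$ let $\phi_A\in\mathcal S_R(m|n,r)$ be given by $$\phi_A([xy]_\alpha h)=\delta_{\mu,\alpha}\,[xy]_\lambda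 T_dT_{D}\,h\qquad(\alpha\in\Lambda(m|n,r),\ h\in\mathcal H_R),$$ where $D=\mathcal D_{W_\lambda^d\cap W_\mu}\cap W_\mu$ and $T_D=\sum_{w_0\in D\cap W_{\mu^{(0)}},\,w_1\in D\cap W_{\mu^{(1)}}}(-q)^{-\ell(w_1)}T_{w_0}T_{w_1}$. Put $\widehat i=0$ if $i\le m$ and $\widehat i=1$ if $i>m$. For $A=(a_{i,j})\in M(m|n,r)$ let $$[A]=(-1)^{\widehat A}\upsilon^{-d(A)}\phi_A,\quad \widehat A=\sum_{m<k<i,\ j<l}a_{i,j}a_{k,l},\quad d(A)=\sum_{i>k,\ j<l}a_{i,j}a_{k,l}+\sum_{i,\ j<l}(-1)^{\widehat i}a_{i,j}a_{i,l},$$ and put $[A]=0$ if $A\in M_{m+n}(\mathbb N)$ is not in $M(m|n,r)$. Let $\upsilon_h=\upsilon$ if $h\le m$ and $\upsilon_h=\upsilon^{-1}$ if $h>m$. Let $\overline{[\![s]\!]}_{\upsilon_h^2}=1+\upsilon_h^{-2}+\cdots+\upsilon_h^{-2(s-1)}$. Let $E_{i,j}$ be the matrix units and $A^{\pm}_{h,k}=A\pm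 E_{h,k}\mp E_{h+1,k}$. **Statement.** For every $A\in M(m|n,r)$ the element $\phi_A$ is well defined. Let $A=(a_{i,j})\in M(m|n,r)$ and $1\le h<m+n$. Let $D_h^{+}$ (resp. $D_h^-$) denote a matrix in $M(m|n,r)$, if there is one, such that $D_h^+-E_{h,h+1}$ (resp. $D_h^--E_{h+1,h}$) is a diagonal matrix with entries in $\mathbb N$ and such that the sequence of column sums of $D_h^\pm$ is the sequence of row sums of $A$. Let $\epsilon_{h,k}=0$ for $h\ne m$ and $\epsilon_{m,k}=\sum_{i>m,\ j<k}a_{i,j}$. Then, whenever the matrix $D_h^+$, resp. $D_h^-$, exists, the following holds in $\mathcal S_R(m|n,r)$: 1. $\displaystyle [D^+_h][A]=\sum_{1\le k\le m+n,\ a_{h+1,k}\ge1}(-1)^{\epsilon_{h,k}}\upsilon_h^{f^+_{h,k}}\,\overline{[\![a_{h,k}+1]\!]}_{\upsilon_h^2}\,[A^+_{h,k}]$, where $f^+_{h,k}=\sum_{j\ge k}a_{h,j}-(-1)^{\widehat h+\widehat{h+1}}\sum_{j>k}a_{h+1,j}$; 2. $\displaystyle [D^-_h][A]=\sum_{1\le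 k\le m+n,\ a_{h,k}\ge1}(-1)^{\epsilon_{h,k}}\upsilon_{h+1}^{f^-_{h,k}}\,\overline{[\![a_{h+1,k}+1]\!]}_{\upsilon_{h+1}^2}\,[A^-_{h,k}]$, where $f^-_{h,k}=\sum_{j\le k}a_{h+1,j}-(-1)^{\widehat h+\widehat{h+1}}\sum_{j<k}a_{h,j}$. -/

import Mathlib

namespace QSchurSuper

/-- The basic transpositions `s_k = (k, k+1)`. -/
def simpleTransp (r : ℕ) : Set (Equiv.Perm (Fin r)) :=
  {s | ∃ i j : Fin r, j.val = i.val + 1 ∧ s = Equiv.swap i j}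

/-- The length function with respect to the basic transpositions. -/
noncomputable def len {r : ℕ} (w : Equiv.Perm (Fin r)) : ℕ :=
  sInf {k | ∃ l : List (Equiv.Perm (Fin r)),
    (∀ s ∈ l, s ∈ simpleTransp r) ∧ l.prod = w ∧ l.length = k}

/-- Inversions of a permutation. -/
def invSet {r : ℕ} (w : Equiv.Perm (Fin r)) : Finset (Fin r × Fin r) :=
  Finset.univ.filter fun p => p.1 < p.2 ∧ w p.2 < w p.1

theorem mem_invSet {r : ℕ} (w : Equiv.Perm (Fin r)) (a b : Fin r) :
    (a, b) ∈ invSet w ↔ a < b ∧ w b < w a := by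
  simp [invSet]

theorem swap_lt {r : ℕ} {i j : Fin r} (hij : j.val = i.val + 1) {a b : Fin r} (hab : a < b)
    (hne : ¬ (a = i ∧ b = j)) : Equiv.swap i j a < Equiv.swap i j b := by
  simp only [Equiv.swap_apply_def]
  simp only [Fin.ext_iff, Fin.lt_def] at *
  split_ifs <;> omega

theorem invSet_mul {r : ℕ} (w : Equiv.Perm (Fin r)) {i j : Fin r} (hij : j.val = i.val + 1)
    (h : w i < w j) : (invSet (w * Equiv.swap i j)).card = (invSet w).card + 1 := by
  have hne : i ≠ j := by rintro rfl; omega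
  have hlt : i < j := by rw [Fin.lt_def]; omega
  have key : invSet (w * Equiv.swap i j) = insert (i, j) ((invSet w).map
      ((Equiv.swap i j).prodCongr (Equiv.swap i j)).toEmbedding) := by
    ext ⟨a, b⟩
    simp only [mem_invSet, Finset.mem_insert, Finset.mem_map_equiv, Equiv.prodCongr_symm,
      Equiv.symm_swap, Equiv.prodCongr_apply, Prod.map, Equiv.Perm.mul_apply, Prod.mk.injEq]
    constructor
    · rintro ⟨hab, hw⟩
      by_cases hc : a = i ∧ b = j
      · exact Or.inl hc
      · exact Or.inr ⟨swap_lt hij hab hc, hw⟩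
    · rintro (⟨rfl, rfl⟩ | ⟨hab, hw⟩)
      · simpa using ⟨hlt, h⟩
      · refine ⟨?_, hw⟩
        by_cases hc : Equiv.swap i j a = i ∧ Equiv.swap i j b = j
        · rw [hc.1, hc.2] at hw
          exact absurd hw (not_lt.mpr h.le)
        · simpa using swap_lt hij hab hc
  rw [key, Finset.card_insert_of_notMem, Finset.card_map]
  simp only [Finset.mem_map_equiv, Equiv.prodCongr_symm, Equiv.symm_swap, Equiv.prodCongr_apply,
    Prod.map, mem_invSet, Equiv.swap_apply_left, Equiv.swap_apply_right, not_and]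
  intro hji
  exact absurd hji (not_lt.mpr hlt.le)

theorem invSet_mul' {r : ℕ} (w : Equiv.Perm (Fin r)) {i j : Fin r} (hij : j.val = i.val + 1)
    (h : w j < w i) : (invSet (w * Equiv.swap i j)).card + 1 = (invSet w).card := by
  have := invSet_mul (w * Equiv.swap i j) hij (by simpa using h)
  rw [← this, mul_assoc, Equiv.swap_mul_self, mul_one]

theorem invSet_prod_le {r : ℕ} (l : List (Equiv.Perm (Fin r)))
    (hl : ∀ s ∈ l, s ∈ simpleTransp r) : (invSet l.prod).card ≤ l.length := by
  induction l using List.reverseRecOn with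
  | nil =>
    simp only [List.prod_nil, List.length_nil, Nat.le_zero, Finset.card_eq_zero]
    ext ⟨a, b⟩
    simp only [mem_invSet, Equiv.Perm.one_apply, Finset.notMem_empty, iff_false, not_and]
    exact fun h => not_lt.mpr h.le
  | append_singleton l s ih =>
    obtain ⟨i, j, hij, rfl⟩ := hl s (by simp)
    have ih' := ih fun t ht => hl t (by simp [ht])
    have hne : l.prod i ≠ l.prod j := fun h => by
      have := l.prod.injective h; subst this; omega
    rw [List.prod_append, List.prod_singleton, List.length_append, List.length_singleton]
    rcases lt_or_gt_of_ne hne with h | h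
    · rw [invSet_mul _ hij h]; omega
    · have := invSet_mul' _ hij h; omega

theorem exists_descent {r : ℕ} (w : Equiv.Perm (Fin r)) (hw : w ≠ 1) :
    ∃ i j : Fin r, j.val = i.val + 1 ∧ w j < w i := by
  by_contra hcon
  push Not at hcon
  apply hw
  cases r with
  | zero => exact Subsingleton.elim _ _
  | succ r =>
    have hm : StrictMono w := by
      rw [Fin.strictMono_iff_lt_succ]
      intro i
      refine lt_of_le_of_ne (hcon i.castSucc i.succ (by simp)) fun h => ?_
      have := congrArg Fin.val (w.injective h)
      simp at this
    ext1 x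
    have he : hm.orderIsoOfSurjective w w.surjective = OrderIso.refl _ := Subsingleton.elim _ _
    exact congrArg (fun e : Fin (r + 1) ≃o Fin (r + 1) => e x) he

theorem exists_word {r : ℕ} (k : ℕ) : ∀ w : Equiv.Perm (Fin r), (invSet w).card = k →
    ∃ l : List (Equiv.Perm (Fin r)),
      (∀ s ∈ l, s ∈ simpleTransp r) ∧ l.prod = w ∧ l.length = k := by
  induction k with
  | zero =>
    intro w hw
    refine ⟨[], by simp, ?_, rfl⟩
    by_contra hne
    obtain ⟨i, j, hij, h⟩ := exists_descent w (fun h => hne h.symm)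
    have := invSet_mul' w hij h
    omega
  | succ k ih =>
    intro w hw
    have hne : w ≠ 1 := by
      rintro rfl
      have := invSet_prod_le ([] : List (Equiv.Perm (Fin r))) (by simp)
      simp only [List.prod_nil, List.length_nil] at this
      omega
    obtain ⟨i, j, hij, h⟩ := exists_descent w hne
    have := invSet_mul' w hij h
    obtain ⟨l, hl, hp, hk⟩ := ih (w * Equiv.swap i j) (by omega)
    refine ⟨l ++ [Equiv.swap i j], ?_, ?_, by simp [hk]⟩
    · intro s hs
      rcases List.mem_append.mp hs with hs | hs
      · exact hl s hs
      · rw [List.mem_singleton] at hs; exact ⟨i, j, hij, hs⟩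
    · rw [List.prod_append, hp, List.prod_singleton, mul_assoc, Equiv.swap_mul_self, mul_one]

/-- The length of a permutation is its number of inversions. -/
theorem len_eq {r : ℕ} (w : Equiv.Perm (Fin r)) : len w = (invSet w).card := by
  apply le_antisymm
  · exact Nat.sInf_le (exists_word _ w rfl)
  · have hn : {k | ∃ l : List (Equiv.Perm (Fin r)),
      (∀ s ∈ l, s ∈ simpleTransp r) ∧ l.prod = w ∧ l.length = k}.Nonempty :=
      ⟨_, exists_word _ w rfl⟩
    obtain ⟨l, hl, hp, hk⟩ := Nat.sInf_mem hn
    have := invSet_prod_le l hl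
    rw [hp] at this
    exact this.trans hk.le

theorem len_inv {r : ℕ} (w : Equiv.Perm (Fin r)) : len w⁻¹ = len w := by
  rw [len_eq, len_eq]
  refine Finset.card_bij' (fun p _ => (w⁻¹ p.2, w⁻¹ p.1)) (fun p _ => (w p.2, w p.1)) ?_ ?_ ?_ ?_
  all_goals simp +contextual [invSet]

theorem len_lt_mul_swap {r : ℕ} (w : Equiv.Perm (Fin r)) {i j : Fin r}
    (hij : j.val = i.val + 1) : len w < len (w * Equiv.swap i j) ↔ w i < w j := by
  rw [len_eq, len_eq]
  have hne : w i ≠ w j := fun h => by have := w.injective h; subst this; omega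
  constructor
  · intro h
    by_contra hc
    have := invSet_mul' w hij (lt_of_le_of_ne (not_lt.mp hc) hne.symm)
    omega
  · intro h
    rw [invSet_mul w hij h]; omega

theorem len_lt_swap_mul {r : ℕ} (w : Equiv.Perm (Fin r)) {i j : Fin r}
    (hij : j.val = i.val + 1) : len w < len (Equiv.swap i j * w) ↔ w⁻¹ i < w⁻¹ j := by
  rw [← len_lt_mul_swap w⁻¹ hij, len_inv, ← len_inv (w⁻¹ * _)]
  simp

/-- Every permutation is reached from the identity through basic transpositions. -/
theorem perm_induction {r : ℕ} {P : Equiv.Perm (Fin r) → Prop} (h1 : P 1)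
    (hs : ∀ w, ∀ s ∈ simpleTransp r, P w → P (w * s)) (w : Equiv.Perm (Fin r)) : P w := by
  obtain ⟨l, hl, hp, -⟩ := exists_word _ w rfl
  rw [← hp]
  clear hp
  induction l using List.reverseRecOn with
  | nil => simpa using h1
  | append_singleton l s ih =>
    rw [List.prod_append, List.prod_singleton]
    exact hs _ _ (hl s (by simp)) (ih fun t ht => hl t (by simp [ht]))

/-- Right multiplication by `T_s` on the free module with basis indexed by permutations. -/
noncomputable def rightOp {R : Type*} [CommRing R] (q : Rˣ) {r : ℕ} (s : Equiv.Perm (Fin r)) :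
    Module.End R (Equiv.Perm (Fin r) →₀ R) :=
  Finsupp.linearCombination R fun w =>
    if len w < len (w * s) then Finsupp.single (w * s) 1
    else Finsupp.single w ((q : R) - 1) + Finsupp.single (w * s) (q : R)

/-- Left multiplication by `T_s` on the free module with basis indexed by permutations. -/
noncomputable def leftOp {R : Type*} [CommRing R] (q : Rˣ) {r : ℕ} (s : Equiv.Perm (Fin r)) :
    Module.End R (Equiv.Perm (Fin r) →₀ R) :=
  Finsupp.linearCombination R fun w =>
    if len w < len (s * w) then Finsupp.single (s * w) 1
    else Finsupp.single w ((q : R) - 1) + Finsupp.single (s * w) (q : R)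

theorem rightOp_single {R : Type*} [CommRing R] (q : Rˣ) {r : ℕ} (s w : Equiv.Perm (Fin r))
    (c : R) : rightOp q s (Finsupp.single w c) = if len w < len (w * s) then
      Finsupp.single (w * s) c
      else Finsupp.single w (c * ((q : R) - 1)) + Finsupp.single (w * s) (c * (q : R)) := by
  rw [rightOp, Finsupp.linearCombination_single]
  split_ifs
  · rw [Finsupp.smul_single, smul_eq_mul, mul_one]
  · rw [smul_add, Finsupp.smul_single, Finsupp.smul_single, smul_eq_mul, smul_eq_mul]

theorem leftOp_single {R : Type*} [CommRing R] (q : Rˣ) {r : ℕ} (s w : Equiv.Perm (Fin r))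
    (c : R) : leftOp q s (Finsupp.single w c) = if len w < len (s * w) then
      Finsupp.single (s * w) c
      else Finsupp.single w (c * ((q : R) - 1)) + Finsupp.single (s * w) (c * (q : R)) := by
  rw [leftOp, Finsupp.linearCombination_single]
  split_ifs
  · rw [Finsupp.smul_single, smul_eq_mul, mul_one]
  · rw [smul_add, Finsupp.smul_single, Finsupp.smul_single, smul_eq_mul, smul_eq_mul]

theorem swap_lt_iff {r : ℕ} {i j : Fin r} (hij : j.val = i.val + 1) {a b : Fin r}
    (h1 : ¬ (a = i ∧ b = j)) (h2 : ¬ (a = j ∧ b = i)) :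
    Equiv.swap i j a < Equiv.swap i j b ↔ a < b := by
  rcases lt_trichotomy a b with h | h | h
  · exact iff_of_true (swap_lt hij h h1) h
  · subst h; simp
  · exact iff_of_false (swap_lt hij h fun hc => h2 ⟨hc.2, hc.1⟩).not_gt h.not_gt

theorem left_right_comm {R : Type*} [CommRing R] (q : Rˣ) {r : ℕ} {s t : Equiv.Perm (Fin r)}
    (hs : s ∈ simpleTransp r) (ht : t ∈ simpleTransp r) :
    leftOp q s * rightOp q t = rightOp q t * leftOp q s := by
  have hss : s * s = 1 := by obtain ⟨i, j, -, rfl⟩ := hs; exact Equiv.swap_mul_self i j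
  have htt : t * t = 1 := by obtain ⟨i, j, -, rfl⟩ := ht; exact Equiv.swap_mul_self i j
  have hcase : ∀ w : Equiv.Perm (Fin r), s * w ≠ w * t →
      ((len w < len (s * w) ↔ len (w * t) < len (s * (w * t))) ∧
       (len w < len (w * t) ↔ len (s * w) < len (s * w * t))) := by
    obtain ⟨i, j, hij, rfl⟩ := hs
    obtain ⟨a, b, hab, rfl⟩ := ht
    intro w hw
    have hk1 : ¬ (w a = i ∧ w b = j) := fun h => hw (by
      rw [← h.1, ← h.2, ← Equiv.mul_swap_eq_swap_mul])
    have hk2 : ¬ (w a = j ∧ w b = i) := fun h => hw (by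
      rw [← h.1, ← h.2, Equiv.swap_comm (w b), ← Equiv.mul_swap_eq_swap_mul])
    constructor
    · rw [len_lt_swap_mul _ hij, len_lt_swap_mul _ hij, mul_inv_rev, Equiv.swap_inv,
        Equiv.Perm.mul_apply, Equiv.Perm.mul_apply, swap_lt_iff hab]
      · rintro ⟨h1, h2⟩; exact hk1 ⟨by rw [← h1]; simp, by rw [← h2]; simp⟩
      · rintro ⟨h1, h2⟩; exact hk2 ⟨by rw [← h2]; simp, by rw [← h1]; simp⟩
    · rw [len_lt_mul_swap _ hab, len_lt_mul_swap _ hab,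
        Equiv.Perm.mul_apply, Equiv.Perm.mul_apply, swap_lt_iff hij]
      · exact hk1
      · exact hk2
  refine Finsupp.lhom_ext fun w c => ?_
  rw [Module.End.mul_apply, Module.End.mul_apply]
  by_cases hw : s * w = w * t
  · have e1 : ∀ c, leftOp q s (Finsupp.single w c) = rightOp q t (Finsupp.single w c) := by
      intro c; rw [leftOp_single, rightOp_single, hw]
    have hw' : s * (w * t) = w * t * t := by
      rw [← hw, ← mul_assoc, hss, one_mul, hw, mul_assoc, htt, mul_one]
    have e2 : ∀ c, leftOp q s (Finsupp.single (w * t) c) =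
        rightOp q t (Finsupp.single (w * t) c) := by
      intro c; rw [leftOp_single, rightOp_single, hw']
    rw [e1 c, rightOp_single]
    split_ifs
    · exact e2 c
    · rw [map_add, map_add, e1, e2]
  · obtain ⟨h1, h2⟩ := hcase w hw
    rw [mul_assoc] at h2
    rw [leftOp_single, rightOp_single]
    by_cases c1 : len w < len (s * w) <;> by_cases c2 : len w < len (w * t) <;>
      have d1 := c1 <;> have d2 := c2 <;> rw [h1] at d1 <;> rw [h2] at d2 <;>
      simp only [c1, c2, if_true, if_false, map_add, leftOp_single, rightOp_single, d1, d2,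
        mul_assoc]
    rw [mul_comm (q : R) ((q : R) - 1)]
    abel

/-- Operators commuting with all right multiplications are determined by their value at `1`. -/
theorem right_ext {R : Type*} [CommRing R] {q : Rˣ} {r : ℕ}
    {f g : Module.End R (Equiv.Perm (Fin r) →₀ R)}
    (hf : f ∈ Subalgebra.centralizer R (rightOp q '' simpleTransp r))
    (hg : g ∈ Subalgebra.centralizer R (rightOp q '' simpleTransp r))
    (h : f (Finsupp.single 1 1) = g (Finsupp.single 1 1)) : f = g := by
  rw [Subalgebra.mem_centralizer_iff] at hf hg
  have key : ∀ w : Equiv.Perm (Fin r), f (Finsupp.single w 1) = g (Finsupp.single w 1) := by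
    refine perm_induction h fun w s hs hw => ?_
    have hc : f (rightOp q s (Finsupp.single w 1)) = g (rightOp q s (Finsupp.single w 1)) := by
      have h1 := LinearMap.congr_fun (hf _ ⟨s, hs, rfl⟩) (Finsupp.single w 1)
      have h2 := LinearMap.congr_fun (hg _ ⟨s, hs, rfl⟩) (Finsupp.single w 1)
      rw [Module.End.mul_apply, Module.End.mul_apply] at h1 h2
      rw [← h1, ← h2, hw]
    rw [rightOp_single] at hc
    split_ifs at hc
    · exact hc
    · rw [map_add, map_add, one_mul, one_mul] at hc
      have e1 : ∀ c : R, (Finsupp.single w c : Equiv.Perm (Fin r) →₀ R) =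
          c • Finsupp.single w 1 := fun c => by simp
      have e2 : ∀ c : R, (Finsupp.single (w * s) c : Equiv.Perm (Fin r) →₀ R) =
          c • Finsupp.single (w * s) 1 := fun c => by simp
      rw [e1, e2, map_smul, map_smul, map_smul, map_smul, hw] at hc
      have := add_left_cancel hc
      have h3 := congrArg (fun x => (↑q⁻¹ : R) • x) this
      simpa only [smul_smul, Units.inv_mul, one_smul] using h3
  refine Finsupp.lhom_ext fun w c => ?_
  have e1 : (Finsupp.single w c : Equiv.Perm (Fin r) →₀ R) = c • Finsupp.single w 1 := by simp
  rw [e1, map_smul, map_smul, key]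

theorem left_mem {R : Type*} [CommRing R] (q : Rˣ) {r : ℕ} {s : Equiv.Perm (Fin r)}
    (hs : s ∈ simpleTransp r) :
    leftOp q s ∈ Subalgebra.centralizer R (rightOp q '' simpleTransp r) := by
  rw [Subalgebra.mem_centralizer_iff]
  rintro _ ⟨t, ht, rfl⟩
  exact (left_right_comm q hs ht).symm

theorem exists_op {R : Type*} [CommRing R] (q : Rˣ) {r : ℕ} (x : Equiv.Perm (Fin r) →₀ R) :
    ∃ f ∈ Subalgebra.centralizer R (rightOp q '' simpleTransp r),
      f (Finsupp.single 1 1) = x := by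
  have key : ∀ w : Equiv.Perm (Fin r),
      ∃ f ∈ Subalgebra.centralizer R (rightOp q '' simpleTransp r),
        f (Finsupp.single 1 1) = Finsupp.single w⁻¹ 1 := by
    refine perm_induction ⟨1, one_mem _, by simp⟩ fun w s hs hw => ?_
    obtain ⟨f, hf, hfw⟩ := hw
    have hss : s⁻¹ = s := by obtain ⟨i, j, -, rfl⟩ := hs; exact Equiv.swap_inv i j
    have hv : leftOp q s (f (Finsupp.single 1 1)) = if len w⁻¹ < len (s * w⁻¹) then
        Finsupp.single (s * w⁻¹) 1
        else Finsupp.single w⁻¹ ((q : R) - 1) + Finsupp.single (s * w⁻¹) (q : R) := by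
      rw [hfw, leftOp_single, one_mul, one_mul]
    rw [mul_inv_rev, hss]
    split_ifs at hv
    · exact ⟨leftOp q s * f, mul_mem (left_mem q hs) hf, hv⟩
    · have hg : leftOp q s * f + (1 - (q : R)) • f ∈
          Subalgebra.centralizer R (rightOp q '' simpleTransp r) :=
        add_mem (mul_mem (left_mem q hs) hf) (Subalgebra.smul_mem _ hf _)
      refine ⟨(↑q⁻¹ : R) • (leftOp q s * f + (1 - (q : R)) • f),
        Subalgebra.smul_mem _ hg _, ?_⟩
      rw [LinearMap.smul_apply, LinearMap.add_apply, Module.End.mul_apply, hv,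
        LinearMap.smul_apply, hfw, Finsupp.smul_single, smul_eq_mul, mul_one,
        add_right_comm, ← Finsupp.single_add, sub_add_sub_cancel, sub_self, Finsupp.single_zero,
        zero_add, Finsupp.smul_single, smul_eq_mul, Units.inv_mul]
  induction x using Finsupp.induction_linear with
  | zero => exact ⟨0, zero_mem _, rfl⟩
  | add x y hx hy =>
    obtain ⟨f, hf, rfl⟩ := hx
    obtain ⟨g, hg, rfl⟩ := hy
    exact ⟨f + g, add_mem hf hg, rfl⟩
  | single w c =>
    obtain ⟨f, hf, hfw⟩ := key w⁻¹
    exact ⟨c • f, Subalgebra.smul_mem _ hf _, by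
      rw [LinearMap.smul_apply, hfw, inv_inv, Finsupp.smul_single, smul_eq_mul, mul_one]⟩

/-- The Hecke algebra of the symmetric group on `r` letters: the free `R`-module with basis
`T_w` (`w` a permutation). Its multiplication is introduced below; `Hecke.T_mul_T` shows that it
is the one given by the usual rules for `T_w T_s`, which determine it. -/
def Hecke (R : Type*) [CommRing R] (_q : Rˣ) (r : ℕ) : Type _ := Equiv.Perm (Fin r) →₀ R

namespace Hecke

variable {R : Type*} [CommRing R] {q : Rˣ} {r : ℕ}

noncomputable instance : AddCommGroup (Hecke R q r) :=
  inferInstanceAs (AddCommGroup (Equiv.Perm (Fin r) →₀ R))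

noncomputable instance : Module R (Hecke R q r) :=
  inferInstanceAs (Module R (Equiv.Perm (Fin r) →₀ R))

/-- The basis `T_w` of the Hecke algebra. -/
noncomputable def T (R : Type*) [CommRing R] (q : Rˣ) (r : ℕ) :
    Module.Basis (Equiv.Perm (Fin r)) R (Hecke R q r) :=
  Module.Basis.ofRepr (LinearEquiv.refl R (Equiv.Perm (Fin r) →₀ R))

/-- Left multiplication by `x`: the unique operator commuting with the right multiplications by
all `T_s` and sending `T_1` to `x`. -/
noncomputable def op (x : Hecke R q r) : Module.End R (Equiv.Perm (Fin r) →₀ R) :=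
  (exists_op q x).choose

theorem op_mem (x : Hecke R q r) :
    op x ∈ Subalgebra.centralizer R (rightOp q '' simpleTransp r) :=
  (exists_op q x).choose_spec.1

theorem op_one (x : Hecke R q r) : op x (Finsupp.single 1 1) = x :=
  (exists_op q x).choose_spec.2

theorem op_eq {x : Hecke R q r} {f : Module.End R (Equiv.Perm (Fin r) →₀ R)}
    (hf : f ∈ Subalgebra.centralizer R (rightOp q '' simpleTransp r))
    (h : f (Finsupp.single 1 1) = x) : op x = f :=
  right_ext (op_mem x) hf ((op_one x).trans h.symm)

noncomputable instance : One (Hecke R q r) :=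
  ⟨(Finsupp.single 1 1 : Equiv.Perm (Fin r) →₀ R)⟩

noncomputable instance : Mul (Hecke R q r) := ⟨fun x y => op x y⟩

theorem mul_def (x y : Hecke R q r) : x * y = op x y := rfl

theorem op_mul (x y : Hecke R q r) : op (x * y) = op x * op y :=
  op_eq (mul_mem (op_mem x) (op_mem y)) (by rw [Module.End.mul_apply, op_one, mul_def])

theorem op_add (x y : Hecke R q r) : op (x + y) = op x + op y :=
  op_eq (add_mem (op_mem x) (op_mem y)) (by rw [LinearMap.add_apply, op_one, op_one]; rfl)

theorem op_smul (c : R) (x : Hecke R q r) : op (c • x) = c • op x :=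
  op_eq (Subalgebra.smul_mem _ (op_mem x) c) (by rw [LinearMap.smul_apply, op_one]; rfl)

theorem op_one_eq : op (1 : Hecke R q r) = 1 := op_eq (one_mem _) rfl

theorem op_zero : op (0 : Hecke R q r) = 0 := op_eq (zero_mem _) rfl

noncomputable instance : Ring (Hecke R q r) :=
  { (inferInstance : AddCommGroup (Hecke R q r)) with
    mul := (· * ·)
    one := 1
    mul_assoc := fun x y z => LinearMap.congr_fun (op_mul x y) z
    one_mul := fun x => LinearMap.congr_fun op_one_eq x
    mul_one := fun x => op_one x
    left_distrib := fun x y z => map_add (op x) y z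
    right_distrib := fun x y z => LinearMap.congr_fun (op_add x y) z
    zero_mul := fun x => LinearMap.congr_fun op_zero x
    mul_zero := fun x => map_zero (op x) }

noncomputable instance : Algebra R (Hecke R q r) :=
  Algebra.ofModule
    (fun c x y => LinearMap.congr_fun (op_smul c x) y)
    (fun c x y => map_smul (op x) c y)

/-- The unit of the Hecke algebra is `T_1`. -/
theorem T_one : T R q r 1 = 1 := rfl

/-- The defining rules of the Hecke algebra. -/
theorem T_mul_T (w s : Equiv.Perm (Fin r)) (hs : s ∈ simpleTransp r) :
    T R q r w * T R q r s =
      if len w < len (w * s) then T R q r (w * s)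
      else ((q : R) - 1) • T R q r w + (q : R) • T R q r (w * s) := by
  have e : ∀ v : Equiv.Perm (Fin r), ∀ c : R,
      c • T R q r v = (Finsupp.single v c : Equiv.Perm (Fin r) →₀ R) := fun v c =>
    (Finsupp.smul_single c v (1 : R)).trans (by rw [smul_eq_mul, mul_one])
  have e1 : ∀ v : Equiv.Perm (Fin r),
      T R q r v = (Finsupp.single v 1 : Equiv.Perm (Fin r) →₀ R) := fun v => rfl
  have h1 : len (1 : Equiv.Perm (Fin r)) < len (1 * s) := by
    obtain ⟨i, j, hij, rfl⟩ := hs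
    rw [len_lt_mul_swap 1 hij, Fin.lt_def, Equiv.Perm.one_apply, Equiv.Perm.one_apply]
    omega
  have h2 : rightOp q s (Finsupp.single 1 1) = (Finsupp.single s 1) := by
    rw [rightOp_single, if_pos h1, one_mul]
  have h3 := LinearMap.congr_fun ((Subalgebra.mem_centralizer_iff R).mp (op_mem (T R q r w)) _
    ⟨s, hs, rfl⟩) (Finsupp.single 1 1)
  rw [Module.End.mul_apply, Module.End.mul_apply, h2, op_one] at h3
  refine h3.symm.trans ((congrArg _ (e1 w)).trans ?_)
  rw [rightOp_single, one_mul, one_mul, e, e, e1]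
  rfl

end Hecke

/-- The interval `ℕ_i^l` of the composition `l`: with letters numbered from `0`, the `x` with
`l_0 + ⋯ + l_{i-1} ≤ x < l_0 + ⋯ + l_i`. -/
def block {N : ℕ} (r : ℕ) (l : Fin N → ℕ) (i : Fin N) : Finset (Fin r) :=
  Finset.univ.filter fun x => ∑ j ∈ Finset.Iio i, l j ≤ x.val ∧ x.val < ∑ j ∈ Finset.Iic i, l j

/-- The parabolic subgroup `W_l`: permutations leaving every interval `ℕ_i^l` invariant. -/
def young {N : ℕ} (r : ℕ) (l : Fin N → ℕ) : Subgroup (Equiv.Perm (Fin r)) where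
  carrier := {w | ∀ i, ∀ x, w x ∈ block r l i ↔ x ∈ block r l i}
  mul_mem' := fun ha hb i x => (ha i _).trans (hb i x)
  one_mem' := fun _ _ => Iff.rfl
  inv_mem' := fun {a} ha i x => by simpa using (ha i (a⁻¹ x)).symm

/-- The number `|l^(0)|` of even letters: the sum of the first `m` parts. -/
def evenSize {m n : ℕ} (l : Fin (m + n) → ℕ) : ℕ :=
  ∑ i ∈ Finset.univ.filter fun i : Fin (m + n) => i.val < m, l i

/-- The even part `W_{l^(0)}` of `W_l`, acting on the letters `< |l^(0)|` only. -/
def youngEven {m n : ℕ} (r : ℕ) (l : Fin (m + n) → ℕ) : Subgroup (Equiv.Perm (Fin r)) :=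
  young r l ⊓ fixingSubgroup (Equiv.Perm (Fin r)) {x : Fin r | evenSize l ≤ x.val}

/-- The odd part `W_{l^(1)}` of `W_l`, acting on the letters `≥ |l^(0)|` only. -/
def youngOdd {m n : ℕ} (r : ℕ) (l : Fin (m + n) → ℕ) : Subgroup (Equiv.Perm (Fin r)) :=
  young r l ⊓ fixingSubgroup (Equiv.Perm (Fin r)) {x : Fin r | x.val < evenSize l}

/-- The conjugate `P^d = d⁻¹ P d`. -/
def conjBy {r : ℕ} (P : Subgroup (Equiv.Perm (Fin r))) (d : Equiv.Perm (Fin r)) :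
    Subgroup (Equiv.Perm (Fin r)) :=
  P.comap (MulAut.conj d).toMonoidHom

/-- `𝒟_P`: the shortest representatives of the right cosets `P w`. -/
def minReps {r : ℕ} (P : Subgroup (Equiv.Perm (Fin r))) : Set (Equiv.Perm (Fin r)) :=
  {d | ∀ u ∈ P, len d ≤ len (u * d)}

/-- The set `𝒟°_{lμ}` of those shortest `W_l`-`W_μ` double coset representatives `d` for which
`W_{l^(0)}^d ∩ W_{μ^(1)}` and `W_{l^(1)}^d ∩ W_{μ^(0)}` are trivial. -/
def superReps {m n : ℕ} (r : ℕ) (l μ : Fin (m + n) → ℕ) : Set (Equiv.Perm (Fin r)) :=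
  {d | d ∈ minReps (young r l) ∧ d⁻¹ ∈ minReps (young r μ) ∧
    conjBy (youngEven r l) d ⊓ youngOdd r μ = ⊥ ∧ conjBy (youngOdd r l) d ⊓ youngEven r μ = ⊥}

/-- The matrix `(|ℕ_i^l ∩ d(ℕ_j^μ)|)_{i,j}`. -/
def jmath {N r : ℕ} (l : Fin N → ℕ) (d : Equiv.Perm (Fin r)) (μ : Fin N → ℕ) :
    Matrix (Fin N) (Fin N) ℕ :=
  Matrix.of fun i j => (block r l i ∩ (block r μ j).map d.toEmbedding).card

/-- `Λ(m|n,r)`: the compositions of `r` into `m + n` parts. -/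
abbrev Comps (m n r : ℕ) : Type := {l : Fin (m + n) → ℕ // ∑ i, l i = r}

/-- The set of matrices `M(m|n,r)`. -/
def superMat (m n r : ℕ) : Set (Matrix (Fin (m + n)) (Fin (m + n)) ℕ) :=
  {A | ∃ l μ : Comps m n r, ∃ d ∈ superReps r l.1 μ.1, jmath l.1 d μ.1 = A}

section Algebra

variable {R : Type*} [CommRing R]

open scoped Classical in
/-- `T_D = ∑ T_{w₀} (-q)^{-ℓ(w₁)} T_{w₁}`, over `w₀ ∈ D ∩ W_{l^(0)}` and `w₁ ∈ D ∩ W_{l^(1)}`. -/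
noncomputable def superSum (q : Rˣ) {m n : ℕ} (r : ℕ) (l : Fin (m + n) → ℕ)
    (D : Set (Equiv.Perm (Fin r))) : Hecke R q r :=
  ∑ w₀ ∈ Finset.univ.filter fun w => w ∈ D ∧ w ∈ youngEven r l,
    ∑ w₁ ∈ Finset.univ.filter fun w => w ∈ D ∧ w ∈ youngOdd r l,
      (((-q) ^ (-(len w₁ : ℤ)) : Rˣ) : R) • (Hecke.T R q r w₀ * Hecke.T R q r w₁)

open scoped Classical in
/-- `[xy]_l = x_{l^(0)} y_{l^(1)}`. -/
noncomputable def xy (q : Rˣ) {m n : ℕ} (r : ℕ) (l : Fin (m + n) → ℕ) : Hecke R q r :=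
  (∑ w ∈ Finset.univ.filter fun w => w ∈ youngEven r l, Hecke.T R q r w) *
    ∑ w ∈ Finset.univ.filter fun w => w ∈ youngOdd r l,
      (((-q) ^ (-(len w : ℤ)) : Rˣ) : R) • Hecke.T R q r w

/-- The right `ℋ`-module `[xy]_l ℋ`. -/
noncomputable def xyMod (q : Rˣ) {m n : ℕ} (r : ℕ) (l : Fin (m + n) → ℕ) :
    Submodule (Hecke R q r)ᵐᵒᵖ (Hecke R q r) :=
  Submodule.span _ {xy q r l}

theorem xy_mul_mem (q : Rˣ) {m n : ℕ} (r : ℕ) (l : Fin (m + n) → ℕ) (h : Hecke R q r) :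
    xy q r l * h ∈ xyMod q r l :=
  Submodule.smul_mem _ (MulOpposite.op h) (Submodule.mem_span_singleton_self _)

/-- The tensor space: the right `ℋ`-module `⨁_l [xy]_l ℋ`, over all `l ∈ Λ(m|n,r)`. -/
abbrev TensorSpace (q : Rˣ) (m n r : ℕ) : Type _ :=
  DirectSum (Comps m n r) fun l => xyMod q r l.1

/-- The `q`-Schur superalgebra: the endomorphisms of the tensor space as a right `ℋ`-module. -/
abbrev QSchur (q : Rˣ) (m n r : ℕ) : Type _ :=
  Module.End (Hecke R q r)ᵐᵒᵖ (TensorSpace q m n r)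

/-- `T_{W_l d W_μ} = [xy]_l T_d T_{𝒟_ν ∩ W_μ}`, where `W_ν = W_l^d ∩ W_μ`. -/
noncomputable def dcSum (q : Rˣ) {m n r : ℕ} (l : Fin (m + n) → ℕ) (d : Equiv.Perm (Fin r))
    (μ : Fin (m + n) → ℕ) : Hecke R q r :=
  xy q r l * (Hecke.T R q r d *
    superSum q r μ (minReps (conjBy (young r l) d ⊓ young r μ) ∩ young r μ))

theorem dcSum_mul_mem (q : Rˣ) {m n r : ℕ} (l : Fin (m + n) → ℕ) (d : Equiv.Perm (Fin r))
    (μ : Fin (m + n) → ℕ) (h : Hecke R q r) : dcSum q l d μ * h ∈ xyMod q r l := by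
  rw [dcSum, mul_assoc]
  exact xy_mul_mem q r l _

/-- `f` is the endomorphism `φ_{lμ}^d`: it sends `[xy]_α h` to `δ_{μ,α} T_{W_l d W_μ} h`. -/
def IsPhi (q : Rˣ) {m n r : ℕ} (l : Comps m n r) (d : Equiv.Perm (Fin r)) (μ : Comps m n r)
    (f : QSchur q m n r) : Prop :=
  ∀ (α : Comps m n r) (h : Hecke R q r),
    f (DirectSum.lof (Hecke R q r)ᵐᵒᵖ (Comps m n r) (fun l => xyMod q r l.1) α
        ⟨xy q r α.1 * h, xy_mul_mem q r α.1 h⟩) =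
      if α = μ then DirectSum.lof (Hecke R q r)ᵐᵒᵖ (Comps m n r) (fun l => xyMod q r l.1) l
        ⟨dcSum q l.1 d μ.1 * h, dcSum_mul_mem q l.1 d μ.1 h⟩
      else 0

/-- `f` is the endomorphism `φ_A`, i.e. `φ_{lμ}^d` for the triple `(l,d,μ)` with matrix `A`. -/
def IsPhiMat (q : Rˣ) {m n r : ℕ} (A : Matrix (Fin (m + n)) (Fin (m + n)) ℕ)
    (f : QSchur q m n r) : Prop :=
  ∀ (l μ : Comps m n r), ∀ d ∈ superReps r l.1 μ.1, jmath l.1 d μ.1 = A → IsPhi q l d μ f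

open scoped Classical in
/-- The element `φ_A` for `A ∈ M(m|n,r)`, and `0` for any other matrix. -/
noncomputable def phi (q : Rˣ) {m n : ℕ} (r : ℕ) (A : Matrix (Fin (m + n)) (Fin (m + n)) ℕ) :
    QSchur q m n r :=
  if h : A ∈ superMat m n r ∧ ∃ f : QSchur q m n r, IsPhiMat q A f then h.2.choose else 0

end Algebra

/-- The parity function. -/
def parity {m n : ℕ} (h : Fin (m + n)) : ℕ := if h.val < m then 0 else 1

/-- `Â = ∑ a_{i,j} a_{k,l}` over odd indices `k < i` and over `j < l`. -/
def hatSign {m n : ℕ} (A : Matrix (Fin (m + n)) (Fin (m + n)) ℕ) : ℕ :=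
  ∑ i, ∑ k, ∑ j, ∑ l, if m ≤ k.val ∧ k < i ∧ j < l then A i j * A k l else 0

/-- `d(A) = ∑_{i>k, j<l} a_{i,j} a_{k,l} + ∑_{i, j<l} (-1)^{î} a_{i,j} a_{i,l}`. -/
def dExp {m n : ℕ} (A : Matrix (Fin (m + n)) (Fin (m + n)) ℕ) : ℤ :=
  (∑ i, ∑ k, ∑ j, ∑ l, if k < i ∧ j < l then (A i j : ℤ) * A k l else 0) +
    ∑ i, ∑ j, ∑ l, if j < l then (-1) ^ parity i * ((A i j : ℤ) * A i l) else 0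

/-- The normalised element `[A] = (-1)^Â υ^{-d(A)} φ_A`. -/
noncomputable def brk {R : Type*} [CommRing R] (υ : Rˣ) {m n : ℕ} (r : ℕ)
    (A : Matrix (Fin (m + n)) (Fin (m + n)) ℕ) : QSchur (υ ^ 2) m n r :=
  (((-1) ^ hatSign A * υ ^ (-dExp A) : Rˣ) : R) • phi (υ ^ 2) r A

/-- `υ_h` is `υ` for even `h` and `υ⁻¹` for odd `h`. -/
def upsilon {R : Type*} [CommRing R] (υ : Rˣ) {m n : ℕ} (h : Fin (m + n)) : Rˣ :=
  if h.val < m then υ else υ⁻¹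

/-- `⟦k⟧_x = 1 + x + ⋯ + x^{k-1}`. -/
def gaussInt {R : Type*} [CommRing R] (x : R) (k : ℕ) : R := ∑ i ∈ Finset.range k, x ^ i

/-- `⟦k⟧_{u²}` with the bar involution `u ↦ u⁻¹` applied, i.e. `1 + u^{-2} + ⋯ + u^{-2(k-1)}`. -/
def gaussBar {R : Type*} [CommRing R] (u : Rˣ) (k : ℕ) : R :=
  gaussInt (((u⁻¹ : Rˣ) : R) ^ 2) k

/-- `ro(A)`, the sequence of row sums. -/
def ro {N : ℕ} (A : Matrix (Fin N) (Fin N) ℕ) (i : Fin N) : ℕ := ∑ j, A i j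

/-- `co(A)`, the sequence of column sums. -/
def co {N : ℕ} (A : Matrix (Fin N) (Fin N) ℕ) (j : Fin N) : ℕ := ∑ i, A i j

/-- `D - E_{a,b}` is a diagonal matrix (with entries in `ℕ`) and `co(D) = ro(A)`. -/
def IsElem {N : ℕ} (A D : Matrix (Fin N) (Fin N) ℕ) (a b : Fin N) : Prop :=
  (∃ x : Fin N → ℕ, D = Matrix.diagonal x + Matrix.single a b 1) ∧ co D = ro A

/-- `A + E_{a,k} - E_{b,k}`, used for `a ≠ b` and `A b k ≥ 1`. -/
def moveEntry {N : ℕ} (A : Matrix (Fin N) (Fin N) ℕ) (a b k : Fin N) :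
    Matrix (Fin N) (Fin N) ℕ :=
  A + Matrix.single a k 1 - Matrix.single b k 1

/-- `ε_{h,k}`, for `h` numbered from `0`: `∑_{i odd, j<k} a_{i,j}` if `h` is the last even index,
and `0` otherwise. -/
def epsSign {m n : ℕ} (A : Matrix (Fin (m + n)) (Fin (m + n)) ℕ) (h k : Fin (m + n)) : ℕ :=
  if h.val + 1 = m then
    ∑ i ∈ Finset.univ.filter fun i : Fin (m + n) => m ≤ i.val, ∑ j ∈ Finset.Iio k, A i j
  else 0

/-- `f^+_{h,k} = ∑_{j≥k} a_{h,j} - (-1)^{ĥ+ĥ'} ∑_{j>k} a_{h',j}`, where `h' = h + 1`. -/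
def fPlus {m n : ℕ} (A : Matrix (Fin (m + n)) (Fin (m + n)) ℕ) (h h' k : Fin (m + n)) : ℤ :=
  ∑ j ∈ Finset.Ici k, (A h j : ℤ) -
    (-1) ^ (parity h + parity h') * ∑ j ∈ Finset.Ioi k, (A h' j : ℤ)

/-- `f^-_{h,k} = ∑_{j≤k} a_{h',j} - (-1)^{ĥ+ĥ'} ∑_{j<k} a_{h,j}`, where `h' = h + 1`. -/
def fMinus {m n : ℕ} (A : Matrix (Fin (m + n)) (Fin (m + n)) ℕ) (h h' k : Fin (m + n)) : ℤ :=
  ∑ j ∈ Finset.Iic k, (A h' j : ℤ) -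
    (-1) ^ (parity h + parity h') * ∑ j ∈ Finset.Iio k, (A h j : ℤ)

end QSchurSuper

open QSchurSuper

/-!
Words in the `m + n` colours give bases of all the modules involved. A coset of `W_l` is a word
`f = col l ∘ w` in the colours, and the right ideal `[xy]_l ℋ` is spanned by elements
`wordSum q l f` on which `T_s` acts by exchanging two neighbouring letters, with eigenvalue `heckeChar` (`q` in even
and `-1` in odd colours) if the two letters agree. A matrix `A` is the joint content of such a word
and of the word `col μ`; the condition that `A` lies in `M(m|n,r)` only says that the entries at
positions of mixed parity are at most `1` (`mem_superMat_iff`). The element `T_{W_l d W_μ}` is then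
`matSum q l μ A`, the signed sum of all words that have the matrix `A` of `d` (`dcSum_eq_matSum`).

*Existence of `φ_A`.* The group `W_μ` acts on `matSum q l μ A` by the same character as on `[xy]_μ`
(`matSum_mul_T`); the bound on the mixed entries is what makes this true, because two equal letters
inside one block of `μ` then have the parity of the block. An element of `ℋ` with this property is a
left multiple `z [xy]_μ` (`exists_mul_xy_eq`), so `φ_A` is left multiplication by `z`.

*The product.* For `D - E_{t,p}` diagonal with `t`, `p` neighbours, `φ_D` sends the word `col l` to
the sum `shiftSum` of all words in which one letter has changed its colour from `p` to `t`, each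
with the weight that the iterated coproduct of a quantum group gives to a root vector. This operator
commutes with the right action of `ℋ` (`shiftSum_mul_T_of_lt`), hence has the same form on every
word (`mul_wordSum_eq_shiftSum`). Apply it to the sum of the words of matrix `A`, and collect the
pairs of a word and a moved letter by the column `k` of the letter and by the resulting word: the
weights are a factor depending on `A` and `k` times the terms of a geometric progression
(`weight_eq`), which add up to a Gaussian integer (`sum_shiftSum`). If the moved matrix is not in
`M(m|n,r)`, the entry that is too large is `2` at a position of mixed parity, where the progression
has ratio `-1`; so the Gaussian integer is `1 - 1 = 0` (`gaussInt_innerWeight`), in accordance with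
the convention `[A] = 0`. This gives the product formula `phi_mul_phi`.

*Normalisation.* The exponents `d(A)` and `Â` are quadratic forms in the entries of `A`, and the
change under `A ↦ A + E_{t,k} - E_{p,k}` is linear in the partial row sums beside the column `k`
(`quadForm_moveEntry`). Comparing powers of `υ` and signs, separately for two even rows, two odd
rows and the two rows at the boundary, gives the stated coefficients.
-/

namespace QSchurSuper

/-! ### Permutations that are increasing on prescribed sets -/

/-- Multiplying by a transposition that removes an inversion strictly decreases the length. -/
theorem len_mul_swap_lt {r : ℕ} (w : Equiv.Perm (Fin r)) {a b : Fin r} (hab : a < b)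
    (hw : w b < w a) : len (w * Equiv.swap a b) < len w := by
  rw [len_eq, len_eq]
  set s := Equiv.swap a b with hs
  have hss : ∀ x, s (s x) = x := Equiv.swap_apply_self a b
  have hcase : ∀ x, (x = a ∧ s x = b) ∨ (x = b ∧ s x = a) ∨ (x ≠ a ∧ x ≠ b ∧ s x = x) := by
    intro x
    by_cases h1 : x = a
    · left; simp [h1, hs]
    · by_cases h2 : x = b
      · right; left; simp [h2, hs]
      · right; right; exact ⟨h1, h2, Equiv.swap_apply_of_ne_of_ne h1 h2⟩
  -- An inversion is moved along with the letters, unless that would reverse it.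
  have hmaps : ∀ p ∈ invSet (w * s),
      (if s p.1 < s p.2 then (s p.1, s p.2) else p) ∈ (invSet w).erase (a, b) := by
    rintro ⟨x, y⟩ hp
    rw [mem_invSet] at hp
    obtain ⟨hxy, hlt⟩ := hp
    simp only [Equiv.Perm.mul_apply] at hlt
    rw [Finset.mem_erase]
    split_ifs with hc
    · refine ⟨fun h => ?_, (mem_invSet _ _ _).mpr ⟨hc, hlt⟩⟩
      simp only [Prod.mk.injEq] at h
      rw [h.1, h.2] at hlt
      have hx := hss x; have hy := hss y
      rw [h.1, hs, Equiv.swap_apply_left] at hx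
      rw [h.2, hs, Equiv.swap_apply_right] at hy
      rw [← hx, ← hy] at hxy
      exact absurd hxy hab.not_gt
    · simp only at hc
      rw [mem_invSet]
      rcases hcase x with ⟨rfl, e1⟩ | ⟨rfl, e1⟩ | ⟨h1, h2, e1⟩ <;>
      rcases hcase y with ⟨rfl, e2⟩ | ⟨rfl, e2⟩ | ⟨h3, h4, e2⟩ <;>
      simp only [ne_eq, Prod.mk.injEq] <;> grind
  have hcard := Finset.card_le_card_of_injOn _ hmaps (by
    rintro ⟨x, y⟩ hp ⟨x', y'⟩ hp' heq
    have hp1 := ((mem_invSet _ _ _).mp (Finset.mem_coe.mp hp)).1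
    have hp2 := ((mem_invSet _ _ _).mp (Finset.mem_coe.mp hp')).1
    simp only at heq
    split_ifs at heq with c1 c2 c2
    · simpa using heq
    · simp only [Prod.mk.injEq] at heq
      rw [← heq.1, ← heq.2, hss, hss] at c2
      exact absurd hp1 c2
    · simp only [Prod.mk.injEq] at heq
      rw [heq.1, heq.2, hss, hss] at c1
      exact absurd hp2 c1
    · exact heq)
  have hmem : (a, b) ∈ invSet w := (mem_invSet _ _ _).mpr ⟨hab, hw⟩
  rw [Finset.card_erase_of_mem hmem] at hcard
  have := Finset.card_pos.mpr ⟨_, hmem⟩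
  omega

theorem le_apply_of_monotone_on_fibres {r : ℕ} {γ : Type*} {k : Fin r → γ}
    {p : Equiv.Perm (Fin r)} (hk : ∀ x, k (p x) = k x)
    (hp : ∀ x y, x < y → k x = k y → p x < p y) (x : Fin r) : x ≤ p x := by
  induction x using WellFoundedLT.induction with
  | ind x ih =>
    by_contra hx
    have hx := not_le.mp hx
    exact absurd (ih _ hx) (not_le.mpr (hp _ _ hx (hk x)))

/-- A permutation preserving the fibres of a function and increasing on each is trivial. -/
theorem eq_one_of_monotone_on_fibres {r : ℕ} {γ : Type*} {k : Fin r → γ}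
    {p : Equiv.Perm (Fin r)} (hk : ∀ x, k (p x) = k x)
    (hp : ∀ x y, x < y → k x = k y → p x < p y) : p = 1 := by
  have hk' : ∀ x, k (p⁻¹ x) = k x := fun x => by simpa using (hk (p⁻¹ x)).symm
  have h2 := le_apply_of_monotone_on_fibres (p := p⁻¹) hk' (fun x y hxy he => by
    by_contra hc
    have hne : p⁻¹ x ≠ p⁻¹ y := fun h => hxy.ne (p⁻¹.injective h)
    have := hp _ _ (lt_of_le_of_ne (not_lt.mp hc) hne.symm) (by rw [hk', hk', he])
    exact absurd hxy (by simpa using this.le))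
  ext1 x
  refine le_antisymm ?_ (le_apply_of_monotone_on_fibres hk hp x)
  simpa using h2 (p x)

/-- A coset `{w | k ∘ w = k ∘ w₀}` has a member that reverses no two letters on whose images `k`
agrees: any member of least length. -/
theorem exists_monotone_on_fibres {r : ℕ} {γ : Type*} (k : Fin r → γ) (w₀ : Equiv.Perm (Fin r)) :
    ∃ w : Equiv.Perm (Fin r), (∀ x, k (w x) = k (w₀ x)) ∧
      (∀ a b, a < b → k (w a) = k (w b) → w a < w b) ∧
      ∀ w' : Equiv.Perm (Fin r), (∀ x, k (w' x) = k (w₀ x)) → len w ≤ len w' := by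
  classical
  obtain ⟨w, hw, hmin⟩ := Finset.exists_min_image
    (Finset.univ.filter fun w : Equiv.Perm (Fin r) => ∀ x, k (w x) = k (w₀ x)) len
    ⟨w₀, by simp⟩
  simp only [Finset.mem_filter, Finset.mem_univ, true_and] at hw hmin
  refine ⟨w, hw, fun a b hab he => ?_, hmin⟩
  by_contra hc
  have hne : w b ≠ w a := fun h => hab.ne' (w.injective h)
  refine absurd (len_mul_swap_lt w hab (lt_of_le_of_ne (not_lt.mp hc) hne))
    (not_lt.mpr (hmin _ fun x => ?_))
  rw [Equiv.Perm.mul_apply, ← hw x]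
  rcases eq_or_ne x a with rfl | h1
  · rw [Equiv.swap_apply_left, he]
  · rcases eq_or_ne x b with rfl | h2
    · rw [Equiv.swap_apply_right, he]
    · rw [Equiv.swap_apply_of_ne_of_ne h1 h2]

theorem eq_of_monotone_on_fibres {r : ℕ} {γ : Type*} {k : Fin r → γ} {v w : Equiv.Perm (Fin r)}
    (hv : ∀ a b, a < b → k (v a) = k (v b) → v a < v b)
    (hw : ∀ a b, a < b → k (w a) = k (w b) → w a < w b) (h : ∀ x, k (v x) = k (w x)) : v = w := by
  have hvp : ∀ x, v ((v⁻¹ * w) x) = w x := fun x => by simp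
  refine inv_mul_eq_one.mp (eq_one_of_monotone_on_fibres (k := fun x => k (w x)) (fun x => ?_)
    fun x y hxy he => ?_)
  · rw [← h, hvp]
  · have h1 := hw x y hxy he
    by_contra hc
    rcases (not_lt.mp hc).lt_or_eq with hlt | heq
    · have h2 := hv _ _ hlt (by rw [hvp, hvp]; exact he.symm)
      rw [hvp, hvp] at h2
      exact absurd h1 h2.not_gt
    · exact hxy.ne' ((v⁻¹ * w).injective heq)

theorem len_le_of_monotone_on_fibres {r : ℕ} {γ : Type*} {k : Fin r → γ}
    {w w' : Equiv.Perm (Fin r)} (hw : ∀ a b, a < b → k (w a) = k (w b) → w a < w b)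
    (h : ∀ x, k (w' x) = k (w x)) : len w ≤ len w' := by
  obtain ⟨v, hv1, hv2, hv3⟩ := exists_monotone_on_fibres k w
  rw [← eq_of_monotone_on_fibres hv2 hw hv1]
  exact hv3 _ h

theorem exists_perm_of_card_fibre_eq {r : ℕ} {γ : Type*} [DecidableEq γ] (f g : Fin r → γ)
    (h : ∀ c, (Finset.univ.filter fun x => f x = c).card =
      (Finset.univ.filter fun x => g x = c).card) :
    ∃ w : Equiv.Perm (Fin r), ∀ x, f (w x) = g x := by
  have e : ∀ c, Nonempty ({x // g x = c} ≃ {x // f x = c}) := fun c =>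
    ⟨Fintype.equivOfCardEq (by rw [Fintype.card_subtype, Fintype.card_subtype, h])⟩
  exact ⟨Equiv.ofFiberEquiv fun c => (e c).some, fun x => Equiv.ofFiberEquiv_map _ x⟩

section Hecke

variable {R : Type*} [CommRing R] {q : Rˣ} {r : ℕ}

theorem T_mul_swap_of_lt (w : Equiv.Perm (Fin r)) {i j : Fin r} (hij : j.val = i.val + 1)
    (h : w i < w j) : Hecke.T R q r w * Hecke.T R q r (Equiv.swap i j) =
      Hecke.T R q r (w * Equiv.swap i j) := by
  rw [Hecke.T_mul_T _ _ ⟨i, j, hij, rfl⟩, if_pos ((len_lt_mul_swap w hij).mpr h)]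

theorem T_swap_mul_self {i j : Fin r} (hij : j.val = i.val + 1) :
    Hecke.T R q r (Equiv.swap i j) * Hecke.T R q r (Equiv.swap i j) =
      ((q : R) - 1) • Hecke.T R q r (Equiv.swap i j) + (q : R) • 1 := by
  have hlt : i < j := by rw [Fin.lt_def]; omega
  rw [Hecke.T_mul_T _ _ ⟨i, j, hij, rfl⟩, if_neg, Equiv.swap_mul_self, Hecke.T_one]
  rw [len_lt_mul_swap _ hij]
  simpa using hlt.le

/-- A family `Ψ` that is multiplied correctly by `T_s` at every `k`-ascent is multiplied correctly
by `T_d` for all `d` whose inversions are strict for `k`: induction along a reduced word of `d`. -/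
theorem mul_T_of_strict_inversions {β : Type*} [Preorder β] {k : Fin r → β}
    (Ψ : Equiv.Perm (Fin r) → Hecke R q r)
    (hΨ : ∀ (w : Equiv.Perm (Fin r)) (i j : Fin r), j.val = i.val + 1 → k (w i) < k (w j) →
      Ψ w * Hecke.T R q r (Equiv.swap i j) = Ψ (w * Equiv.swap i j))
    (d : Equiv.Perm (Fin r)) (hd : ∀ a b, a < b → d b < d a → k (d b) < k (d a)) :
    Ψ 1 * Hecke.T R q r d = Ψ d := by
  induction hN : (invSet d).card using Nat.strong_induction_on generalizing d with
  | _ N ih =>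
    by_cases h1 : d = 1
    · rw [h1, Hecke.T_one, mul_one]
    · obtain ⟨i, j, hij, hlt⟩ := exists_descent d h1
      have hcard := invSet_mul' d hij hlt
      have hi : (d * Equiv.swap i j) i = d j := by simp
      have hj : (d * Equiv.swap i j) j = d i := by simp
      have hij' : i < j := by rw [Fin.lt_def]; omega
      have hd' : ∀ a b, a < b → (d * Equiv.swap i j) b < (d * Equiv.swap i j) a →
          k ((d * Equiv.swap i j) b) < k ((d * Equiv.swap i j) a) := by
        intro a b hab hba
        by_cases hc : a = i ∧ b = j
        · rw [hc.1, hc.2, hi, hj] at hba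
          exact absurd hba hlt.not_gt
        · exact hd _ _ (swap_lt hij hab hc) hba
      have e : d * Equiv.swap i j * Equiv.swap i j = d := by
        rw [mul_assoc, Equiv.swap_mul_self, mul_one]
      have h2 := T_mul_swap_of_lt (R := R) (q := q) (d * Equiv.swap i j) hij (by rwa [hi, hj])
      rw [e] at h2
      rw [← h2, ← mul_assoc, ih _ (by omega) _ hd' rfl,
        hΨ _ _ _ hij (by rw [hi, hj]; exact hd _ _ hij' hlt), e]

/-- `T_w T_u = T_{wu}` if `w` is increasing at every inversion of `u`. -/
theorem T_mul_T_of_strict_inversions (w u : Equiv.Perm (Fin r))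
    (h : ∀ a b, a < b → u b < u a → w (u b) < w (u a)) :
    Hecke.T R q r w * Hecke.T R q r u = Hecke.T R q r (w * u) := by
  have := mul_T_of_strict_inversions (R := R) (q := q) (k := w)
    (fun u => Hecke.T R q r (w * u)) (fun v i j hij hv => by
      rw [T_mul_swap_of_lt _ hij hv, mul_assoc]) u h
  rwa [mul_one] at this

end Hecke

/-! ### Compositions as colourings and the index set of matrices -/

theorem sum_Iic_le_sum_Iio {N : ℕ} (l : Fin N → ℕ) {i j : Fin N} (h : i < j) :
    ∑ k ∈ Finset.Iic i, l k ≤ ∑ k ∈ Finset.Iio j, l k :=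
  Finset.sum_le_sum_of_subset fun _ hk =>
    Finset.mem_Iio.mpr (lt_of_le_of_lt (Finset.mem_Iic.mp hk) h)

theorem lt_of_mem_block {N r : ℕ} {l : Fin N → ℕ} {i j : Fin N} (h : i < j) {x y : Fin r}
    (hx : x ∈ block r l i) (hy : y ∈ block r l j) : x < y := by
  simp only [block, Finset.mem_filter, Finset.mem_univ, true_and] at hx hy
  have := sum_Iic_le_sum_Iio l h
  rw [Fin.lt_def]; omega

theorem exists_mem_block {N r : ℕ} {l : Fin N → ℕ} (hl : ∑ i, l i = r) (x : Fin r) :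
    ∃ i, x ∈ block r l i := by
  have hx : x.val < ∑ i, l i := hl ▸ x.isLt
  have hN : ∃ i : Fin N, x.val < ∑ j ∈ Finset.Iic i, l j := by
    cases N with
    | zero => simp at hx
    | succ N =>
      refine ⟨Fin.last N, ?_⟩
      have : Finset.Iic (Fin.last N) = Finset.univ := by ext; simp [Fin.le_last]
      rwa [this]
  have hmin := Finset.exists_min_image
    (Finset.univ.filter fun i : Fin N => x.val < ∑ j ∈ Finset.Iic i, l j) id
    (by obtain ⟨i, hi⟩ := hN; exact ⟨i, by simpa using hi⟩)
  obtain ⟨i, hi, hmin⟩ := hmin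
  simp only [Finset.mem_filter, Finset.mem_univ, true_and, id] at hi hmin
  refine ⟨i, ?_⟩
  simp only [block, Finset.mem_filter, Finset.mem_univ, true_and]
  refine ⟨?_, hi⟩
  by_contra hc
  rw [not_le] at hc
  by_cases h0 : i.val = 0
  · have : Finset.Iio i = ∅ := by
      ext k; simp only [Finset.mem_Iio, Finset.notMem_empty, iff_false, Fin.lt_def]; omega
    simp [this] at hc
  · let j : Fin N := ⟨i.val - 1, by omega⟩
    have hj : Finset.Iio i = Finset.Iic j := by
      ext k; simp only [Finset.mem_Iio, Finset.mem_Iic, Fin.lt_def, Fin.le_def, j]; omega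
    rw [hj] at hc
    have := hmin j hc
    rw [Fin.le_def] at this
    simp only [j] at this
    omega

/-- The colour of the letter `x`: the index of the interval of `l` in which it lies. A coset
`W_l w` is the same thing as the word `col l ∘ w`. -/
noncomputable def col {m n r : ℕ} (l : Comps m n r) (x : Fin r) : Fin (m + n) :=
  (exists_mem_block l.2 x).choose

section

variable {m n r : ℕ}

theorem mem_block_iff (l : Comps m n r) (i : Fin (m + n)) (x : Fin r) :
    x ∈ block r l.1 i ↔ col l x = i := by
  have hc : x ∈ block r l.1 (col l x) := (exists_mem_block l.2 x).choose_spec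
  constructor
  · intro h
    rcases lt_trichotomy (col l x) i with h1 | h1 | h1
    · exact absurd (lt_of_mem_block h1 hc h) (lt_irrefl _)
    · exact h1
    · exact absurd (lt_of_mem_block h1 h hc) (lt_irrefl _)
  · rintro rfl; exact hc

theorem lt_of_col_lt (l : Comps m n r) {x y : Fin r} (h : col l x < col l y) : x < y :=
  lt_of_mem_block h ((mem_block_iff l _ x).mpr rfl) ((mem_block_iff l _ y).mpr rfl)

theorem col_mono (l : Comps m n r) {x y : Fin r} (h : x ≤ y) : col l x ≤ col l y :=
  not_lt.mp fun hc => (lt_of_col_lt l hc).not_ge h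

theorem card_col (l : Comps m n r) (i : Fin (m + n)) :
    (Finset.univ.filter fun x => col l x = i).card = l.1 i := by
  have h1 : (Finset.univ.filter fun x => col l x = i) = block r l.1 i := by
    ext x; simp [mem_block_iff]
  have h2 : (block r l.1 i).map Fin.valEmbedding =
      Finset.Ico (∑ j ∈ Finset.Iio i, l.1 j) (∑ j ∈ Finset.Iic i, l.1 j) := by
    have hle : ∑ j ∈ Finset.Iic i, l.1 j ≤ r :=
      (Finset.sum_le_sum_of_subset (Finset.subset_univ _)).trans_eq l.2
    ext y
    simp only [block, Finset.mem_map, Finset.mem_filter, Finset.mem_univ, true_and,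
      Fin.valEmbedding_apply, Finset.mem_Ico]
    constructor
    · rintro ⟨x, hx, rfl⟩; exact hx
    · intro hy; exact ⟨⟨y, by omega⟩, hy, rfl⟩
  rw [h1, ← Finset.card_map Fin.valEmbedding, h2, Nat.card_Ico]
  have h3 : Finset.Iic i = insert i (Finset.Iio i) := by simp
  rw [h3, Finset.sum_insert (by simp)]
  omega

theorem mem_young_iff (l : Comps m n r) (w : Equiv.Perm (Fin r)) :
    w ∈ young r l.1 ↔ ∀ x, col l (w x) = col l x := by
  change (∀ i, ∀ x, w x ∈ block r l.1 i ↔ x ∈ block r l.1 i) ↔ _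
  simp only [mem_block_iff]
  exact ⟨fun h x => (h _ x).mpr rfl, fun h i x => by rw [h]⟩

theorem lt_evenSize_iff (l : Comps m n r) (x : Fin r) :
    x.val < evenSize l.1 ↔ (col l x).val < m := by
  have hc : x ∈ block r l.1 (col l x) := (mem_block_iff l _ x).mpr rfl
  simp only [block, Finset.mem_filter, Finset.mem_univ, true_and] at hc
  constructor
  · intro h
    by_contra hm
    have : evenSize l.1 ≤ ∑ j ∈ Finset.Iio (col l x), l.1 j :=
      Finset.sum_le_sum_of_subset fun j hj => by
        simp only [Finset.mem_filter, Finset.mem_univ, true_and] at hj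
        rw [Finset.mem_Iio, Fin.lt_def]; omega
    omega
  · intro h
    have : ∑ j ∈ Finset.Iic (col l x), l.1 j ≤ evenSize l.1 :=
      Finset.sum_le_sum_of_subset fun j hj => by
        simp only [Finset.mem_filter, Finset.mem_univ, true_and]
        rw [Finset.mem_Iic, Fin.le_def] at hj; omega
    omega

theorem mem_youngEven_iff (l : Comps m n r) (w : Equiv.Perm (Fin r)) :
    w ∈ youngEven r l.1 ↔ (∀ x, col l (w x) = col l x) ∧ ∀ x, m ≤ (col l x).val → w x = x := by
  have e : ∀ x : Fin r, evenSize l.1 ≤ x.val ↔ m ≤ (col l x).val := fun x => by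
    have := lt_evenSize_iff l x; omega
  rw [youngEven, Subgroup.mem_inf, mem_young_iff, mem_fixingSubgroup_iff]
  simp only [Set.mem_ofPred_eq, e, Equiv.Perm.smul_def]

theorem mem_youngOdd_iff (l : Comps m n r) (w : Equiv.Perm (Fin r)) :
    w ∈ youngOdd r l.1 ↔ (∀ x, col l (w x) = col l x) ∧ ∀ x, (col l x).val < m → w x = x := by
  rw [youngOdd, Subgroup.mem_inf, mem_young_iff, mem_fixingSubgroup_iff]
  simp only [Set.mem_ofPred_eq, lt_evenSize_iff, Equiv.Perm.smul_def]

theorem mem_conjBy_iff (P : Subgroup (Equiv.Perm (Fin r))) (d w : Equiv.Perm (Fin r)) :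
    w ∈ conjBy P d ↔ d * w * d⁻¹ ∈ P := Iff.rfl

theorem lt_of_mem_minReps {P : Subgroup (Equiv.Perm (Fin r))} {d : Equiv.Perm (Fin r)}
    (hd : d ∈ minReps P) {a b : Fin r} (hab : a < b) (hP : Equiv.swap (d a) (d b) ∈ P) :
    d a < d b := by
  by_contra hc
  have hne : d b ≠ d a := fun h => hab.ne' (d.injective h)
  have h1 := len_mul_swap_lt d hab (lt_of_le_of_ne (not_lt.mp hc) hne)
  rw [Equiv.mul_swap_eq_swap_mul] at h1
  exact absurd h1 (not_lt.mpr (hd _ hP))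

theorem apply_swap_eq {α γ : Type*} [DecidableEq α] (k : α → γ) {a b : α} (h : k a = k b)
    (x : α) : k (Equiv.swap a b x) = k x := by
  rw [Equiv.swap_apply_def]
  split_ifs with h1 h2
  · rw [h1, h]
  · rw [h2, h]
  · rfl

/-- The matrix of a pair of words: how often each pair of colours occurs. -/
def wordMat {N : ℕ} (f g : Fin r → Fin N) : Matrix (Fin N) (Fin N) ℕ :=
  Matrix.of fun i j => (Finset.univ.filter fun x => f x = i ∧ g x = j).card

theorem wordMat_apply {N : ℕ} (f g : Fin r → Fin N) (i j : Fin N) :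
    wordMat f g i j = (Finset.univ.filter fun x => f x = i ∧ g x = j).card := rfl

theorem jmath_eq (l μ : Comps m n r) (d : Equiv.Perm (Fin r)) :
    jmath l.1 d μ.1 = wordMat (fun x => col l (d x)) (col μ) := by
  ext i j
  rw [wordMat_apply, jmath, Matrix.of_apply, ← Finset.card_map d.toEmbedding
    (s := Finset.univ.filter fun x => col l (d x) = i ∧ col μ x = j)]
  congr 1
  ext x
  simp only [Finset.mem_inter, mem_block_iff, Finset.mem_map_equiv, Finset.mem_filter,
    Finset.mem_univ, true_and, Equiv.apply_symm_apply]

theorem ro_wordMat {N : ℕ} (f g : Fin r → Fin N) (i : Fin N) :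
    ro (wordMat f g) i = (Finset.univ.filter fun x => f x = i).card := by
  simp only [ro, wordMat_apply]
  rw [Finset.card_eq_sum_card_fiberwise (f := g) (t := Finset.univ) (by simp)]
  simp only [Finset.filter_filter]

theorem co_wordMat {N : ℕ} (f g : Fin r → Fin N) (j : Fin N) :
    co (wordMat f g) j = (Finset.univ.filter fun x => g x = j).card := by
  simp only [co, wordMat_apply]
  rw [Finset.card_eq_sum_card_fiberwise (f := f) (t := Finset.univ) (by simp)]
  simp only [Finset.filter_filter, and_comm]

theorem card_comp_perm {N : ℕ} (f : Fin r → Fin N) (d : Equiv.Perm (Fin r)) (i : Fin N) :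
    (Finset.univ.filter fun x => f (d x) = i).card =
      (Finset.univ.filter fun x => f x = i).card := by
  rw [← Finset.card_map d.toEmbedding]
  congr 1
  ext x
  simp [Finset.mem_map_equiv]

theorem ro_jmath (l μ : Comps m n r) (d : Equiv.Perm (Fin r)) : ro (jmath l.1 d μ.1) = l.1 := by
  ext i
  rw [jmath_eq, ro_wordMat, card_comp_perm, card_col]

theorem co_jmath (l μ : Comps m n r) (d : Equiv.Perm (Fin r)) : co (jmath l.1 d μ.1) = μ.1 := by
  ext i
  rw [jmath_eq, co_wordMat, card_col]

/-- The parity condition on a matrix: entries at positions of mixed parity are at most `1`. -/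
def ParityBound (A : Matrix (Fin (m + n)) (Fin (m + n)) ℕ) : Prop :=
  ∀ i j, ¬ (i.val < m ↔ j.val < m) → A i j ≤ 1

/-- The triviality conditions in `superReps`, in terms of the matrix: a mixed entry `≥ 2` would
give a transposition in the intersection. -/
theorem superReps_iff (l μ : Comps m n r) (d : Equiv.Perm (Fin r)) :
    d ∈ superReps r l.1 μ.1 ↔ d ∈ minReps (young r l.1) ∧ d⁻¹ ∈ minReps (young r μ.1) ∧
      ParityBound (jmath l.1 d μ.1) := by
  have hconj : ∀ w : Equiv.Perm (Fin r), (∀ x, col l ((d * w * d⁻¹) x) = col l x) ↔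
      ∀ x, col l (d (w x)) = col l (d x) := fun w =>
    ⟨fun h x => by simpa using h (d x), fun h x => by simpa using h (d⁻¹ x)⟩
  have hconj' : ∀ (w : Equiv.Perm (Fin r)) (P : Fin (m + n) → Prop),
      (∀ x, P (col l x) → (d * w * d⁻¹) x = x) ↔ ∀ x, P (col l (d x)) → w x = x := fun w P =>
    ⟨fun h x hx => by simpa using h (d x) hx, fun h x hx => by
      have := h (d⁻¹ x) (by simpa using hx)
      rw [Equiv.Perm.mul_apply, Equiv.Perm.mul_apply, this, ← Equiv.Perm.mul_apply,
        mul_inv_cancel, Equiv.Perm.one_apply]⟩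
  rw [superReps, Set.mem_ofPred_eq, Subgroup.eq_bot_iff_forall, Subgroup.eq_bot_iff_forall]
  simp only [Subgroup.mem_inf, mem_conjBy_iff, mem_youngEven_iff, mem_youngOdd_iff, hconj,
    hconj' _ fun c => m ≤ c.val, hconj' _ fun c => c.val < m]
  refine and_congr_right fun _ => and_congr_right fun _ => ?_
  rw [jmath_eq]
  constructor
  · rintro ⟨h0, h1⟩ i j hij
    rw [wordMat_apply]
    by_contra hc
    obtain ⟨a, ha, b, hb, hab⟩ := Finset.one_lt_card.mp (not_le.mp hc)
    simp only [Finset.mem_filter, Finset.mem_univ, true_and] at ha hb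
    have e1 := apply_swap_eq (fun x => col l (d x)) (ha.1.trans hb.1.symm)
    have e2 := apply_swap_eq (col μ) (ha.2.trans hb.2.symm)
    have hfix : ∀ x, (col l (d x) ≠ i ∨ col μ x ≠ j) → Equiv.swap a b x = x := fun x hx =>
      Equiv.swap_apply_of_ne_of_ne (by rintro rfl; tauto) (by rintro rfl; tauto)
    have hne : Equiv.swap a b ≠ 1 := fun h => hab (Equiv.swap_eq_one_iff.mp h)
    by_cases him : i.val < m
    · refine hne (h0 _ ⟨⟨e1, fun x hx => hfix x (Or.inl ?_)⟩,
        ⟨e2, fun x hx => hfix x (Or.inr ?_)⟩⟩) <;> rintro rfl <;> omega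
    · refine hne (h1 _ ⟨⟨e1, fun x hx => hfix x (Or.inl ?_)⟩,
        ⟨e2, fun x hx => hfix x (Or.inr ?_)⟩⟩) <;> rintro rfl <;> omega
  · intro h
    have key : ∀ (w : Equiv.Perm (Fin r)) (x : Fin r), col l (d (w x)) = col l (d x) →
        col μ (w x) = col μ x → ¬ ((col l (d x)).val < m ↔ (col μ x).val < m) → w x = x := by
      intro w x h1 h2 h3
      have := h _ _ h3
      rw [wordMat_apply, Finset.card_le_one] at this
      exact this _ (by simp [h1, h2]) _ (by simp)
    constructor
    · rintro w ⟨⟨a1, a2⟩, b1, b2⟩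
      ext1 x
      by_cases c1 : m ≤ (col l (d x)).val
      · exact a2 x c1
      · by_cases c2 : (col μ x).val < m
        · exact b2 x c2
        · exact key w x (a1 x) (b1 x) (by omega)
    · rintro w ⟨⟨a1, a2⟩, b1, b2⟩
      ext1 x
      by_cases c1 : (col l (d x)).val < m
      · exact a2 x c1
      · by_cases c2 : m ≤ (col μ x).val
        · exact b2 x c2
        · exact key w x (a1 x) (b1 x) (by omega)

theorem exists_wordMat_eq {N : ℕ} (A : Matrix (Fin N) (Fin N) ℕ) (hA : ∑ i, ∑ j, A i j = r) :
    ∃ f g : Fin r → Fin N, wordMat f g = A := by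
  have e : Nonempty (Fin r ≃ Σ p : Fin N × Fin N, Fin (A p.1 p.2)) := by
    refine ⟨Fintype.equivOfCardEq ?_⟩
    simp only [Fintype.card_fin, Fintype.card_sigma]
    rw [Fintype.sum_prod_type, hA]
  obtain ⟨e⟩ := e
  refine ⟨fun x => (e x).1.1, fun x => (e x).1.2, ?_⟩
  ext i j
  rw [wordMat_apply, ← Finset.card_map e.toEmbedding]
  have : (Finset.univ.filter fun x => (e x).1.1 = i ∧ (e x).1.2 = j).map e.toEmbedding =
      Finset.univ.map (Function.Embedding.sigmaMk (β := fun p : Fin N × Fin N =>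
        Fin (A p.1 p.2)) (i, j)) := by
    ext ⟨⟨a, b⟩, x⟩
    rw [Finset.mem_map_equiv]
    simp only [Finset.mem_filter, Finset.mem_univ, true_and,
      Equiv.apply_symm_apply, Finset.mem_map, Function.Embedding.sigmaMk_apply]
    constructor
    · rintro ⟨rfl, rfl⟩; exact ⟨x, rfl⟩
    · rintro ⟨y, hy⟩
      have := congrArg Sigma.fst hy
      simp only [Prod.mk.injEq] at this
      exact ⟨this.1.symm, this.2.symm⟩
  rw [this]
  simp

/-- The index set `M(m|n,r)`: matrices of total `r` whose entries of mixed parity are at most `1`.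
A permutation of least length among those with matrix `A` is the required representative. -/
theorem mem_superMat_iff (A : Matrix (Fin (m + n)) (Fin (m + n)) ℕ) :
    A ∈ superMat m n r ↔ (∑ i, ∑ j, A i j = r) ∧ ParityBound A := by
  constructor
  · rintro ⟨l, μ, d, hd, rfl⟩
    refine ⟨?_, ((superReps_iff l μ d).mp hd).2.2⟩
    exact (Finset.sum_congr rfl fun i _ => congrFun (ro_jmath l μ d) i).trans l.2
  · rintro ⟨hA, hp⟩
    obtain ⟨f, g, rfl⟩ := exists_wordMat_eq A hA
    let l : Comps m n r := ⟨ro (wordMat f g), hA⟩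
    let μ : Comps m n r := ⟨co (wordMat f g), Finset.sum_comm.trans hA⟩
    obtain ⟨σ, hσ⟩ := exists_perm_of_card_fibre_eq (col l) f fun c => by
      rw [card_col, ← ro_wordMat f g]
    obtain ⟨τ, hτ⟩ := exists_perm_of_card_fibre_eq (col μ) g fun c => by
      rw [card_col, ← co_wordMat f g]
    have hmat : jmath l.1 (σ * τ⁻¹) μ.1 = wordMat f g := by
      ext i j
      rw [jmath_eq, wordMat_apply, wordMat_apply, ← Finset.card_map τ.toEmbedding (s :=
        Finset.univ.filter fun x => f x = i ∧ g x = j)]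
      congr 1
      ext x
      simp only [Finset.mem_map_equiv, Finset.mem_filter, Finset.mem_univ, true_and, ← hσ, ← hτ]
      simp [Equiv.Perm.inv_def]
    classical
    obtain ⟨d, hd, hmin⟩ := Finset.exists_min_image
      (Finset.univ.filter fun d : Equiv.Perm (Fin r) => jmath l.1 d μ.1 = wordMat f g) len
      ⟨_, by simpa using hmat⟩
    simp only [Finset.mem_filter, Finset.mem_univ, true_and] at hd hmin
    refine ⟨l, μ, d, (superReps_iff l μ d).mpr ⟨fun u hu => hmin _ ?_, fun u hu => ?_, ?_⟩, hd⟩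
    · rw [← hd, jmath_eq, jmath_eq]
      simp only [Equiv.Perm.mul_apply, (mem_young_iff l u).mp hu]
    · rw [len_inv, ← len_inv (u * d⁻¹)]
      refine hmin _ ?_
      have hu' := (mem_young_iff μ _).mp (inv_mem hu)
      rw [← hd, jmath_eq, jmath_eq]
      ext i j
      rw [wordMat_apply, wordMat_apply, ← Finset.card_map (u⁻¹).toEmbedding]
      congr 1
      ext x
      simp only [Finset.mem_map_equiv, Finset.mem_filter, Finset.mem_univ, true_and, mul_inv_rev,
        inv_inv, Equiv.Perm.mul_apply]
      have : col μ ((Equiv.symm u⁻¹) x) = col μ x := by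
        rw [← hu' ((Equiv.symm u⁻¹) x)]; simp
      rw [this, Equiv.apply_symm_apply]
    · rw [hd]; exact hp

end

/-! ### Signed sums over the permutations with a given word -/

section

variable {R : Type*} [CommRing R] {m n r : ℕ}

/-- The number of inversions of `f` between letters having the same odd colour under `c`. -/
def oddInv {β : Type*} [LinearOrder β] (c : Fin r → Fin (m + n)) (f : Fin r → β) : ℕ :=
  (Finset.univ.filter fun p : Fin r × Fin r =>
    p.1 < p.2 ∧ c p.1 = c p.2 ∧ m ≤ (c p.1).val ∧ f p.2 < f p.1).card

/-- The scalar by which `T_s` acts on `[xy]_l` from the right, for `s` in a block of colour `c`: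
`q` for even `c` and `-1` for odd `c`. -/
def heckeChar (q : Rˣ) (c : Fin (m + n)) : Rˣ := if c.val < m then q else -1

/-- `1` for even `c` and `-q⁻¹` for odd `c`: the weight of one inversion in colour `c`. -/
def invWeight (q : Rˣ) (c : Fin (m + n)) : Rˣ := if c.val < m then 1 else (-q)⁻¹

theorem invWeight_mul (q : Rˣ) (c : Fin (m + n)) : invWeight q c * q = heckeChar q c := by
  unfold invWeight heckeChar
  split_ifs <;> simp

/-- The quadratic relation `(T_s - q)(T_s + 1) = 0`, as a relation between scalars. -/
theorem one_add_invWeight (q : Rˣ) (c : Fin (m + n)) :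
    1 + (invWeight q c : R) * ((q : R) - 1) = (heckeChar q c : R) * (invWeight q c : R) := by
  unfold invWeight heckeChar
  split_ifs
  · simp
  · rw [inv_neg, Units.val_neg, Units.val_neg, Units.val_one]
    linear_combination (-1 : R) * (q.inv_mul)

theorem oddInv_swap_of_ne {β : Type*} [LinearOrder β] (c : Fin r → Fin (m + n)) (f : Fin r → β)
    {i j : Fin r} (hij : j.val = i.val + 1) (h : c i ≠ c j) :
    oddInv (fun x => c (Equiv.swap i j x)) (fun x => f (Equiv.swap i j x)) = oddInv c f := by
  unfold oddInv
  rw [← Finset.card_map ((Equiv.swap i j).prodCongr (Equiv.swap i j)).toEmbedding]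
  congr 1
  ext ⟨a, b⟩
  rw [Finset.mem_map_equiv]
  simp only [Finset.mem_filter, Finset.mem_univ, true_and, Equiv.prodCongr_symm,
    Equiv.symm_swap, Equiv.prodCongr_apply, Prod.map, Equiv.swap_apply_self]
  by_cases h1 : a = i ∧ b = j
  · rw [h1.1, h1.2]; simp [h]
  by_cases h2 : a = j ∧ b = i
  · rw [h2.1, h2.2]; simp [h.symm]
  rw [swap_lt_iff hij h1 h2]

theorem oddInv_swap_of_eq {β : Type*} [LinearOrder β] (c : Fin r → Fin (m + n)) (f : Fin r → β)
    {i j : Fin r} (hij : j.val = i.val + 1) (h : c i = c j) (hf : f i < f j) :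
    oddInv c (fun x => f (Equiv.swap i j x)) = oddInv c f + if (c i).val < m then 0 else 1 := by
  have hlt : i < j := by rw [Fin.lt_def]; omega
  have key : ∀ a b, ¬ (a = i ∧ b = j) →
      (a < b ∧ c a = c b ∧ m ≤ (c a).val ∧
        f (Equiv.swap i j b) < f (Equiv.swap i j a) ↔
      Equiv.swap i j a < Equiv.swap i j b ∧ c (Equiv.swap i j a) = c (Equiv.swap i j b) ∧
        m ≤ (c (Equiv.swap i j a)).val ∧ f (Equiv.swap i j b) < f (Equiv.swap i j a)) := by
    intro a b h1
    rw [apply_swap_eq c h, apply_swap_eq c h]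
    by_cases h2 : a = j ∧ b = i
    · rw [h2.1, h2.2]
      simp [hlt.not_gt, hf.not_gt]
    rw [swap_lt_iff hij h1 h2]
  unfold oddInv
  rw [← Finset.card_map ((Equiv.swap i j).prodCongr (Equiv.swap i j)).toEmbedding
    (s := Finset.univ.filter fun p : Fin r × Fin r =>
      p.1 < p.2 ∧ c p.1 = c p.2 ∧ m ≤ (c p.1).val ∧ f p.2 < f p.1)]
  split_ifs with hm
  · rw [add_zero]
    congr 1
    ext ⟨a, b⟩
    rw [Finset.mem_map_equiv]
    simp only [Finset.mem_filter, Finset.mem_univ, true_and, Equiv.prodCongr_symm,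
      Equiv.symm_swap, Equiv.prodCongr_apply, Prod.map]
    by_cases h1 : a = i ∧ b = j
    · rw [h1.1, h1.2]
      simp [hlt.not_gt, Nat.not_le.mpr hm]
    · exact key a b h1
  · rw [← Finset.card_insert_of_notMem (a := (i, j))]
    · congr 1
      ext ⟨a, b⟩
      rw [Finset.mem_insert, Finset.mem_map_equiv]
      simp only [Finset.mem_filter, Finset.mem_univ, true_and, Equiv.prodCongr_symm,
        Equiv.symm_swap, Equiv.prodCongr_apply, Prod.map, Prod.mk.injEq]
      by_cases h1 : a = i ∧ b = j
      · rw [h1.1, h1.2]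
        simp [hlt, hf, h, h ▸ Nat.not_lt.mp hm]
      · rw [key a b h1]
        simp [h1]
    · rw [Finset.mem_map_equiv]
      simp [hlt.not_gt]

/-- One more inversion in colour `c` multiplies the weight by `invWeight q c`. -/
theorem pow_oddInv_swap (q : Rˣ) {β : Type*} [LinearOrder β] (c : Fin r → Fin (m + n))
    (f : Fin r → β) {i j : Fin r} (hij : j.val = i.val + 1) (h : c i = c j) (hf : f i < f j) :
    ((-q)⁻¹ ^ oddInv c (fun x => f (Equiv.swap i j x)) : Rˣ) =
      invWeight q (c i) * (-q)⁻¹ ^ oddInv c f := by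
  rw [oddInv_swap_of_eq c f hij h hf, invWeight]
  split_ifs <;> simp [pow_succ']

/-- A sum over a set with an involution `σ`, grouped into the pairs `x, σ x` that `asc` tells apart
and the remaining terms. -/
theorem sum_eq_sum_ascents {ι M : Type*} [AddCommMonoid M] (S : Finset ι) (σ : ι → ι)
    (hσ : ∀ x ∈ S, σ x ∈ S) (hinv : ∀ x, σ (σ x) = x) (asc : ι → Prop) [DecidablePred asc]
    (hasc : ∀ x, asc x → ¬ asc (σ x)) (F : ι → M) :
    ∑ x ∈ S, F x = ∑ x ∈ S.filter asc, (F x + F (σ x)) +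
      ∑ x ∈ S.filter (fun x => ¬ asc x ∧ ¬ asc (σ x)), F x := by
  rw [← Finset.sum_filter_add_sum_filter_not S asc, Finset.sum_add_distrib, add_assoc]
  congr 1
  rw [← Finset.sum_filter_add_sum_filter_not (S.filter fun x => ¬ asc x) (fun x => asc (σ x)),
    Finset.filter_filter, Finset.filter_filter]
  congr 1
  refine Finset.sum_bij' (fun x _ => σ x) (fun x _ => σ x) ?_ ?_ ?_ ?_ ?_
  · intro x hx
    simp only [Finset.mem_filter] at hx ⊢
    exact ⟨hσ x hx.1, hx.2.2⟩
  · intro x hx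
    simp only [Finset.mem_filter] at hx ⊢
    exact ⟨hσ x hx.1, hasc x hx.2, by rw [hinv]; exact hx.2⟩
  · exact fun x _ => hinv x
  · exact fun x _ => hinv x
  · exact fun x _ => by rw [hinv]

/-- A sum over pairs `x, σ x` exchanged by `T_s`, with weights in the ratio `invWeight q c`, is an
eigenvector of `T_s`. -/
theorem sum_mul_T_swap (q : Rˣ) {ι : Type*} {i j : Fin r} (hij : j.val = i.val + 1)
    (c : Fin (m + n)) (S : Finset ι) (σ : ι → ι) (hσ : ∀ x ∈ S, σ x ∈ S)
    (hinv : ∀ x, σ (σ x) = x) (asc : ι → Prop) (hasc : ∀ x, asc x → ¬ asc (σ x))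
    (X : ι → Hecke R q r) (κ : ι → Rˣ)
    (hX : ∀ x ∈ S, asc x → X x * Hecke.T R q r (Equiv.swap i j) = X (σ x))
    (hκ : ∀ x ∈ S, asc x → κ (σ x) = invWeight q c * κ x)
    (hfix : ∀ x ∈ S, ¬ asc x → ¬ asc (σ x) →
      X x * Hecke.T R q r (Equiv.swap i j) = (heckeChar q c : R) • X x) :
    (∑ x ∈ S, (κ x : R) • X x) * Hecke.T R q r (Equiv.swap i j) =
      (heckeChar q c : R) • ∑ x ∈ S, (κ x : R) • X x := by
  classical
  rw [sum_eq_sum_ascents S σ hσ hinv asc hasc, add_mul, smul_add, Finset.sum_mul, Finset.sum_mul,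
    Finset.smul_sum, Finset.smul_sum]
  congr 1
  · refine Finset.sum_congr rfl fun x hx => ?_
    rw [Finset.mem_filter] at hx
    have e1 := one_add_invWeight q c
    have e2 := congrArg (Units.val (α := R)) (invWeight_mul q c)
    rw [Units.val_mul] at e2
    rw [hκ x hx.1 hx.2, ← hX x hx.1 hx.2, Units.val_mul, add_mul, smul_mul_assoc,
      smul_mul_assoc, mul_assoc, T_swap_mul_self hij, mul_add, mul_smul_comm, mul_smul_comm,
      mul_one]
    simp only [smul_add, smul_smul]
    rw [← add_assoc, ← add_smul, add_comm]
    congr 2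
    · rw [← e2]; ring
    · linear_combination (κ x : R) * e1
  · refine Finset.sum_congr rfl fun x hx => ?_
    rw [Finset.mem_filter] at hx
    rw [smul_mul_assoc, hfix x hx.1 hx.2.1 hx.2.2, smul_comm]

/-- The basis element of the module `[xy]_l ℋ` attached to a word `f`, i.e. to the coset of all `w`
with `col l ∘ w = f`: the sum of the `T_w`, weighted by `(-q)⁻¹` to the number of inversions of `w`
between letters of the same odd colour. For `f = col l` it is `[xy]_l`. It is zero if the content
of `f` is not `l`. -/
noncomputable def wordSum (q : Rˣ) (l : Comps m n r) (f : Fin r → Fin (m + n)) : Hecke R q r :=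
  ∑ w ∈ Finset.univ.filter fun w : Equiv.Perm (Fin r) => (fun x => col l (w x)) = f,
    (((-q)⁻¹ ^ oddInv f w : Rˣ) : R) • Hecke.T R q r w

theorem wordSum_mul_T_of_lt (q : Rˣ) (l : Comps m n r) (f : Fin r → Fin (m + n))
    {i j : Fin r} (hij : j.val = i.val + 1) (h : f i < f j) :
    wordSum q l f * Hecke.T R q r (Equiv.swap i j) =
      wordSum q l fun x => f (Equiv.swap i j x) := by
  rw [wordSum, wordSum, Finset.sum_mul]
  refine Finset.sum_equiv (Equiv.mulRight (Equiv.swap i j)) (fun w => ?_) fun w hw => ?_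
  · simp only [Finset.mem_filter, Finset.mem_univ, true_and, Equiv.coe_mulRight,
      Equiv.Perm.mul_apply]
    constructor
    · rintro rfl; rfl
    · intro h
      ext x
      have := congrFun h (Equiv.swap i j x)
      simp only [Equiv.swap_apply_self] at this
      rw [this]
  · simp only [Finset.mem_filter, Finset.mem_univ, true_and] at hw
    subst hw
    rw [smul_mul_assoc, T_mul_swap_of_lt w hij (lt_of_col_lt l h), Equiv.coe_mulRight]
    congr 3
    exact (oddInv_swap_of_ne (fun x => col l (w x)) w hij h.ne).symm

theorem wordSum_mul_T_of_eq (q : Rˣ) (l : Comps m n r) (f : Fin r → Fin (m + n))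
    {i j : Fin r} (hij : j.val = i.val + 1) (h : f i = f j) :
    wordSum q l f * Hecke.T R q r (Equiv.swap i j) = (heckeChar q (f i) : R) • wordSum q l f := by
  have hlt : i < j := by rw [Fin.lt_def]; omega
  refine sum_mul_T_swap q hij (f i) _ (fun w => w * Equiv.swap i j) ?_ ?_
    (fun w => w i < w j) ?_ _ _ ?_ ?_ ?_
  · intro w hw
    simp only [Finset.mem_filter, Finset.mem_univ, true_and] at hw ⊢
    subst hw
    ext x
    exact congrArg Fin.val (apply_swap_eq (fun x => col l (w x)) h x)
  · intro w; rw [mul_assoc, Equiv.swap_mul_self, mul_one]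
  · intro w hw
    simpa using hw.le
  · exact fun w _ hw => T_mul_swap_of_lt w hij hw
  · exact fun w _ hw => pow_oddInv_swap q f w hij h hw
  · intro w _ h1 h2
    simp only [Equiv.Perm.mul_apply, Equiv.swap_apply_left, Equiv.swap_apply_right] at h2
    exact absurd (w.injective (le_antisymm (not_lt.mp h2) (not_lt.mp h1))) hlt.ne

/-- `wordSum` is multiplied by `T_d` in the naive way if all inversions of `d` are ascents of the
word. -/
theorem wordSum_mul_T_of_strict_inversions (q : Rˣ) (l : Comps m n r) (f : Fin r → Fin (m + n))
    (d : Equiv.Perm (Fin r)) (hd : ∀ a b, a < b → d b < d a → f (d b) < f (d a)) :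
    wordSum q l f * Hecke.T R q r d = wordSum q l fun x => f (d x) :=
  mul_T_of_strict_inversions (fun w => wordSum q l fun x => f (w x))
    (fun w _ _ hij h => wordSum_mul_T_of_lt q l (fun x => f (w x)) hij h) d hd

theorem col_eq_of_inversion (l : Comps m n r) {w : Equiv.Perm (Fin r)}
    (hw : ∀ x, col l (w x) = col l x) {a b : Fin r} (hab : a < b) (h : w b < w a) :
    col l a = col l b := by
  refine le_antisymm (col_mono l hab.le) ?_
  rw [← hw a, ← hw b]
  exact col_mono l h.le

theorem exists_even_mul_odd (l : Comps m n r) {w : Equiv.Perm (Fin r)} (hw : w ∈ young r l.1) :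
    ∃ w₀ ∈ youngEven r l.1, ∃ w₁ ∈ youngOdd r l.1, w₀ * w₁ = w := by
  have hw' := (mem_young_iff l w).mp hw
  have hp : ∀ x, (col l (w x)).val < m ↔ (col l x).val < m := fun x => by rw [hw']
  let w₀ : Equiv.Perm (Fin r) :=
    Equiv.Perm.ofSubtype (w.subtypePerm (p := fun x => (col l x).val < m) hp)
  have h0 : ∀ x, (col l x).val < m → w₀ x = w x := fun x hx =>
    Equiv.Perm.ofSubtype_apply_of_mem (w.subtypePerm (p := fun x => (col l x).val < m) hp) hx
  have h1 : ∀ x, ¬ (col l x).val < m → w₀ x = x := fun x hx =>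
    Equiv.Perm.ofSubtype_apply_of_not_mem (w.subtypePerm (p := fun x => (col l x).val < m) hp) hx
  have h2 : w₀ ∈ youngEven r l.1 := by
    refine (mem_youngEven_iff l _).mpr ⟨fun x => ?_, fun x hx => h1 x (by omega)⟩
    by_cases hx : (col l x).val < m
    · rw [h0 x hx, hw']
    · rw [h1 x hx]
  refine ⟨w₀, h2, w₀⁻¹ * w, (mem_youngOdd_iff l _).mpr ⟨?_, fun x hx => ?_⟩, by simp⟩
  · exact (mem_young_iff l _).mp (mul_mem (inv_mem (Subgroup.mem_inf.mp h2).1) hw)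
  · rw [Equiv.Perm.mul_apply, ← h0 x hx, ← Equiv.Perm.mul_apply, inv_mul_cancel,
      Equiv.Perm.one_apply]

theorem youngEven_inf_youngOdd (l : Comps m n r) : youngEven r l.1 ⊓ youngOdd r l.1 = ⊥ := by
  rw [Subgroup.eq_bot_iff_forall]
  intro w hw
  rw [Subgroup.mem_inf, mem_youngEven_iff, mem_youngOdd_iff] at hw
  ext1 x
  by_cases hx : (col l x).val < m
  · exact hw.2.2 x hx
  · exact hw.1.2 x (by omega)

open scoped Classical in
/-- The double sum defining `T_D` as a single sum over `D ∩ W_l`. -/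
theorem superSum_eq (q : Rˣ) (l : Comps m n r) (D : Set (Equiv.Perm (Fin r)))
    (hD : ∀ w₀ ∈ youngEven r l.1, ∀ w₁ ∈ youngOdd r l.1,
      (w₀ * w₁ ∈ D ↔ w₀ ∈ D ∧ w₁ ∈ D)) :
    superSum q r l.1 D = ∑ w ∈ Finset.univ.filter fun w => w ∈ D ∧ w ∈ young r l.1,
      (((-q)⁻¹ ^ oddInv (col l) w : Rˣ) : R) • Hecke.T R q r w := by
  rw [superSum, ← Finset.sum_product']
  refine Finset.sum_bij (fun p _ => p.1 * p.2) ?_ ?_ ?_ ?_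
  · rintro ⟨w₀, w₁⟩ hp
    simp only [Finset.mem_product, Finset.mem_filter, Finset.mem_univ, true_and] at hp ⊢
    exact ⟨(hD _ hp.1.2 _ hp.2.2).mpr ⟨hp.1.1, hp.2.1⟩,
      mul_mem (Subgroup.mem_inf.mp hp.1.2).1 (Subgroup.mem_inf.mp hp.2.2).1⟩
  · rintro ⟨w₀, w₁⟩ hp ⟨v₀, v₁⟩ hp' heq
    simp only [Finset.mem_product, Finset.mem_filter, Finset.mem_univ, true_and] at hp hp' heq
    have e : v₀⁻¹ * w₀ = v₁ * w₁⁻¹ := by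
      rw [inv_mul_eq_iff_eq_mul, ← mul_assoc, ← heq]; simp
    have h1 : v₀⁻¹ * w₀ ∈ youngEven r l.1 ⊓ youngOdd r l.1 :=
      Subgroup.mem_inf.mpr ⟨mul_mem (inv_mem hp'.1.2) hp.1.2,
        e ▸ mul_mem hp'.2.2 (inv_mem hp.2.2)⟩
    rw [youngEven_inf_youngOdd, Subgroup.mem_bot] at h1
    rw [h1] at e
    rw [Prod.mk.injEq]
    exact ⟨(inv_mul_eq_one.mp h1).symm, (mul_inv_eq_one.mp e.symm).symm⟩
  · intro w hw
    simp only [Finset.mem_filter, Finset.mem_univ, true_and] at hw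
    obtain ⟨w₀, h0, w₁, h1, rfl⟩ := exists_even_mul_odd l hw.2
    have := (hD _ h0 _ h1).mp hw.1
    exact ⟨(w₀, w₁), by simp [h0, h1, this.1, this.2], rfl⟩
  · rintro ⟨w₀, w₁⟩ hp
    simp only [Finset.mem_product, Finset.mem_filter, Finset.mem_univ, true_and] at hp
    have h0 := (mem_youngEven_iff l _).mp hp.1.2
    have h1 := (mem_youngOdd_iff l _).mp hp.2.2
    have hodd : ∀ a b, a < b → w₁ b < w₁ a →
        m ≤ (col l a).val ∧ m ≤ (col l b).val := by
      intro a b hab hba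
      have he := col_eq_of_inversion l h1.1 hab hba
      rw [← he, and_self]
      by_contra hc
      have hc := not_le.mp hc
      rw [h1.2 a hc, h1.2 b (by rwa [← he])] at hba
      exact absurd hab hba.not_gt
    have hfix : ∀ x, m ≤ (col l x).val → w₀ (w₁ x) = w₁ x := fun x hx =>
      h0.2 _ (by rwa [h1.1])
    have hlen : oddInv (col l) (w₀ * w₁) = len w₁ := by
      rw [len_eq, oddInv, invSet]
      congr 1
      refine Finset.filter_congr ?_
      rintro ⟨a, b⟩ -
      simp only [Equiv.Perm.mul_apply]
      constructor
      · rintro ⟨hab, hc, hm, hba⟩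
        rw [hfix _ hm, hfix _ (hc ▸ hm)] at hba
        exact ⟨hab, hba⟩
      · rintro ⟨hab, hba⟩
        have := hodd a b hab hba
        refine ⟨hab, col_eq_of_inversion l h1.1 hab hba, this.1, ?_⟩
        rwa [hfix _ this.1, hfix _ this.2]
    rw [hlen, T_mul_T_of_strict_inversions w₀ w₁ fun a b hab hba => by
      rwa [hfix _ (hodd a b hab hba).1, hfix _ (hodd a b hab hba).2], zpow_neg, inv_pow,
      zpow_natCast]

theorem wordSum_col (q : Rˣ) (l : Comps m n r) : (wordSum q l (col l) : Hecke R q r) =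
    xy q r l.1 := by
  classical
  have h1 : (xy q r l.1 : Hecke R q r) = superSum q r l.1 Set.univ := by
    rw [xy, superSum, Finset.sum_mul_sum]
    simp only [Set.mem_univ, true_and, mul_smul_comm]
  rw [h1, superSum_eq q l Set.univ (by simp), wordSum]
  refine Finset.sum_congr ?_ fun _ _ => rfl
  ext w
  simp [mem_young_iff, funext_iff]

end

/-! ### The double coset sums -/

section

variable {R : Type*} [CommRing R] {m n r : ℕ}

theorem wordMat_comp_perm {N : ℕ} (f g : Fin r → Fin N) (d : Equiv.Perm (Fin r)) :
    wordMat (fun x => f (d x)) (fun x => g (d x)) = wordMat f g := by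
  ext i j
  rw [wordMat_apply, wordMat_apply, ← Finset.card_map d.toEmbedding]
  congr 1
  ext x
  simp [Finset.mem_map_equiv]

theorem exists_perm_of_wordMat_eq {N : ℕ} {f g c : Fin r → Fin N}
    (h : wordMat f c = wordMat g c) :
    ∃ w : Equiv.Perm (Fin r), ∀ x, (g (w x), c (w x)) = (f x, c x) := by
  refine exists_perm_of_card_fibre_eq (fun x => (g x, c x)) (fun x => (f x, c x)) ?_
  rintro ⟨i, j⟩
  simp only [Prod.mk.injEq]
  exact (congrFun (congrFun h i) j).symm

/-- The sum of the words `f` that form with the word of `μ` the matrix `A`, each weighted by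
`(-q)⁻¹` to the number of its inversions inside the odd blocks of `μ`. -/
noncomputable def matSum (q : Rˣ) (l μ : Comps m n r)
    (A : Matrix (Fin (m + n)) (Fin (m + n)) ℕ) : Hecke R q r :=
  ∑ f ∈ Finset.univ.filter fun f : Fin r → Fin (m + n) => wordMat f (col μ) = A,
    (((-q)⁻¹ ^ oddInv (col μ) f : Rˣ) : R) • wordSum q l f

theorem two_le_wordMat {N : ℕ} (f g : Fin r → Fin N) {x y : Fin r} (hxy : x ≠ y)
    (hf : f x = f y) (hg : g x = g y) : 2 ≤ wordMat f g (f x) (g x) := by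
  rw [wordMat_apply]
  exact Finset.one_lt_card.mpr ⟨x, by simp, y, by simp [hf, hg], hxy⟩

/-- `matSum` transforms under `W_μ` like `[xy]_μ`. Two equal letters of a word in one block of `μ`
give an entry `≥ 2`, so that their colour and the block have the same parity. -/
theorem matSum_mul_T (q : Rˣ) (l μ : Comps m n r)
    {A : Matrix (Fin (m + n)) (Fin (m + n)) ℕ} (hA : ParityBound A) {i j : Fin r}
    (hij : j.val = i.val + 1) (h : col μ i = col μ j) :
    matSum q l μ A * Hecke.T R q r (Equiv.swap i j) =
      (heckeChar q (col μ i) : R) • matSum q l μ A := by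
  have hlt : i < j := by rw [Fin.lt_def]; omega
  refine sum_mul_T_swap q hij (col μ i) _ (fun f x => f (Equiv.swap i j x)) ?_ ?_
    (fun f => f i < f j) ?_ _ _ ?_ ?_ ?_
  · intro f hf
    simp only [Finset.mem_filter, Finset.mem_univ, true_and] at hf ⊢
    rw [← hf, ← wordMat_comp_perm f (col μ) (Equiv.swap i j)]
    congr 1
    ext x
    rw [apply_swap_eq _ h]
  · intro f; simp
  · intro f hf
    simpa using hf.le
  · exact fun f _ hf => wordSum_mul_T_of_lt q l f hij hf
  · exact fun f _ hf => pow_oddInv_swap q (col μ) f hij h hf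
  · intro f hf h1 h2
    simp only [Equiv.swap_apply_left, Equiv.swap_apply_right] at h2
    have he : f i = f j := le_antisymm (not_lt.mp h2) (not_lt.mp h1)
    rw [wordSum_mul_T_of_eq q l f hij he]
    congr 2
    simp only [Finset.mem_filter, Finset.mem_univ, true_and] at hf
    have h2 := two_le_wordMat f (col μ) hlt.ne he h
    rw [hf] at h2
    have hp : (f i).val < m ↔ (col μ i).val < m := by
      by_contra hc
      have := hA _ _ hc
      omega
    simp only [heckeChar, hp]

theorem mem_minReps_iff {γ : Type*} {P : Subgroup (Equiv.Perm (Fin r))} {k : Fin r → γ}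
    (hP : ∀ u, u ∈ P ↔ ∀ x, k (u x) = k x) (w : Equiv.Perm (Fin r)) :
    w ∈ minReps P ↔ ∀ a b, a < b → k (w a) = k (w b) → w a < w b :=
  ⟨fun h _ _ hab he => lt_of_mem_minReps h hab ((hP _).mpr (apply_swap_eq k he)),
    fun h u hu => len_le_of_monotone_on_fibres h fun x => (hP u).mp hu (w x)⟩

theorem strict_inversions_of_monotone {α γ : Type*} [LinearOrder γ] [LinearOrder α]
    {k : α → γ} {w : Fin r → α} (hmono : ∀ a b, w b < w a → k (w b) ≤ k (w a))
    (h : ∀ a b, a < b → k (w a) = k (w b) → w a < w b) (a b : Fin r) (hab : a < b)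
    (hw : w b < w a) : k (w b) < k (w a) :=
  lt_of_le_of_ne (hmono a b hw) fun he => (h a b hab he.symm).not_gt hw

theorem xy_mul_T_of_monotone (q : Rˣ) (l : Comps m n r) {d : Equiv.Perm (Fin r)}
    (hd : ∀ a b, a < b → col l (d a) = col l (d b) → d a < d b) :
    xy q r l.1 * Hecke.T R q r d = wordSum q l fun x => col l (d x) := by
  rw [← wordSum_col, wordSum_mul_T_of_strict_inversions]
  exact strict_inversions_of_monotone (fun a b h => col_mono l h.le) hd

/-- `T_{W_l d W_μ}` depends on `l`, `μ` and the matrix of `d` only. -/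
theorem dcSum_eq_matSum (q : Rˣ) (l μ : Comps m n r) {d : Equiv.Perm (Fin r)}
    (hd : d ∈ superReps r l.1 μ.1) :
    (dcSum q l.1 d μ.1 : Hecke R q r) = matSum q l μ (jmath l.1 d μ.1) := by
  classical
  obtain ⟨hd1, hd2, -⟩ := (superReps_iff l μ d).mp hd
  rw [mem_minReps_iff (mem_young_iff l)] at hd1
  rw [mem_minReps_iff (mem_young_iff μ)] at hd2
  set g : Fin r → Fin (m + n) := fun x => col l (d x) with hg
  have hgmono : ∀ a b, a ≤ b → col μ a = col μ b → g a ≤ g b := by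
    intro a b hab he
    refine col_mono l ?_
    by_contra hc
    exact absurd hab (by simpa using hd2 _ _ (not_le.mp hc) (by simpa using he.symm))
  set P := conjBy (young r l.1) d ⊓ young r μ.1 with hPdef
  have hP : ∀ u, u ∈ P ↔ ∀ x, (g (u x), col μ (u x)) = (g x, col μ x) := by
    intro u
    rw [hPdef, Subgroup.mem_inf, mem_conjBy_iff, mem_young_iff, mem_young_iff]
    simp only [Prod.mk.injEq, forall_and]
    refine and_congr_left fun _ => ⟨fun h x => by simpa using h (d x), fun h x => ?_⟩
    simpa [hg] using h (d⁻¹ x)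
  have hmin := mem_minReps_iff (k := fun x => (g x, col μ x)) hP
  have hD : ∀ w₀ ∈ youngEven r μ.1, ∀ w₁ ∈ youngOdd r μ.1,
      (w₀ * w₁ ∈ minReps P ∩ young r μ.1 ↔
        w₀ ∈ minReps P ∩ young r μ.1 ∧ w₁ ∈ minReps P ∩ young r μ.1) := by
    intro w₀ h0 w₁ h1
    have y0 := (Subgroup.mem_inf.mp h0).1
    have y1 := (Subgroup.mem_inf.mp h1).1
    simp only [Set.mem_inter_iff, SetLike.mem_coe, y0, y1, mul_mem y0 y1, and_true]
    simp only [hmin]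
    rw [mem_youngEven_iff] at h0
    rw [mem_youngOdd_iff] at h1
    have even : ∀ x, (col μ x).val < m → w₁ x = x ∧ (w₀ * w₁) x = w₀ x := fun x hx => by
      rw [Equiv.Perm.mul_apply, h1.2 x hx]; exact ⟨rfl, rfl⟩
    have odd : ∀ x, ¬ (col μ x).val < m → w₀ x = x ∧ (w₀ * w₁) x = w₁ x := fun x hx => by
      rw [Equiv.Perm.mul_apply, h0.2 x (by omega), h0.2 (w₁ x) (by rw [h1.1]; omega)]
      exact ⟨rfl, rfl⟩
    have hcol : ∀ (w : Equiv.Perm (Fin r)), (∀ x, col μ (w x) = col μ x) → ∀ a b,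
        (g (w a), col μ (w a)) = (g (w b), col μ (w b)) → col μ a = col μ b := by
      intro w hw a b he
      rw [← hw a, ← hw b]
      exact congrArg Prod.snd he
    constructor
    · refine fun h => ⟨fun a b hab he => ?_, fun a b hab he => ?_⟩
      · have hc := hcol _ h0.1 a b he
        by_cases hm : (col μ a).val < m
        · have e1 := even a hm; have e2 := even b (hc ▸ hm)
          have := h a b hab
          rw [e1.2, e2.2] at this
          exact this he
        · have e1 := odd a hm; have e2 := odd b (hc ▸ hm)
          rwa [e1.1, e2.1]
      · have hc := hcol _ h1.1 a b he
        by_cases hm : (col μ a).val < m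
        · have e1 := even a hm; have e2 := even b (hc ▸ hm)
          rwa [e1.1, e2.1]
        · have e1 := odd a hm; have e2 := odd b (hc ▸ hm)
          have := h a b hab
          rw [e1.2, e2.2] at this
          exact this he
    · rintro ⟨k0, k1⟩ a b hab he
      have hc := hcol _ ((mem_young_iff μ _).mp (mul_mem y0 y1)) a b he
      by_cases hm : (col μ a).val < m
      · rw [(even a hm).2, (even b (hc ▸ hm)).2] at he ⊢
        exact k0 a b hab he
      · rw [(odd a hm).2, (odd b (hc ▸ hm)).2] at he ⊢
        exact k1 a b hab he
  have hDw : ∀ w : Equiv.Perm (Fin r), w ∈ minReps P ∩ young r μ.1 ∧ w ∈ young r μ.1 ↔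
      (∀ x, col μ (w x) = col μ x) ∧
        ∀ a b, a < b → (g (w a), col μ (w a)) = (g (w b), col μ (w b)) → w a < w b := by
    intro w
    simp only [Set.mem_inter_iff, SetLike.mem_coe, hmin, mem_young_iff]
    tauto
  -- In a word `g ∘ w` the inversions inside the blocks of `μ` are those of `w`.
  have hinv : ∀ w : Equiv.Perm (Fin r), (∀ x, col μ (w x) = col μ x) →
      (∀ a b, a < b → (g (w a), col μ (w a)) = (g (w b), col μ (w b)) → w a < w b) →
      ∀ a b, a < b → col μ a = col μ b → (w b < w a ↔ g (w b) < g (w a)) := by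
    intro w h1 h2 a b hab hc
    have hc' : col μ (w a) = col μ (w b) := by rw [h1, h1, hc]
    refine ⟨fun h => lt_of_le_of_ne (hgmono _ _ h.le hc'.symm) fun he => ?_, fun h => ?_⟩
    · exact (h2 a b hab (by rw [he, hc'])).not_gt h
    · by_contra hlt
      exact (hgmono _ _ (not_lt.mp hlt) hc').not_gt h
  rw [dcSum, ← mul_assoc, xy_mul_T_of_monotone q l hd1, ← hPdef]
  generalize minReps P ∩ (young r μ.1 : Set (Equiv.Perm (Fin r))) = D at hD hDw ⊢
  rw [superSum_eq q μ _ hD, Finset.mul_sum, matSum]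
  -- The shortest representatives `w` in `W_μ` correspond to the words `g ∘ w` of the given matrix.
  refine Finset.sum_bij (fun w _ x => g (w x)) ?_ ?_ ?_ ?_
  · intro w hw
    have hw := (hDw w).mp (Finset.mem_filter.mp hw).2
    rw [Finset.mem_filter, jmath_eq, ← wordMat_comp_perm (fun x => col l (d x)) (col μ) w]
    simp only [hw.1, Finset.mem_univ, hg, true_and]
  · intro w hw w' hw' he
    have hw := (hDw w).mp (Finset.mem_filter.mp hw).2
    have hw' := (hDw w').mp (Finset.mem_filter.mp hw').2
    refine eq_of_monotone_on_fibres (k := fun x => (g x, col μ x)) hw.2 hw'.2 fun x => ?_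
    rw [hw.1, hw'.1, congrFun he x]
  · intro f hf
    rw [Finset.mem_filter, jmath_eq] at hf
    obtain ⟨w₀, hw₀⟩ := exists_perm_of_wordMat_eq hf.2
    obtain ⟨w, hw1, hw2, -⟩ := exists_monotone_on_fibres (fun x => (g x, col μ x)) w₀
    have hw3 : ∀ x, (g (w x), col μ (w x)) = (f x, col μ x) := fun x => (hw1 x).trans (hw₀ x)
    refine ⟨w, ?_, funext fun x => congrArg Prod.fst (hw3 x)⟩
    exact Finset.mem_filter.mpr ⟨Finset.mem_univ _,
      (hDw w).mpr ⟨fun x => congrArg Prod.snd (hw3 x), hw2⟩⟩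
  · intro w hw
    have hw := (hDw w).mp (Finset.mem_filter.mp hw).2
    have h1 := hinv w hw.1 hw.2
    have h2 : oddInv (col μ) w = oddInv (col μ) fun x => g (w x) := by
      unfold oddInv
      congr 1
      refine Finset.filter_congr ?_
      rintro ⟨a, b⟩ -
      exact and_congr_right fun hab => and_congr_right fun hc => and_congr_right fun _ =>
        h1 a b hab hc
    rw [mul_smul_comm, wordSum_mul_T_of_strict_inversions, h2]
    intro a b hab hba
    exact (h1 a b hab (col_eq_of_inversion μ hw.1 hab hba)).mp hba

end

/-! ### The endomorphisms attached to matrices -/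

section

variable {R : Type*} [CommRing R] {m n r : ℕ}

theorem repr_mul_T_swap (q : Rˣ) {i j : Fin r} (hij : j.val = i.val + 1)
    {w : Equiv.Perm (Fin r)} (hw : w i < w j) (x : Hecke R q r) :
    (Hecke.T R q r).repr (x * Hecke.T R q r (Equiv.swap i j)) w =
      (q : R) * (Hecke.T R q r).repr x (w * Equiv.swap i j) := by
  classical
  have key : ((Hecke.T R q r).coord w).comp
      (LinearMap.mulRight R (Hecke.T R q r (Equiv.swap i j))) =
      (q : R) • (Hecke.T R q r).coord (w * Equiv.swap i j) := by
    refine (Hecke.T R q r).ext fun u => ?_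
    have hiff : u * Equiv.swap i j = w ↔ u = w * Equiv.swap i j := by
      constructor
      · rintro rfl; rw [mul_assoc, Equiv.swap_mul_self, mul_one]
      · rintro rfl; rw [mul_assoc, Equiv.swap_mul_self, mul_one]
    simp only [LinearMap.comp_apply, LinearMap.mulRight_apply, Module.Basis.coord_apply,
      LinearMap.smul_apply]
    rw [Hecke.T_mul_T _ _ ⟨i, j, hij, rfl⟩]
    simp only [len_lt_mul_swap u hij]
    split_ifs with hu
    · rw [Module.Basis.repr_self, Module.Basis.repr_self, Finsupp.single_apply,
        Finsupp.single_apply, if_neg, if_neg, smul_zero]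
      · rintro rfl; simp [hw.not_gt] at hu
      · rintro rfl; simp [hu.not_gt] at hw
    · rw [map_add, map_smul, map_smul, Finsupp.add_apply, Finsupp.smul_apply, Finsupp.smul_apply,
        Module.Basis.repr_self, Module.Basis.repr_self, Finsupp.single_apply,
        Finsupp.single_apply, Finsupp.single_apply, if_neg (fun h : u = w => hu (h ▸ hw)),
        smul_zero, zero_add]
      simp only [hiff]
  simpa using LinearMap.congr_fun key x

/-- An element on which `W_μ` acts from the right as it does on `[xy]_μ` is a left multiple of
`[xy]_μ`: its coefficients along a coset `w W_μ` are determined by the one at the shortest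
element. -/
theorem exists_mul_xy_eq (q : Rˣ) (μ : Comps m n r) (v : Hecke R q r)
    (hv : ∀ i j : Fin r, j.val = i.val + 1 → col μ i = col μ j →
      v * Hecke.T R q r (Equiv.swap i j) = (heckeChar q (col μ i) : R) • v) :
    ∃ z : Hecke R q r, z * xy q r μ.1 = v := by
  classical
  set V := (Hecke.T R q r).repr v with hV
  have hstep : ∀ (w : Equiv.Perm (Fin r)) (i j : Fin r), j.val = i.val + 1 →
      col μ i = col μ j → w i < w j →
      V (w * Equiv.swap i j) = (invWeight q (col μ i) : R) * V w := by
    intro w i j hij hc hw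
    have h1 := repr_mul_T_swap q hij hw v
    rw [hv i j hij hc, map_smul, Finsupp.smul_apply, ← hV, ← invWeight_mul, smul_eq_mul,
      Units.val_mul] at h1
    refine (q.isUnit.mul_right_inj).mp ?_
    rw [← h1]; ring
  have hcoeff : ∀ (w u : Equiv.Perm (Fin r)),
      (∀ a b, a < b → col μ a = col μ b → w a < w b) → (∀ x, col μ (u x) = col μ x) →
      V (w * u) = (((-q)⁻¹ ^ oddInv (col μ) u : Rˣ) : R) * V w := by
    intro w u hw
    induction hN : (invSet u).card using Nat.strong_induction_on generalizing u with
    | _ N ih =>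
      intro hu
      by_cases h1 : u = 1
      · have : oddInv (col μ) (1 : Equiv.Perm (Fin r)) = 0 := by
          simp only [oddInv, Finset.card_eq_zero, Finset.filter_eq_empty_iff]
          rintro p - ⟨h1, -, -, h2⟩
          exact absurd h1 h2.not_gt
        rw [h1, this]; simp
      · obtain ⟨i, j, hij, hlt⟩ := exists_descent u h1
        have hcard := invSet_mul' u hij hlt
        have hij' : i < j := by rw [Fin.lt_def]; omega
        have hc := col_eq_of_inversion μ hu hij' hlt
        set u' := u * Equiv.swap i j with hu'
        have hi : u' i = u j := by simp [hu']
        have hj : u' j = u i := by simp [hu']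
        have e : u' * Equiv.swap i j = u := by
          rw [hu', mul_assoc, Equiv.swap_mul_self, mul_one]
        have hcu' : ∀ x, col μ (u' x) = col μ x := fun x => by
          rw [hu', Equiv.Perm.mul_apply, hu, apply_swap_eq _ hc]
        have hup : u' i < u' j := by rwa [hi, hj]
        have h2 := pow_oddInv_swap q (col μ) u' hij hc hup
        have h3 : (fun x => u' (Equiv.swap i j x)) = u := by
          rw [← e]; rfl
        rw [h3] at h2
        rw [h2, ← e, ← mul_assoc, hstep (w * u') i j hij hc
          (hw _ _ hup (by rw [hcu', hcu', hc])), ih _ (by omega) u' rfl hcu', Units.val_mul,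
          mul_assoc]
  let Z : Finset (Equiv.Perm (Fin r)) :=
    Finset.univ.filter fun y => ∀ a b, a < b → col μ (y a) = col μ (y b) → y a < y b
  have hZ : ∀ y ∈ Z, ∀ a b, a < b → col μ a = col μ b → y⁻¹ a < y⁻¹ b := by
    intro y hy a b hab he
    simp only [Z, Finset.mem_filter, Finset.mem_univ, true_and] at hy
    by_contra hc
    rcases (not_lt.mp hc).lt_or_eq with hlt | heq
    · exact absurd hab (by simpa using (hy _ _ hlt (by simpa using he.symm)).le)
    · exact hab.ne' (y⁻¹.injective heq)
  refine ⟨∑ y ∈ Z, V y⁻¹ • Hecke.T R q r y⁻¹, ?_⟩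
  conv_rhs => rw [← (Hecke.T R q r).sum_repr v]
  rw [← wordSum_col, wordSum, Finset.sum_mul_sum, ← Finset.sum_product']
  refine Finset.sum_bij (fun p _ => p.1⁻¹ * p.2) (fun _ _ => Finset.mem_univ _) ?_ ?_ ?_
  · rintro ⟨y, u⟩ hp ⟨y', u'⟩ hp' heq
    simp only [Z, Finset.mem_product, Finset.mem_filter, Finset.mem_univ, true_and] at hp hp' heq
    have h1 : ∀ x, col μ (y x) = col μ (y' x) := by
      have h2 : y' = u' * u⁻¹ * y := by
        rw [← mul_inv_eq_iff_eq_mul, ← inv_inj, mul_inv_rev, mul_inv_rev, inv_inv, inv_inv,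
          eq_mul_inv_iff_mul_eq, mul_assoc, ← heq, mul_inv_cancel_left]
      have hu := (mem_young_iff μ u).mpr (congrFun hp.2)
      have hu' := (mem_young_iff μ u').mpr (congrFun hp'.2)
      intro x
      rw [h2, Equiv.Perm.mul_apply,
        (mem_young_iff μ _).mp (mul_mem hu' (inv_mem hu)) (y x)]
    have h2 := eq_of_monotone_on_fibres hp.1 hp'.1 h1
    subst h2
    rw [mul_right_inj] at heq
    rw [heq]
  · intro x _
    obtain ⟨y, hy1, hy2, -⟩ := exists_monotone_on_fibres (col μ) x⁻¹
    refine ⟨(y, y * x), ?_, by simp⟩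
    simp only [Z, Finset.mem_product, Finset.mem_filter, Finset.mem_univ, true_and]
    exact ⟨hy2, by ext t; simp [hy1]⟩
  · rintro ⟨y, u⟩ hp
    rw [Finset.mem_product] at hp
    have h1 := hZ y hp.1
    have h2 := congrFun (Finset.mem_filter.mp hp.2).2
    simp only at h1 h2 ⊢
    rw [hcoeff _ _ h1 h2, smul_mul_smul_comm, T_mul_T_of_strict_inversions, mul_comm]
    intro a b hab hba
    exact h1 _ _ hba (by rw [h2, h2]; exact (col_eq_of_inversion μ h2 hab hba).symm)

theorem mem_xyMod_iff (q : Rˣ) (l : Comps m n r) (x : Hecke R q r) :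
    x ∈ xyMod q r l.1 ↔ ∃ h, x = xy q r l.1 * h := by
  rw [xyMod, Submodule.mem_span_singleton]
  constructor
  · rintro ⟨a, rfl⟩; exact ⟨a.unop, rfl⟩
  · rintro ⟨h, rfl⟩; exact ⟨MulOpposite.op h, rfl⟩

/-- Left multiplication by `z`, as a map of right ideals. -/
noncomputable def leftMul {q : Rˣ} {l μ : Comps m n r} (z : Hecke R q r)
    (hz : ∀ x ∈ xyMod q r μ.1, z * x ∈ xyMod q r l.1) :
    xyMod q r μ.1 →ₗ[(Hecke R q r)ᵐᵒᵖ] xyMod q r l.1 where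
  toFun x := ⟨z * x.1, hz x.1 x.2⟩
  map_add' x y := Subtype.ext (mul_add z x.1 y.1)
  map_smul' a x := Subtype.ext (mul_assoc z x.1 a.unop).symm

/-- The embedding of `[xy]_l ℋ` as a summand of the tensor space. -/
noncomputable abbrev incl (q : Rˣ) (l : Comps m n r) :
    xyMod (R := R) q r l.1 →ₗ[(Hecke R q r)ᵐᵒᵖ] TensorSpace q m n r :=
  DirectSum.lof (Hecke R q r)ᵐᵒᵖ (Comps m n r) (fun l => xyMod q r l.1) l

/-- The endomorphism of the tensor space that multiplies the summand of `μ` by `z` from the left,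
into the summand of `l`, and vanishes on the other summands. -/
noncomputable def leftMulEnd {q : Rˣ} {l μ : Comps m n r} (z : Hecke R q r)
    (hz : ∀ x ∈ xyMod q r μ.1, z * x ∈ xyMod q r l.1) : QSchur q m n r :=
  incl q l ∘ₗ leftMul z hz ∘ₗ
    DirectSum.component (Hecke R q r)ᵐᵒᵖ (Comps m n r) (fun l => xyMod q r l.1) μ

theorem leftMulEnd_incl {q : Rˣ} {l μ : Comps m n r} (z : Hecke R q r)
    (hz : ∀ x ∈ xyMod q r μ.1, z * x ∈ xyMod q r l.1) (x : xyMod q r μ.1) :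
    leftMulEnd z hz (incl q μ x) = incl q l ⟨z * x.1, hz x.1 x.2⟩ := by
  simp only [leftMulEnd, LinearMap.comp_apply, DirectSum.component.lof_self]
  rfl

theorem leftMulEnd_incl_of_ne {q : Rˣ} {l μ α : Comps m n r} (z : Hecke R q r)
    (hz : ∀ x ∈ xyMod q r μ.1, z * x ∈ xyMod q r l.1) (hα : α ≠ μ) (x : xyMod q r α.1) :
    leftMulEnd z hz (incl q α x) = 0 := by
  simp only [leftMulEnd, LinearMap.comp_apply]
  rw [DirectSum.component.of, dif_neg hα, map_zero, map_zero]

theorem isPhi_leftMulEnd {q : Rˣ} {l μ : Comps m n r} {d : Equiv.Perm (Fin r)} (z : Hecke R q r)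
    (hz : ∀ x ∈ xyMod q r μ.1, z * x ∈ xyMod q r l.1) (h : z * xy q r μ.1 = dcSum q l.1 d μ.1) :
    IsPhi q l d μ (leftMulEnd z hz) := by
  intro α h'
  split_ifs with hα
  · subst hα
    refine (leftMulEnd_incl z hz _).trans (congrArg _ (Subtype.ext ?_))
    simp only
    rw [← mul_assoc, h]
  · exact leftMulEnd_incl_of_ne z hz hα _

theorem IsPhi.unique {q : Rˣ} {l μ : Comps m n r} {d : Equiv.Perm (Fin r)}
    {f g : QSchur q m n r} (hf : IsPhi q l d μ f) (hg : IsPhi q l d μ g) : f = g := by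
  refine DirectSum.linearMap_ext _ fun α => LinearMap.ext ?_
  rintro ⟨x, hx⟩
  obtain ⟨h, rfl⟩ := (mem_xyMod_iff q α x).mp hx
  exact (hf α h).trans (hg α h).symm

theorem isPhiMat_leftMulEnd {q : Rˣ} {l μ : Comps m n r}
    {A : Matrix (Fin (m + n)) (Fin (m + n)) ℕ} (hl : l.1 = ro A) (hμ : μ.1 = co A)
    (z : Hecke R q r) (hz : ∀ x ∈ xyMod q r μ.1, z * x ∈ xyMod q r l.1)
    (h : z * xy q r μ.1 = matSum q l μ A) : IsPhiMat q A (leftMulEnd z hz) := by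
  intro l' μ' d hd hA
  have e1 : l' = l := Subtype.ext (by rw [hl, ← hA, ro_jmath])
  have e2 : μ' = μ := Subtype.ext (by rw [hμ, ← hA, co_jmath])
  subst e1 e2
  exact isPhi_leftMulEnd z hz (by rw [h, dcSum_eq_matSum q l' μ' hd, hA])

/-- `φ_A` is well defined, and is left multiplication by an element taking `[xy]_μ` to
`matSum q l μ A`. -/
theorem exists_phi_eq (q : Rˣ) {A : Matrix (Fin (m + n)) (Fin (m + n)) ℕ}
    (hA : A ∈ superMat m n r) {l μ : Comps m n r} (hl : l.1 = ro A) (hμ : μ.1 = co A) :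
    ∃ (z : Hecke R q r) (hz : ∀ x ∈ xyMod q r μ.1, z * x ∈ xyMod q r l.1),
      z * xy q r μ.1 = matSum q l μ A ∧ phi q r A = leftMulEnd z hz ∧
        IsPhiMat q A (leftMulEnd z hz) := by
  obtain ⟨z, hz⟩ := exists_mul_xy_eq q μ (matSum q l μ A) fun i j hij hc =>
    matSum_mul_T q l μ ((mem_superMat_iff A).mp hA).2 hij hc
  obtain ⟨l', μ', d, hd, hd'⟩ := id hA
  have e1 : l' = l := Subtype.ext (by rw [hl, ← hd', ro_jmath])
  have e2 : μ' = μ := Subtype.ext (by rw [hμ, ← hd', co_jmath])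
  subst e1 e2
  have hmem : ∀ x ∈ xyMod q r μ'.1, z * x ∈ xyMod q r l'.1 := by
    intro x hx
    obtain ⟨h, rfl⟩ := (mem_xyMod_iff q μ' x).mp hx
    rw [← mul_assoc, hz, ← hd', ← dcSum_eq_matSum q l' μ' hd]
    exact dcSum_mul_mem q l'.1 d μ'.1 h
  have hphi := isPhiMat_leftMulEnd hl hμ z hmem hz
  refine ⟨z, hmem, hz, ?_, hphi⟩
  have hex : A ∈ superMat m n r ∧ ∃ f : QSchur q m n r, IsPhiMat q A f := ⟨hA, _, hphi⟩
  rw [phi, dif_pos hex]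
  exact (hex.2.choose_spec l' μ' d hd hd').unique (hphi l' μ' d hd hd')

theorem isPhiMat_phi (q : Rˣ) {A : Matrix (Fin (m + n)) (Fin (m + n)) ℕ}
    (hA : A ∈ superMat m n r) : IsPhiMat q A (phi (R := R) q r A) := by
  have hsum := ((mem_superMat_iff A).mp hA).1
  obtain ⟨z, hz, -, h1, h2⟩ := exists_phi_eq (R := R) q hA (l := ⟨ro A, hsum⟩)
    (μ := ⟨co A, Finset.sum_comm.trans hsum⟩) rfl rfl
  rw [h1]
  exact h2

end

/-! ### The operators moving one letter to a neighbouring colour -/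

section

variable {R : Type*} [CommRing R] {m n r : ℕ}

/-- The order of the letters used when a letter changes its colour from `p` to `t`: the usual one
if the colour goes down, and the opposite one if it goes up. -/
def Before {N : ℕ} (t p : Fin N) (x y : Fin r) : Prop := if t < p then x < y else y < x

instance {N : ℕ} (t p : Fin N) (x y : Fin r) : Decidable (Before t p x y) :=
  inferInstanceAs (Decidable (if t < p then x < y else y < x))

/-- Two colours that differ by one. -/
def Adjacent {N : ℕ} (t p : Fin N) : Prop := p.val = t.val + 1 ∨ t.val = p.val + 1

theorem Adjacent.ne {N : ℕ} {t p : Fin N} (h : Adjacent t p) : t ≠ p := by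
  rintro rfl
  rcases h with h | h <;> omega

/-- The weight with which the letter `x` of the word `f` changes its colour from `p` to `t`. -/
noncomputable def shiftWeight (q : Rˣ) (t p : Fin (m + n)) (f : Fin r → Fin (m + n))
    (x : Fin r) : Rˣ :=
  invWeight q p ^ (Finset.univ.filter fun y => f y = p ∧ Before t p y x).card *
    heckeChar q t ^ (Finset.univ.filter fun y => f y = t ∧ Before t p x y).card

/-- The weighted sum of the words obtained from `f` by changing the colour of one letter from `p`
to `t`. This is the `q`-analogue of a root vector acting on a tensor power by its iterated
coproduct. -/
noncomputable def shiftSum (q : Rˣ) (l : Comps m n r) (t p : Fin (m + n))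
    (f : Fin r → Fin (m + n)) : Hecke R q r :=
  ∑ x ∈ Finset.univ.filter fun x => f x = p,
    (shiftWeight q t p f x : R) • wordSum q l (Function.update f x t)

theorem before_swap_iff {N : ℕ} (t p : Fin N) {i j x y : Fin r} (hij : j.val = i.val + 1)
    (h1 : ¬ (x = i ∧ y = j)) (h2 : ¬ (x = j ∧ y = i)) :
    Before t p (Equiv.swap i j x) (Equiv.swap i j y) ↔ Before t p x y := by
  unfold Before
  split_ifs
  · exact swap_lt_iff hij h1 h2
  · exact swap_lt_iff hij (fun h => h2 h.symm) fun h => h1 h.symm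

theorem card_filter_comp_perm (P : Fin r → Prop) [DecidablePred P] (d : Equiv.Perm (Fin r)) :
    (Finset.univ.filter fun x => P (d x)).card = (Finset.univ.filter P).card := by
  rw [← Finset.card_map d.toEmbedding]
  congr 1
  ext x
  simp [Finset.mem_map_equiv]

theorem update_swap {α : Type*} (f : Fin r → α) (i j x : Fin r) (t : α) :
    Function.update (fun y => f (Equiv.swap i j y)) (Equiv.swap i j x) t =
      fun y => Function.update f x t (Equiv.swap i j y) := by
  ext y
  by_cases h : y = Equiv.swap i j x
  · subst h; simp
  · have h' : Equiv.swap i j y ≠ x := fun h' => h (by rw [← h', Equiv.swap_apply_self])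
    rw [Function.update_of_ne h, Function.update_of_ne h']

/-- Exchanging two neighbouring letters changes the weight of a letter only if both the letters
have colours in `{p, t}`. -/
theorem shiftWeight_swap (q : Rˣ) {t p : Fin (m + n)} (f : Fin r → Fin (m + n))
    {i j x : Fin r} (hij : j.val = i.val + 1) (hf : f i < f j) (hx : f x = p) :
    shiftWeight q t p (fun y => f (Equiv.swap i j y)) (Equiv.swap i j x) =
      if (x = i ∧ f j = t) ∨ (x = j ∧ f i = t) then heckeChar q t * shiftWeight q t p f x
      else shiftWeight q t p f x := by
  have hlt : i < j := by rw [Fin.lt_def]; omega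
  have h1 : (Finset.univ.filter fun y => f (Equiv.swap i j y) = p ∧
      Before t p y (Equiv.swap i j x)).card =
      (Finset.univ.filter fun y => f y = p ∧ Before t p y x).card := by
    rw [← card_filter_comp_perm (fun y => f y = p ∧ Before t p y x) (Equiv.swap i j)]
    congr 1
    refine Finset.filter_congr fun y _ => and_congr_right fun hy => ?_
    rw [← before_swap_iff t p hij (x := Equiv.swap i j y) (y := x), Equiv.swap_apply_self]
    · rintro ⟨ha, hb⟩; rw [ha, ← hx, hb] at hy; exact hf.ne hy
    · rintro ⟨ha, hb⟩; rw [ha, ← hx, hb] at hy; exact hf.ne' hy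
  have h2 : (Finset.univ.filter fun y => f (Equiv.swap i j y) = t ∧
      Before t p (Equiv.swap i j x) y).card =
      (Finset.univ.filter fun y => f y = t ∧
        Before t p (Equiv.swap i j x) (Equiv.swap i j y)).card := by
    rw [← card_filter_comp_perm (fun y => f y = t ∧
      Before t p (Equiv.swap i j x) (Equiv.swap i j y)) (Equiv.swap i j)]
    simp only [Equiv.swap_apply_self]
  unfold shiftWeight
  rw [h1, h2]
  split_ifs with hc
  · -- The other one of the two letters moves to the far side of `x`.
    have h3 : ∃ y₀, f y₀ = t ∧ ¬ Before t p x y₀ ∧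
        Before t p (Equiv.swap i j x) (Equiv.swap i j y₀) ∧
        ((x = i ∧ y₀ = j) ∨ (x = j ∧ y₀ = i)) := by
      rcases hc with ⟨rfl, hc⟩ | ⟨rfl, hc⟩
      · rw [hx, hc] at hf
        refine ⟨j, hc, ?_, ?_, Or.inl ⟨rfl, rfl⟩⟩ <;> simp [Before, hf.not_gt, hlt, hlt.le]
      · rw [hx, hc] at hf
        refine ⟨i, hc, ?_, ?_, Or.inr ⟨rfl, rfl⟩⟩ <;> simp [Before, hf, hlt, hlt.le]
    obtain ⟨y₀, hy1, hy2, hy3, hy4⟩ := h3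
    have h4 : (Finset.univ.filter fun y => f y = t ∧
        Before t p (Equiv.swap i j x) (Equiv.swap i j y)) =
        insert y₀ (Finset.univ.filter fun y => f y = t ∧ Before t p x y) := by
      ext y
      simp only [Finset.mem_filter, Finset.mem_univ, true_and, Finset.mem_insert]
      by_cases hy : y = y₀
      · rw [hy]; exact iff_of_true ⟨hy1, hy3⟩ (Or.inl rfl)
      · rw [before_swap_iff t p hij]
        · simp [hy]
        · rintro ⟨ha, hb⟩
          rcases hy4 with ⟨h, h'⟩ | ⟨h, h'⟩
          · exact hy (hb.trans h'.symm)
          · exact hlt.ne (ha.symm.trans h)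
        · rintro ⟨ha, hb⟩
          rcases hy4 with ⟨h, h'⟩ | ⟨h, h'⟩
          · exact hlt.ne (h.symm.trans ha)
          · exact hy (hb.trans h'.symm)
    rw [h4, Finset.card_insert_of_notMem (by simp [hy2]), pow_succ']
    exact mul_left_comm _ _ _
  · congr 3
    refine Finset.filter_congr fun y _ => and_congr_right fun hy => before_swap_iff t p hij ?_ ?_
    · rintro ⟨rfl, rfl⟩; exact hc (Or.inl ⟨rfl, hy⟩)
    · rintro ⟨rfl, rfl⟩; exact hc (Or.inr ⟨rfl, hy⟩)

/-- Moving a letter to a neighbouring colour commutes with the right action of the Hecke algebra;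
ascents are enough. -/
theorem shiftSum_mul_T_of_lt (q : Rˣ) (l : Comps m n r) {t p : Fin (m + n)} (htp : Adjacent t p)
    (f : Fin r → Fin (m + n)) {i j : Fin r} (hij : j.val = i.val + 1) (hf : f i < f j) :
    shiftSum q l t p f * Hecke.T R q r (Equiv.swap i j) =
      shiftSum q l t p fun x => f (Equiv.swap i j x) := by
  have hne : i ≠ j := by rintro rfl; omega
  rw [shiftSum, shiftSum, Finset.sum_mul]
  refine Finset.sum_equiv (Equiv.swap i j) (fun x => by simp) fun x hx => ?_
  simp only [Finset.mem_filter, Finset.mem_univ, true_and] at hx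
  rw [update_swap, shiftWeight_swap q f hij hf hx, smul_mul_assoc]
  split_ifs with hc
  · have he : Function.update f x t i = t ∧ Function.update f x t j = t := by
      rcases hc with ⟨rfl, hc⟩ | ⟨rfl, hc⟩
      · simp [hne.symm, hc]
      · simp [hne, hc]
    rw [wordSum_mul_T_of_eq q l _ hij (he.1.trans he.2.symm), he.1, smul_smul, Units.val_mul,
      mul_comm]
    congr 2
    ext y
    rw [apply_swap_eq (Function.update f x t) (he.1.trans he.2.symm)]
  · rw [wordSum_mul_T_of_lt q l _ hij]
    by_cases hi : x = i
    · subst hi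
      have : f j ≠ t := fun h => hc (Or.inl ⟨rfl, h⟩)
      rw [Function.update_self, Function.update_of_ne hne.symm]
      rcases htp with h | h <;> (rw [← hx] at h; grind)
    by_cases hj : x = j
    · subst hj
      have : f i ≠ t := fun h => hc (Or.inr ⟨rfl, h⟩)
      rw [Function.update_self, Function.update_of_ne hne]
      rcases htp with h | h <;> (rw [← hx] at h; grind)
    · rwa [Function.update_of_ne (Ne.symm hi), Function.update_of_ne (Ne.symm hj)]

theorem card_pair_fst (x : Fin r) (P : Fin r → Prop) [DecidablePred P] :
    (Finset.univ.filter fun p : Fin r × Fin r => p.1 = x ∧ P p.2).card =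
      (Finset.univ.filter P).card := by
  rw [← Finset.card_map (⟨fun y => (x, y), fun a b h => by simpa using h⟩ : Fin r ↪ Fin r × Fin r)]
  congr 1
  ext ⟨a, b⟩
  simp only [Finset.mem_filter, Finset.mem_univ, true_and, Finset.mem_map]
  constructor
  · rintro ⟨rfl, h⟩; exact ⟨b, h, rfl⟩
  · rintro ⟨y, h, he⟩; cases he; exact ⟨rfl, h⟩

theorem card_pair_snd (x : Fin r) (P : Fin r → Prop) [DecidablePred P] :
    (Finset.univ.filter fun p : Fin r × Fin r => p.2 = x ∧ P p.1).card =
      (Finset.univ.filter P).card := by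
  rw [← card_pair_fst x P, ← Finset.card_map (Equiv.prodComm _ _).toEmbedding]
  congr 1
  ext ⟨a, b⟩
  simp [Finset.mem_map_equiv]

theorem oddInv_update_of_even (c f : Fin r → Fin (m + n)) (x : Fin r) (t : Fin (m + n))
    (hx : (c x).val < m) : oddInv c (Function.update f x t) = oddInv c f := by
  unfold oddInv
  congr 1
  refine Finset.filter_congr ?_
  rintro ⟨a, b⟩ -
  refine and_congr_right fun _ => and_congr_right fun hc => and_congr_right fun hm => ?_
  simp only at hc hm
  rw [Function.update_of_ne, Function.update_of_ne]
  · rintro rfl; exact absurd hx (not_lt.mpr hm)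
  · rintro rfl; exact absurd (hc ▸ hx) (not_lt.mpr hm)

/-- The change of the number of odd inversions when a letter in an odd block moves to a
neighbouring colour. -/
theorem oddInv_update_of_odd (c f : Fin r → Fin (m + n)) {t p : Fin (m + n)} (htp : Adjacent t p)
    {x : Fin r} (hx : f x = p) (hm : m ≤ (c x).val) :
    oddInv c (Function.update f x t) +
        (Finset.univ.filter fun y => c y = c x ∧ f y = t ∧ Before t p x y).card =
      oddInv c f + (Finset.univ.filter fun y => c y = c x ∧ f y = p ∧ Before t p y x).card := by
  have hupd : ∀ y, y ≠ x → Function.update f x t y = f y := fun y hy => Function.update_of_ne hy _ _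
  have hself : Function.update f x t x = t := Function.update_self _ _ _
  rcases htp with h | h
  · have hlt : t < p := by rw [Fin.lt_def]; omega
    rw [← card_pair_fst x fun y => c y = c x ∧ f y = t ∧ Before t p x y,
      ← card_pair_snd x fun y => c y = c x ∧ f y = p ∧ Before t p y x]
    simp only [oddInv, Before, if_pos hlt, Finset.card_filter, ← Finset.sum_add_distrib]
    refine Finset.sum_congr rfl ?_
    rintro ⟨a, b⟩ -
    simp only
    by_cases ha : a = x
    · by_cases hb : b = x
      · subst ha hb; simp
      · subst ha
        rw [hself, hupd b hb, hx]
        simp only [Fin.lt_def, Fin.ext_iff] at hb ⊢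
        grind
    · by_cases hb : b = x
      · subst hb
        rw [hself, hupd a ha, hx]
        simp only [Fin.lt_def, Fin.ext_iff] at ha ⊢
        grind
      · rw [hupd a ha, hupd b hb]
        simp only [ha, hb, false_and, if_false]
  · have hlt : ¬ t < p := by rw [Fin.lt_def]; omega
    rw [← card_pair_snd x fun y => c y = c x ∧ f y = t ∧ Before t p x y,
      ← card_pair_fst x fun y => c y = c x ∧ f y = p ∧ Before t p y x]
    simp only [oddInv, Before, if_neg hlt, Finset.card_filter, ← Finset.sum_add_distrib]
    refine Finset.sum_congr rfl ?_
    rintro ⟨a, b⟩ -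
    simp only
    by_cases ha : a = x
    · by_cases hb : b = x
      · subst ha hb; simp
      · subst ha
        rw [hself, hupd b hb, hx]
        simp only [Fin.lt_def, Fin.ext_iff] at hb ⊢
        grind
    · by_cases hb : b = x
      · subst hb
        rw [hself, hupd a ha, hx]
        simp only [Fin.lt_def, Fin.ext_iff] at ha ⊢
        grind
      · rw [hupd a ha, hupd b hb]
        simp only [ha, hb, false_and, if_false]

theorem wordMat_update {N : ℕ} (f g : Fin r → Fin N) (x : Fin r) (t : Fin N) :
    wordMat (Function.update f x t) g + Matrix.single (f x) (g x) 1 =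
      wordMat f g + Matrix.single t (g x) 1 := by
  ext i j
  have key : ∀ f' : Fin r → Fin N, (∀ y, y ≠ x → f' y = f y) → wordMat f' g i j =
      (Finset.univ.filter fun y => y ≠ x ∧ f y = i ∧ g y = j).card +
        Matrix.single (f' x) (g x) 1 i j := by
    intro f' hf'
    rw [wordMat_apply, Matrix.single_apply, Finset.card_filter, Finset.card_filter,
      ← Finset.add_sum_erase _ _ (Finset.mem_univ x),
      ← Finset.add_sum_erase _ (fun y => if y ≠ x ∧ f y = i ∧ g y = j then 1 else 0)
        (Finset.mem_univ x)]
    simp only [ne_eq, not_true_eq_false, false_and, if_false, zero_add]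
    rw [add_comm]
    congr 1
    refine Finset.sum_congr rfl fun y hy => ?_
    have hy := Finset.ne_of_mem_erase hy
    rw [hf' y hy]
    simp [hy]
  rw [Matrix.add_apply, Matrix.add_apply, key f fun _ _ => rfl,
    key (Function.update f x t) fun y hy => Function.update_of_ne hy _ _, Function.update_self]
  omega

theorem wordMat_col_self (l : Comps m n r) : wordMat (col l) (col l) = Matrix.diagonal l.1 := by
  ext i j
  rw [wordMat_apply, Matrix.diagonal_apply]
  split_ifs with h
  · subst h; simp [card_col]
  · rw [Finset.card_eq_zero, Finset.filter_eq_empty_iff]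
    rintro x - ⟨h1, h2⟩
    exact h (h1.symm.trans h2)

theorem co_diagonal_add_single {N : ℕ} (X : Fin N → ℕ) (t p : Fin N) :
    co (Matrix.diagonal X + Matrix.single t p 1) = X + Pi.single p 1 := by
  ext j
  simp only [co, Matrix.add_apply, Finset.sum_add_distrib, Matrix.diagonal_apply,
    Matrix.single_apply, Pi.add_apply, Finset.sum_ite_eq', Finset.mem_univ, if_true,
    Pi.single_apply]
  congr 1
  by_cases h : p = j
  · subst h; simp
  · simp [h, Ne.symm h]

theorem ro_diagonal_add_single {N : ℕ} (X : Fin N → ℕ) (t p : Fin N) :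
    ro (Matrix.diagonal X + Matrix.single t p 1) = X + Pi.single t 1 := by
  ext j
  simp only [ro, Matrix.add_apply, Finset.sum_add_distrib, Matrix.diagonal_apply,
    Matrix.single_apply, Pi.add_apply, Finset.sum_ite_eq, Finset.mem_univ, if_true, Pi.single_apply]
  congr 1
  by_cases h : t = j
  · subst h; simp
  · simp [h, Ne.symm h]

/-- For the matrix `D` of an elementary move the double coset sum is the sum of all moves of one
letter of the word `col l`. -/
theorem matSum_eq_shiftSum (q : Rˣ) (l l' : Comps m n r) {t p : Fin (m + n)} (htp : Adjacent t p)
    (X : Fin (m + n) → ℕ)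
    (hl : co (Matrix.diagonal X + Matrix.single t p 1) = l.1) :
    (matSum q l' l (Matrix.diagonal X + Matrix.single t p 1) : Hecke R q r) =
      shiftSum q l' t p (col l) := by
  symm
  have hD : Matrix.diagonal X + Matrix.single t p 1 + Matrix.single p p 1 =
      Matrix.diagonal l.1 + Matrix.single t p 1 := by
    have : Matrix.diagonal (X + Pi.single p 1) = Matrix.diagonal X + Matrix.single p p 1 := by
      rw [← Matrix.diagonal_single, Matrix.diagonal_add]
      rfl
    rw [← hl, co_diagonal_add_single, this]
    abel
  have hoff : ∀ i j, i ≠ j → (Matrix.diagonal X + Matrix.single t p 1 : Matrix _ _ ℕ) i j ≠ 0 →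
      i = t ∧ j = p := by
    intro i j hij h0
    by_contra hc
    refine h0 ?_
    rw [Matrix.add_apply, Matrix.diagonal_apply_ne _ hij, Matrix.single_apply, if_neg, add_zero]
    rintro ⟨rfl, rfl⟩; exact hc ⟨rfl, rfl⟩
  have htpD : (Matrix.diagonal X + Matrix.single t p 1 : Matrix _ _ ℕ) t p = 1 := by
    rw [Matrix.add_apply, Matrix.diagonal_apply_ne _ htp.ne]; simp
  refine Finset.sum_bij (fun x _ => Function.update (col l) x t) ?_ ?_ ?_ ?_
  · intro x hx
    simp only [Finset.mem_filter, Finset.mem_univ, true_and] at hx ⊢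
    have := wordMat_update (col l) (col l) x t
    rw [hx, wordMat_col_self, ← hD] at this
    exact add_right_cancel this
  · intro x hx y hy he
    simp only [Finset.mem_filter, Finset.mem_univ, true_and] at hx hy
    by_contra hne
    have := congrFun he x
    rw [Function.update_self, Function.update_of_ne hne, hx] at this
    exact htp.ne this
  · intro f hf
    simp only [Finset.mem_filter, Finset.mem_univ, true_and] at hf
    have h1 := htpD
    rw [← hf, wordMat_apply, Finset.card_eq_one] at h1
    obtain ⟨x, hx⟩ := h1
    have hx' : f x = t ∧ col l x = p := by
      have : x ∈ ({x} : Finset (Fin r)) := Finset.mem_singleton_self x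
      rw [← hx] at this
      simpa using this
    refine ⟨x, by simp [hx'.2], ?_⟩
    ext y
    by_cases hy : y = x
    · subst hy; rw [Function.update_self, hx'.1]
    · rw [Function.update_of_ne hy]
      by_contra hne
      have h2 := hoff (f y) (col l y) (fun h => hne (by rw [h])) (by
        rw [← hf, wordMat_apply, Finset.card_ne_zero]
        exact ⟨y, by simp⟩)
      have : y ∈ (Finset.univ.filter fun x => f x = t ∧ col l x = p) := by simp [h2]
      rw [hx, Finset.mem_singleton] at this
      exact hy this
  · intro x hx
    simp only [Finset.mem_filter, Finset.mem_univ, true_and] at hx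
    congr 2
    have h0 : oddInv (col l) (col l) = 0 := by
      simp only [oddInv, Finset.card_eq_zero, Finset.filter_eq_empty_iff]
      rintro ⟨a, b⟩ - ⟨-, h1, -, h2⟩
      exact h2.ne h1.symm
    have h2 : (Finset.univ.filter fun y => col l y = t ∧ Before t p x y).card = 0 := by
      rw [Finset.card_eq_zero, Finset.filter_eq_empty_iff]
      rintro y - ⟨hy, hb⟩
      unfold Before at hb
      split_ifs at hb with hlt
      · rw [← hy, ← hx] at hlt
        exact (lt_of_col_lt l hlt).not_gt hb
      · have hlt : p < t := lt_of_le_of_ne (not_lt.mp hlt) htp.ne.symm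
        rw [← hy, ← hx] at hlt
        exact (lt_of_col_lt l hlt).not_gt hb
    unfold shiftWeight
    rw [h2, pow_zero, mul_one, invWeight]
    split_ifs with hp
    · rw [one_pow, oddInv_update_of_even _ _ _ _ (hx ▸ hp), h0, pow_zero]
    · have h3 := oddInv_update_of_odd (col l) (col l) htp hx (by rw [hx]; omega)
      rw [h0, zero_add, hx] at h3
      have h4 : (Finset.univ.filter fun y => col l y = p ∧ col l y = t ∧ Before t p x y).card =
          0 := by
        rw [Finset.card_eq_zero, Finset.filter_eq_empty_iff]
        rintro y - ⟨ha, hb, -⟩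
        exact htp.ne (hb.symm.trans ha)
      rw [h4, add_zero] at h3
      rw [h3]
      simp only [← and_assoc, and_self]

end

/-! ### Products with the matrix of an elementary move -/

section

variable {R : Type*} [CommRing R] {m n r : ℕ}

theorem before_comm {N : ℕ} {t p : Fin N} (h : t ≠ p) (x y : Fin r) :
    Before t p x y ↔ Before p t y x := by
  unfold Before
  rcases lt_or_gt_of_ne h with h | h
  · rw [if_pos h, if_neg h.not_gt]
  · rw [if_neg h.not_gt, if_pos h]

theorem not_before_self {N : ℕ} (t p : Fin N) (x : Fin r) : ¬ Before t p x x := by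
  unfold Before
  split_ifs <;> exact lt_irrefl x

theorem before_of_before_col {N : ℕ} {t p : Fin N} (μ : Comps m n r) {x y : Fin r}
    (h : Before t p (col μ x) (col μ y)) : Before t p x y := by
  unfold Before at *
  split_ifs at * <;> exact lt_of_col_lt μ h

theorem before_col_of_before {N : ℕ} {t p : Fin N} (μ : Comps m n r) {x y : Fin r}
    (h : Before t p x y) (hne : col μ x ≠ col μ y) : Before t p (col μ x) (col μ y) := by
  unfold Before at *
  split_ifs at * with hc
  · exact lt_of_le_of_ne (col_mono μ h.le) hne
  · exact lt_of_le_of_ne (col_mono μ h.le) hne.symm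

/-- The letters of colour `c` before `x`, sorted by their blocks. -/
theorem card_before {t p c : Fin (m + n)} (μ : Comps m n r) (f : Fin r → Fin (m + n))
    (x : Fin r) :
    (Finset.univ.filter fun y => f y = c ∧ Before t p y x).card =
      ∑ j ∈ Finset.univ.filter fun j => Before t p j (col μ x), wordMat f (col μ) c j +
        (Finset.univ.filter fun y => col μ y = col μ x ∧ f y = c ∧ Before t p y x).card := by
  rw [← Finset.card_filter_add_card_filter_not (s := Finset.univ.filter fun y =>
    f y = c ∧ Before t p y x) (fun y => Before t p (col μ y) (col μ x)),
    Finset.filter_filter, Finset.filter_filter]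
  congr 1
  · rw [Finset.card_eq_sum_card_fiberwise (f := col μ)
      (t := Finset.univ.filter fun j => Before t p j (col μ x))]
    · refine Finset.sum_congr rfl fun j hj => ?_
      rw [wordMat_apply, Finset.filter_filter]
      congr 1
      refine Finset.filter_congr fun y _ => ?_
      simp only [Finset.mem_filter, Finset.mem_univ, true_and] at hj
      constructor
      · rintro ⟨⟨⟨h1, -⟩, -⟩, h2⟩; exact ⟨h1, h2⟩
      · rintro ⟨h1, rfl⟩; exact ⟨⟨⟨h1, before_of_before_col μ hj⟩, hj⟩, rfl⟩
    · intro y hy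
      simp only [Finset.coe_filter, Finset.mem_univ, true_and, Set.mem_ofPred_eq] at hy ⊢
      exact hy.2
  · congr 1
    refine Finset.filter_congr fun y _ => ?_
    constructor
    · rintro ⟨⟨h1, h2⟩, h3⟩
      refine ⟨?_, h1, h2⟩
      by_contra hne
      exact h3 (before_col_of_before μ h2 hne)
    · rintro ⟨h1, h2, h3⟩
      exact ⟨⟨h2, h3⟩, by rw [h1]; exact not_before_self _ _ _⟩

/-- The factor contributed to `φ_D φ_A` by the letters outside the column `k`, for a move in the
column `k` from the row `p` to the row `t`. -/
noncomputable def outerWeight (q : Rˣ) (A : Matrix (Fin (m + n)) (Fin (m + n)) ℕ)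
    (t p k : Fin (m + n)) : Rˣ :=
  invWeight q p ^ (∑ j ∈ Finset.univ.filter fun j => Before t p j k, A p j) *
    heckeChar q t ^ (∑ j ∈ Finset.univ.filter fun j => Before t p k j, A t j)

/-- The factor contributed to `φ_D φ_A` by every letter in the position `(t, k)` that is passed in a
move into this position. At a position of mixed parity it is `-1`, elsewhere `q` or `q⁻¹`. -/
noncomputable def innerWeight (q : Rˣ) (t k : Fin (m + n)) : Rˣ :=
  if k.val < m then heckeChar q t else (-q)⁻¹ * heckeChar q t

/-- The weight of a word together with a letter that moves: a factor that depends on the matrix and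
the column only, the weight of the moved word, and one factor for every letter of colour `t`
in the same block that the letter passes. -/
theorem weight_eq (q : Rˣ) (μ : Comps m n r) {t p : Fin (m + n)} (htp : Adjacent t p)
    {f : Fin r → Fin (m + n)} (hA : ParityBound (wordMat f (col μ))) {x : Fin r} (hx : f x = p) :
    ((-q)⁻¹ ^ oddInv (col μ) f * shiftWeight q t p f x : Rˣ) =
      outerWeight q (wordMat f (col μ)) t p (col μ x) *
        ((-q)⁻¹ ^ oddInv (col μ) (Function.update f x t) * innerWeight q t (col μ x) ^
          (Finset.univ.filter fun y => col μ y = col μ x ∧ f y = t ∧ Before t p x y).card) := by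
  have h1 := card_before (t := t) (p := p) (c := p) μ f x
  have h2 := card_before (t := p) (p := t) (c := t) μ f x
  simp only [← before_comm htp.ne] at h2
  set U := (Finset.univ.filter fun y => col μ y = col μ x ∧ f y = p ∧ Before t p y x).card with hU
  set T := (Finset.univ.filter fun y => col μ y = col μ x ∧ f y = t ∧ Before t p x y).card
  rw [shiftWeight, h1, h2, outerWeight]
  -- A second letter in the position `(p, col μ x)` excludes that this position is mixed.
  have hU0 : ¬ (p.val < m ↔ (col μ x).val < m) → U = 0 := by
    intro hp
    have h3 := hA _ _ hp
    rw [hU, Finset.card_eq_zero, Finset.filter_eq_empty_iff]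
    rintro y - ⟨ha, hb, hc⟩
    rw [wordMat_apply, Finset.card_le_one] at h3
    have := h3 y (by simp [ha, hb]) x (by simp [hx])
    subst this
    exact not_before_self _ _ _ hc
  have key : ((-q)⁻¹ ^ oddInv (col μ) f * (invWeight q p ^ U * heckeChar q t ^ T) : Rˣ) =
      (-q)⁻¹ ^ oddInv (col μ) (Function.update f x t) * innerWeight q t (col μ x) ^ T := by
    unfold innerWeight
    split_ifs with hk
    · rw [oddInv_update_of_even _ _ _ _ hk]
      have : invWeight q p ^ U = 1 := by
        by_cases hp : p.val < m
        · rw [invWeight, if_pos hp, one_pow]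
        · rw [hU0 (by tauto), pow_zero]
      rw [this, one_mul]
    · have h3 := oddInv_update_of_odd (col μ) f htp hx (not_lt.mp hk)
      have : invWeight q p ^ U = (-q)⁻¹ ^ U := by
        by_cases hp : p.val < m
        · rw [hU0 (by tauto), pow_zero, pow_zero]
        · rw [invWeight, if_neg hp]
      rw [this, mul_pow, ← mul_assoc, ← mul_assoc, ← pow_add, ← pow_add, h3]
  rw [pow_add, pow_add, ← key]
  simp only [mul_assoc, mul_left_comm, mul_comm]

theorem sum_pow_card_gt {α : Type*} [LinearOrder α] (S : Finset α) (a : R) :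
    ∑ x ∈ S, a ^ (S.filter fun y => x < y).card = gaussInt a S.card := by
  induction S using Finset.induction_on_min with
  | empty => simp [gaussInt]
  | insert b S hb ih =>
    have hbS : b ∉ S := fun h => (hb b h).false
    rw [Finset.sum_insert hbS, Finset.card_insert_of_notMem hbS, gaussInt,
      Finset.sum_range_succ, ← gaussInt, ← ih, add_comm]
    congr 1
    · refine Finset.sum_congr rfl fun x hx => ?_
      rw [Finset.filter_insert, if_neg (hb x hx).not_gt]
    · rw [Finset.filter_insert, if_neg (lt_irrefl b), Finset.filter_true_of_mem hb]

theorem sum_pow_card_before {N : ℕ} (t p : Fin N) (S : Finset (Fin r)) (a : R) :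
    ∑ x ∈ S, a ^ (S.filter fun y => Before t p x y).card = gaussInt a S.card := by
  unfold Before
  by_cases h : t < p
  · simp only [if_pos h]
    exact sum_pow_card_gt S a
  · simp only [if_neg h]
    exact sum_pow_card_gt (α := (Fin r)ᵒᵈ) S a

theorem moveEntry_add {N : ℕ} {A : Matrix (Fin N) (Fin N) ℕ} {t p k : Fin N} (h : 1 ≤ A p k) :
    moveEntry A t p k + Matrix.single p k 1 = A + Matrix.single t k 1 := by
  ext i j
  simp only [moveEntry, Matrix.add_apply, Matrix.sub_apply]
  refine Nat.sub_add_cancel (le_add_right ?_)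
  rw [Matrix.single_apply]
  split_ifs with hc
  · rwa [← hc.1, ← hc.2]
  · exact Nat.zero_le _

theorem moveEntry_apply_target {N : ℕ} {A : Matrix (Fin N) (Fin N) ℕ} {t p k : Fin N}
    (htp : t ≠ p) (h : 1 ≤ A p k) : moveEntry A t p k t k = A t k + 1 := by
  have := congrFun (congrFun (moveEntry_add (t := t) h) t) k
  simpa [Matrix.add_apply, Matrix.single_apply, htp.symm] using this

theorem moveEntry_apply_le {N : ℕ} {A : Matrix (Fin N) (Fin N) ℕ} {t p k i j : Fin N}
    (h : 1 ≤ A p k) (hne : ¬ (i = t ∧ j = k)) : moveEntry A t p k i j ≤ A i j := by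
  have := congrFun (congrFun (moveEntry_add (t := t) h) i) j
  rw [Matrix.add_apply, Matrix.add_apply, Matrix.single_apply t, if_neg fun hc =>
    hne ⟨hc.1.symm, hc.2.symm⟩] at this
  omega

/-- The variable of the Gaussian integer for a move into the row `t`. -/
noncomputable def rowParam (q : Rˣ) (t : Fin (m + n)) : Rˣ := if t.val < m then q else q⁻¹

theorem gaussInt_one (a : R) : gaussInt a 1 = 1 := by simp [gaussInt]

theorem gaussInt_neg_one_two : gaussInt (-1 : R) 2 = 0 := by
  simp [gaussInt, Finset.sum_range_succ]

open scoped Classical in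
/-- If the moved matrix is not in the index set, the signs make the Gaussian integer vanish. -/
theorem gaussInt_innerWeight (q : Rˣ) {A : Matrix (Fin (m + n)) (Fin (m + n)) ℕ}
    (hA : ParityBound A) {t p k : Fin (m + n)} (htp : Adjacent t p) (h : 1 ≤ A p k) :
    gaussInt (innerWeight q t k : R) (A t k + 1) =
      if ParityBound (moveEntry A t p k) then gaussInt (rowParam q t : R) (A t k + 1) else 0 := by
  have ht := moveEntry_apply_target htp.ne h
  by_cases hpar : t.val < m ↔ k.val < m
  · have h1 : ParityBound (moveEntry A t p k) := fun i j hij =>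
      (moveEntry_apply_le h fun hc => hij (by rw [hc.1, hc.2]; exact hpar)).trans (hA i j hij)
    have h2 : innerWeight q t k = rowParam q t := by
      unfold innerWeight rowParam heckeChar
      by_cases hk : k.val < m
      · simp [hk, hpar.mpr hk]
      · simp [hk, mt hpar.mp hk]
    rw [if_pos h1, h2]
  · split_ifs with h1
    · have := h1 t k hpar
      have h0 : A t k = 0 := by omega
      rw [h0, zero_add, gaussInt_one, gaussInt_one]
    · have h2 : A t k = 1 := by
        by_contra hne
        refine h1 fun i j hij => ?_
        by_cases hc : i = t ∧ j = k
        · rw [hc.1, hc.2, ht]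
          have := hA t k hpar
          omega
        · exact (moveEntry_apply_le h hc).trans (hA i j hij)
      have h3 : (innerWeight q t k : R) = -1 := by
        unfold innerWeight heckeChar
        by_cases hk : k.val < m
        · simp [hk, show ¬ t.val < m by tauto]
        · simp [hk, show t.val < m by tauto]
      rw [h2, h3, gaussInt_neg_one_two]

/-- The coefficient of `φ` of the moved matrix in the product `φ_D φ_A`. -/
noncomputable def moveCoeff (q : Rˣ) (A : Matrix (Fin (m + n)) (Fin (m + n)) ℕ)
    (t p k : Fin (m + n)) : R :=
  (outerWeight q A t p k : R) * gaussInt (rowParam q t : R) (A t k + 1)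

theorem wordMat_update_eq_moveEntry_iff {N : ℕ} {f g : Fin r → Fin N} {x : Fin r}
    {t p : Fin N} {A : Matrix (Fin N) (Fin N) ℕ} (hx : f x = p) (h : 1 ≤ A p (g x)) :
    wordMat (Function.update f x t) g = moveEntry A t p (g x) ↔ wordMat f g = A := by
  have h1 := wordMat_update f g x t
  rw [hx] at h1
  rw [← add_left_inj (Matrix.single p (g x) 1), h1, moveEntry_add h, add_left_inj]

open scoped Classical in
/-- Moving one letter in all words of matrix `A`. A word of the matrix `A + E_{t,k} - E_{p,k}` is
reached once from each of its `A t k + 1` letters in the position `(t, k)`, with weights that form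
a geometric progression. -/
theorem sum_shiftSum (q : Rˣ) (l μ : Comps m n r) {t p : Fin (m + n)} (htp : Adjacent t p)
    {A : Matrix (Fin (m + n)) (Fin (m + n)) ℕ} (hA : ParityBound A) :
    ∑ f ∈ Finset.univ.filter fun f : Fin r → Fin (m + n) => wordMat f (col μ) = A,
      (((-q)⁻¹ ^ oddInv (col μ) f : Rˣ) : R) • (shiftSum q l t p f : Hecke R q r) =
    ∑ k ∈ Finset.univ.filter fun k => 1 ≤ A p k, moveCoeff (R := R) q A t p k •
      if ParityBound (moveEntry A t p k) then matSum q l μ (moveEntry A t p k) else 0 := by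
  -- A pair of a word and a letter that moves is recorded by the moved word and the letter.
  let G : (Fin r → Fin (m + n)) → Fin r → Hecke R q r := fun f' x =>
    (((-q)⁻¹ ^ oddInv (col μ) (Function.update f' x p) *
      shiftWeight q t p (Function.update f' x p) x : Rˣ) : R) • wordSum q l f'
  have hback : ∀ (f : Fin r → Fin (m + n)) (x : Fin r) (a b : Fin (m + n)), f x = a →
      Function.update (Function.update f x b) x a = f := by
    rintro f x a b rfl; simp
  have step1 : ∑ f ∈ Finset.univ.filter fun f : Fin r → Fin (m + n) => wordMat f (col μ) = A,
      (((-q)⁻¹ ^ oddInv (col μ) f : Rˣ) : R) • (shiftSum q l t p f : Hecke R q r) =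
      ∑ x, ∑ f ∈ Finset.univ.filter fun f : Fin r → Fin (m + n) =>
        wordMat f (col μ) = A ∧ f x = p, G (Function.update f x t) x := by
    rw [Finset.sum_comm' (t' := Finset.univ.filter fun f : Fin r → Fin (m + n) =>
      wordMat f (col μ) = A) (s' := fun f => Finset.univ.filter fun x => f x = p)
      (by simp [and_comm])]
    refine Finset.sum_congr rfl fun f _ => ?_
    rw [shiftSum, Finset.smul_sum]
    refine Finset.sum_congr rfl fun x hx => ?_
    simp only [Finset.mem_filter, Finset.mem_univ, true_and] at hx
    simp only [G]
    rw [hback f x p t hx, smul_smul, Units.val_mul]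
  have step2 : ∀ x, ∑ f ∈ Finset.univ.filter fun f : Fin r → Fin (m + n) =>
        wordMat f (col μ) = A ∧ f x = p, G (Function.update f x t) x =
      ∑ f' ∈ Finset.univ.filter fun f' : Fin r → Fin (m + n) =>
        (1 ≤ A p (col μ x) ∧ wordMat f' (col μ) = moveEntry A t p (col μ x)) ∧ f' x = t,
        G f' x := by
    intro x
    refine Finset.sum_bij' (fun f _ => Function.update f x t) (fun f' _ => Function.update f' x p)
      ?_ ?_ ?_ ?_ (fun _ _ => rfl)
    · intro f hf
      simp only [Finset.mem_filter, Finset.mem_univ, true_and] at hf ⊢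
      have h1 : 1 ≤ A p (col μ x) := by
        rw [← hf.1, wordMat_apply, Nat.one_le_iff_ne_zero, Finset.card_ne_zero]
        exact ⟨x, by simp [hf.2]⟩
      exact ⟨⟨h1, (wordMat_update_eq_moveEntry_iff hf.2 h1).mpr hf.1⟩, Function.update_self _ _ _⟩
    · intro f' hf
      simp only [Finset.mem_filter, Finset.mem_univ, true_and] at hf ⊢
      refine ⟨?_, Function.update_self _ _ _⟩
      rw [← wordMat_update_eq_moveEntry_iff (t := t) (Function.update_self x p f') hf.1.1,
        hback f' x t p hf.2, hf.1.2]
    · intro f hf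
      simp only [Finset.mem_filter, Finset.mem_univ, true_and] at hf
      exact hback f x p t hf.2
    · intro f' hf
      simp only [Finset.mem_filter, Finset.mem_univ, true_and] at hf
      exact hback f' x t p hf.2
  have step3 : ∀ k, 1 ≤ A p k → ∀ f' : Fin r → Fin (m + n),
      wordMat f' (col μ) = moveEntry A t p k →
      ∑ x ∈ Finset.univ.filter fun x => f' x = t ∧ col μ x = k, G f' x =
        ((outerWeight q A t p k : R) * gaussInt (innerWeight q t k : R) (A t k + 1)) •
          ((((-q)⁻¹ ^ oddInv (col μ) f' : Rˣ) : R) • wordSum q l f') := by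
    intro k hk f' hf'
    have hcard : (Finset.univ.filter fun x => f' x = t ∧ col μ x = k).card = A t k + 1 := by
      rw [← wordMat_apply, hf', moveEntry_apply_target htp.ne hk]
    rw [← hcard, ← sum_pow_card_before t p, Finset.mul_sum, Finset.sum_smul]
    refine Finset.sum_congr rfl fun x hx => ?_
    simp only [Finset.mem_filter, Finset.mem_univ, true_and] at hx
    have hfx : Function.update f' x p x = p := Function.update_self _ _ _
    have hA' : wordMat (Function.update f' x p) (col μ) = A := by
      rw [← wordMat_update_eq_moveEntry_iff (t := t) hfx (by rw [hx.2]; exact hk),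
        hback f' x t p hx.1, hf', hx.2]
    have hw := weight_eq q μ htp (f := Function.update f' x p) (by rw [hA']; exact hA) hfx
    rw [hA', hback f' x t p hx.1, hx.2] at hw
    have hset : (Finset.univ.filter fun y => col μ y = k ∧ Function.update f' x p y = t ∧
        Before t p x y) = (Finset.univ.filter fun x => f' x = t ∧ col μ x = k).filter
          fun y => Before t p x y := by
      rw [Finset.filter_filter]
      refine Finset.filter_congr fun y _ => ?_
      by_cases hy : y = x
      · subst hy
        simp [not_before_self]
      · rw [Function.update_of_ne hy]; tauto
    simp only [G]
    rw [hw, hset, smul_smul, Units.val_mul, Units.val_mul,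
      Units.val_pow_eq_pow_val (innerWeight q t k)]
    congr 1
    ring
  have step4 : ∀ k, 1 ≤ A p k → ∑ x ∈ Finset.univ.filter fun x => col μ x = k,
      ∑ f' ∈ Finset.univ.filter fun f' : Fin r → Fin (m + n) =>
        (1 ≤ A p (col μ x) ∧ wordMat f' (col μ) = moveEntry A t p (col μ x)) ∧ f' x = t, G f' x =
      ∑ f' ∈ Finset.univ.filter fun f' : Fin r → Fin (m + n) =>
        wordMat f' (col μ) = moveEntry A t p k,
        ∑ x ∈ Finset.univ.filter fun x => f' x = t ∧ col μ x = k, G f' x := by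
    intro k hk
    refine Finset.sum_comm' fun x f' => ?_
    simp only [Finset.mem_filter, Finset.mem_univ, true_and]
    constructor
    · rintro ⟨rfl, ⟨-, h1⟩, h2⟩; exact ⟨⟨h2, rfl⟩, h1⟩
    · rintro ⟨⟨h2, rfl⟩, h1⟩; exact ⟨rfl, ⟨hk, h1⟩, h2⟩
  rw [step1, Finset.sum_congr rfl fun x _ => step2 x,
    ← Finset.sum_fiberwise_of_maps_to (s := Finset.univ) (t := Finset.univ) (g := col μ)
      (fun _ _ => Finset.mem_univ _), Finset.sum_filter]
  refine Finset.sum_congr rfl fun k _ => ?_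
  by_cases hk : 1 ≤ A p k
  · rw [if_pos hk, step4 k hk, Finset.sum_congr rfl fun f' hf' =>
      (step3 k hk f' (Finset.mem_filter.mp hf').2).trans (by
        rw [gaussInt_innerWeight q hA htp hk]), ← Finset.smul_sum]
    split_ifs with hB
    · rfl
    · rw [mul_zero, zero_smul, smul_zero]
  · rw [if_neg hk]
    refine Finset.sum_eq_zero fun x hx => Finset.sum_eq_zero fun f' hf' => ?_
    simp only [Finset.mem_filter, Finset.mem_univ, true_and] at hx hf'
    exact absurd (hx ▸ hf'.1.1) hk

/-- A left multiple of `[xy]_l` that is a sum of moves of the word `col l` acts on every other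
word of the same content by the same rule. -/
theorem mul_wordSum_eq_shiftSum (q : Rˣ) (l l' : Comps m n r) {t p : Fin (m + n)}
    (htp : Adjacent t p) {z : Hecke R q r} (hz : z * xy q r l.1 = shiftSum q l' t p (col l))
    {f : Fin r → Fin (m + n)}
    (hf : ∀ c, (Finset.univ.filter fun x => f x = c).card = l.1 c) :
    z * wordSum q l f = shiftSum q l' t p f := by
  obtain ⟨w₀, hw₀⟩ := exists_perm_of_card_fibre_eq (col l) f fun c => by rw [card_col, hf]
  obtain ⟨w, hw1, hw2, -⟩ := exists_monotone_on_fibres (col l) w₀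
  have hfw : (fun x => col l (w x)) = f := funext fun x => (hw1 x).trans (hw₀ x)
  rw [← hfw, ← xy_mul_T_of_monotone q l hw2, ← mul_assoc, hz]
  exact mul_T_of_strict_inversions (k := col l) (fun w => shiftSum q l' t p fun x => col l (w x))
    (fun w _ _ hij h => shiftSum_mul_T_of_lt q l' htp (fun x => col l (w x)) hij h) w
    (strict_inversions_of_monotone (fun _ _ h => col_mono l h.le) hw2)

theorem leftMulEnd_congr {q : Rˣ} {l μ : Comps m n r} {z z' : Hecke R q r}
    (hz : ∀ x ∈ xyMod q r μ.1, z * x ∈ xyMod q r l.1)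
    (hz' : ∀ x ∈ xyMod q r μ.1, z' * x ∈ xyMod q r l.1)
    (h : z * xy q r μ.1 = z' * xy q r μ.1) : leftMulEnd z hz = leftMulEnd z' hz' := by
  refine DirectSum.linearMap_ext _ fun α => LinearMap.ext fun x => ?_
  by_cases hα : α = μ
  · subst hα
    refine (leftMulEnd_incl z hz x).trans (Eq.trans (congrArg _ (Subtype.ext ?_))
      (leftMulEnd_incl z' hz' x).symm)
    obtain ⟨y, hy⟩ := (mem_xyMod_iff q α x.1).mp x.2
    simp only
    rw [hy, ← mul_assoc, h, mul_assoc]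
  · exact (leftMulEnd_incl_of_ne z hz hα x).trans (leftMulEnd_incl_of_ne z' hz' hα x).symm

theorem leftMulEnd_mul {q : Rˣ} {l μ ν : Comps m n r} {z z' : Hecke R q r}
    (hz : ∀ x ∈ xyMod q r μ.1, z * x ∈ xyMod q r l.1)
    (hz' : ∀ x ∈ xyMod q r ν.1, z' * x ∈ xyMod q r μ.1)
    (hzz : ∀ x ∈ xyMod q r ν.1, z * z' * x ∈ xyMod q r l.1) :
    leftMulEnd z hz * leftMulEnd z' hz' = leftMulEnd (z * z') hzz := by
  refine DirectSum.linearMap_ext _ fun α => LinearMap.ext fun x => ?_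
  simp only [LinearMap.comp_apply, Module.End.mul_apply]
  by_cases hα : α = ν
  · subst hα
    rw [leftMulEnd_incl, leftMulEnd_incl, leftMulEnd_incl]
    exact congrArg _ (Subtype.ext (mul_assoc z z' x.1).symm)
  · rw [leftMulEnd_incl_of_ne z' hz' hα, leftMulEnd_incl_of_ne _ hzz hα, map_zero]

theorem sum_smul_leftMulEnd {q : Rˣ} {l μ : Comps m n r} {ι : Type*} (S : Finset ι) (c : ι → R)
    (z : ι → Hecke R q r) (hz : ∀ k, ∀ x ∈ xyMod q r μ.1, z k * x ∈ xyMod q r l.1)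
    (hs : ∀ x ∈ xyMod q r μ.1, (∑ k ∈ S, c k • z k) * x ∈ xyMod q r l.1) :
    ∑ k ∈ S, c k • leftMulEnd (z k) (hz k) = leftMulEnd (∑ k ∈ S, c k • z k) hs := by
  refine DirectSum.linearMap_ext _ fun α => LinearMap.ext fun x => ?_
  simp only [LinearMap.comp_apply, LinearMap.sum_apply, LinearMap.smul_apply]
  by_cases hα : α = μ
  · subst hα
    simp only [leftMulEnd_incl]
    have h1 : (⟨(∑ k ∈ S, c k • z k) * x.1, hs x.1 x.2⟩ : xyMod q r l.1) =
        ∑ k ∈ S, c k • (⟨z k * x.1, hz k x.1 x.2⟩ : xyMod q r l.1) := by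
      refine Subtype.ext ?_
      simp only [Submodule.coe_sum, Submodule.coe_smul_of_tower, Finset.sum_mul, smul_mul_assoc]
    rw [h1, map_sum]
    exact Finset.sum_congr rfl fun k _ => (LinearMap.map_smul_of_tower _ _ _).symm
  · simp only [leftMulEnd_incl_of_ne _ _ hα, smul_zero, Finset.sum_const_zero]

theorem ro_add_single {N : ℕ} (A : Matrix (Fin N) (Fin N) ℕ) (t k : Fin N) :
    ro (A + Matrix.single t k 1) = ro A + Pi.single t 1 := by
  ext i
  simp only [ro, Matrix.add_apply, Finset.sum_add_distrib, Matrix.single_apply, Pi.add_apply,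
    Pi.single_apply]
  congr 1
  by_cases h : t = i
  · subst h; simp
  · simp [h, Ne.symm h]

theorem co_add_single {N : ℕ} (A : Matrix (Fin N) (Fin N) ℕ) (t k : Fin N) :
    co (A + Matrix.single t k 1) = co A + Pi.single k 1 := by
  ext i
  simp only [co, Matrix.add_apply, Finset.sum_add_distrib, Matrix.single_apply, Pi.add_apply,
    Pi.single_apply]
  congr 1
  by_cases h : k = i
  · subst h; simp
  · simp [h, Ne.symm h]

/-- The product formula for the unnormalised elements. -/
theorem phi_mul_phi (q : Rˣ) {A : Matrix (Fin (m + n)) (Fin (m + n)) ℕ}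
    (hA : A ∈ superMat m n r) {t p : Fin (m + n)} (htp : Adjacent t p) (X : Fin (m + n) → ℕ)
    (hD : Matrix.diagonal X + Matrix.single t p 1 ∈ superMat m n r)
    (hco : co (Matrix.diagonal X + Matrix.single t p 1) = ro A) :
    phi (R := R) q r (Matrix.diagonal X + Matrix.single t p 1) * phi q r A =
      ∑ k ∈ Finset.univ.filter fun k => 1 ≤ A p k,
        moveCoeff (R := R) q A t p k • phi q r (moveEntry A t p k) := by
  classical
  set D := Matrix.diagonal X + Matrix.single t p 1 with hDdef
  obtain ⟨hAsum, hAp⟩ := (mem_superMat_iff A).mp hA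
  have hDsum := ((mem_superMat_iff D).mp hD).1
  let l : Comps m n r := ⟨ro A, hAsum⟩
  let μ : Comps m n r := ⟨co A, Finset.sum_comm.trans hAsum⟩
  let l' : Comps m n r := ⟨ro D, hDsum⟩
  obtain ⟨zA, hzA, hzA1, hzA2, -⟩ := exists_phi_eq (R := R) q hA (l := l) (μ := μ) rfl rfl
  obtain ⟨zD, hzD, hzD1, hzD2, -⟩ := exists_phi_eq (R := R) q hD (l := l') (μ := l) rfl hco.symm
  rw [matSum_eq_shiftSum q l l' htp X hco] at hzD1
  have hmove : ∀ k, ∃ z : Hecke R q r, ∃ hz : ∀ x ∈ xyMod q r μ.1, z * x ∈ xyMod q r l'.1,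
      1 ≤ A p k → phi q r (moveEntry A t p k) = leftMulEnd z hz ∧ z * xy q r μ.1 =
        if ParityBound (moveEntry A t p k) then matSum q l' μ (moveEntry A t p k) else 0 := by
    intro k
    by_cases hk : 1 ≤ A p k
    · have hro : ro D = ro (moveEntry A t p k) := by
        have h1 := congrArg ro (moveEntry_add (t := t) hk)
        rw [ro_add_single, ro_add_single, ← hco, co_diagonal_add_single] at h1
        rw [hDdef, ro_diagonal_add_single, ← add_left_inj (Pi.single p 1), h1]
        abel
      have hcoB : co A = co (moveEntry A t p k) := by
        have h1 := congrArg co (moveEntry_add (t := t) hk)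
        rw [co_add_single, co_add_single] at h1
        exact (add_right_cancel h1).symm
      by_cases hB : ParityBound (moveEntry A t p k)
      · have hBm : moveEntry A t p k ∈ superMat m n r := by
          refine (mem_superMat_iff _).mpr ⟨?_, hB⟩
          rw [← hDsum]
          exact Finset.sum_congr rfl fun i _ => (congrFun hro i).symm
        obtain ⟨z, hz, hz1, hz2, -⟩ := exists_phi_eq (R := R) q hBm (l := l') (μ := μ) hro hcoB
        exact ⟨z, hz, fun _ => ⟨hz2, by rw [if_pos hB, hz1]⟩⟩
      · -- Outside the index set `phi` is zero.
        have h0 : ∀ x ∈ xyMod q r μ.1, (0 : Hecke R q r) * x ∈ xyMod q r l'.1 := fun x _ => by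
          rw [zero_mul]; exact zero_mem _
        refine ⟨0, h0, fun _ => ⟨?_, by rw [if_neg hB, zero_mul]⟩⟩
        rw [phi, dif_neg fun h => hB ((mem_superMat_iff _).mp h.1).2]
        have := sum_smul_leftMulEnd (q := q) (l := l') (μ := μ) (∅ : Finset Unit)
          (fun _ => (0 : R)) (fun _ => 0) (fun _ => h0) (by simp)
        simpa using this
    · exact ⟨0, fun x _ => by rw [zero_mul]; exact zero_mem _, fun h => absurd h hk⟩
  choose z hz hz1 using hmove
  have hsum : ∀ x ∈ xyMod q r μ.1, (∑ k ∈ Finset.univ.filter fun k => 1 ≤ A p k,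
      moveCoeff (R := R) q A t p k • z k) * x ∈ xyMod q r l'.1 := by
    intro x hx
    rw [Finset.sum_mul]
    refine sum_mem fun k _ => ?_
    rw [smul_mul_assoc]
    exact Submodule.smul_of_tower_mem _ _ (hz k x hx)
  rw [hzA2, hzD2, leftMulEnd_mul hzD hzA fun x hx => by
    rw [mul_assoc]; exact hzD _ (hzA x hx)]
  rw [Finset.sum_congr rfl fun k hk => by rw [(hz1 k (Finset.mem_filter.mp hk).2).1],
    sum_smul_leftMulEnd _ _ z hz hsum]
  refine leftMulEnd_congr _ _ ?_
  rw [mul_assoc, hzA1, matSum, Finset.mul_sum, Finset.sum_mul]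
  rw [Finset.sum_congr rfl fun f hf => by
    rw [mul_smul_comm, mul_wordSum_eq_shiftSum q l l' htp hzD1 fun c => by
      rw [← ro_wordMat f (col μ), (Finset.mem_filter.mp hf).2]]]
  rw [sum_shiftSum q l' μ htp hAp]
  refine Finset.sum_congr rfl fun k hk => ?_
  rw [smul_mul_assoc, (hz1 k (Finset.mem_filter.mp hk).2).2]

end

/-! ### The normalising exponents and signs -/

section

variable {m n : ℕ}

/-- The sum of the products `a j * b l` over `j < l`. -/
def crossSum {N : ℕ} (a b : Fin N → ℤ) : ℤ := ∑ j, ∑ l, if j < l then a j * b l else 0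

/-- The quadratic form in the entries of `A` that pairs an entry of the row `i` with the entries
of the row `k` to the right of its column, with weight `v i k`. -/
def quadForm {N : ℕ} (v : Fin N → Fin N → ℤ) (A : Matrix (Fin N) (Fin N) ℕ) : ℤ :=
  ∑ i, ∑ k, v i k * crossSum (fun j => (A i j : ℤ)) (fun l => (A k l : ℤ))

theorem crossSum_add_left {N : ℕ} (a a' b : Fin N → ℤ) :
    crossSum (a + a') b = crossSum a b + crossSum a' b := by
  simp only [crossSum, ← Finset.sum_add_distrib]
  refine Finset.sum_congr rfl fun j _ => Finset.sum_congr rfl fun l _ => ?_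
  split_ifs <;> simp [add_mul]

theorem crossSum_add_right {N : ℕ} (a b b' : Fin N → ℤ) :
    crossSum a (b + b') = crossSum a b + crossSum a b' := by
  simp only [crossSum, ← Finset.sum_add_distrib]
  refine Finset.sum_congr rfl fun j _ => Finset.sum_congr rfl fun l _ => ?_
  split_ifs <;> simp [mul_add]

theorem crossSum_single_left {N : ℕ} (b : Fin N → ℤ) (k : Fin N) (e : ℤ) :
    crossSum (Pi.single k e) b = e * ∑ l ∈ Finset.Ioi k, b l := by
  have h : Finset.Ioi k = Finset.univ.filter fun l => k < l := by ext; simp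
  rw [crossSum, Finset.sum_eq_single k, h, Finset.sum_filter, Finset.mul_sum]
  · simp
  · intro j _ hj
    simp [Pi.single_eq_of_ne hj]
  · simp

theorem crossSum_single_right {N : ℕ} (a : Fin N → ℤ) (k : Fin N) (e : ℤ) :
    crossSum a (Pi.single k e) = (∑ j ∈ Finset.Iio k, a j) * e := by
  have h : Finset.Iio k = Finset.univ.filter fun l => l < k := by ext; simp
  rw [crossSum, Finset.sum_comm, Finset.sum_eq_single k, h, Finset.sum_filter, Finset.sum_mul]
  · simp
  · intro j _ hj
    simp [Pi.single_eq_of_ne hj]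
  · simp

/-- The sum of the entries of the row `i` to the left of the column `k`. -/
def leftSum {N : ℕ} (A : Matrix (Fin N) (Fin N) ℕ) (k i : Fin N) : ℕ := ∑ j ∈ Finset.Iio k, A i j

/-- The sum of the entries of the row `i` to the right of the column `k`. -/
def rightSum {N : ℕ} (A : Matrix (Fin N) (Fin N) ℕ) (k i : Fin N) : ℕ := ∑ j ∈ Finset.Ioi k, A i j

theorem leftSum_add_single {N : ℕ} (A : Matrix (Fin N) (Fin N) ℕ) (t k : Fin N) :
    leftSum (A + Matrix.single t k 1) k = leftSum A k := by
  ext i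
  refine Finset.sum_congr rfl fun j hj => ?_
  rw [Matrix.add_apply, Matrix.single_apply, if_neg, add_zero]
  rintro ⟨-, rfl⟩
  exact absurd hj (by simp)

theorem rightSum_add_single {N : ℕ} (A : Matrix (Fin N) (Fin N) ℕ) (t k : Fin N) :
    rightSum (A + Matrix.single t k 1) k = rightSum A k := by
  ext i
  refine Finset.sum_congr rfl fun j hj => ?_
  rw [Matrix.add_apply, Matrix.single_apply, if_neg, add_zero]
  rintro ⟨-, rfl⟩
  exact absurd hj (by simp)

theorem quadForm_add_single {N : ℕ} (v : Fin N → Fin N → ℤ) (A : Matrix (Fin N) (Fin N) ℕ)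
    (t k : Fin N) :
    quadForm v (A + Matrix.single t k 1) = quadForm v A +
      (∑ i, v i t * (leftSum A k i : ℤ) + ∑ i, v t i * (rightSum A k i : ℤ)) := by
  have hrow : ∀ i, (fun j => ((A + Matrix.single t k 1 : Matrix _ _ ℕ) i j : ℤ)) =
      (fun j => (A i j : ℤ)) + Pi.single k (if i = t then 1 else 0) := by
    intro i
    ext j
    rw [Matrix.add_apply, Matrix.single_apply, Pi.add_apply, Pi.single_apply]
    simp only [eq_comm (a := t), eq_comm (a := k)]
    by_cases h1 : i = t <;> by_cases h2 : j = k <;> simp [h1, h2]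
  have hcross : ∀ i i', crossSum (fun j => ((A + Matrix.single t k 1 : Matrix _ _ ℕ) i j : ℤ))
      (fun j => ((A + Matrix.single t k 1 : Matrix _ _ ℕ) i' j : ℤ)) =
      crossSum (fun j => (A i j : ℤ)) (fun j => (A i' j : ℤ)) +
        ((if i' = t then (leftSum A k i : ℤ) else 0) +
          if i = t then (rightSum A k i' : ℤ) else 0) := by
    intro i i'
    have h0 : ∑ l ∈ Finset.Ioi k, (Pi.single k (if i' = t then (1 : ℤ) else 0) : Fin N → ℤ) l =
        0 := Finset.sum_eq_zero fun l hl => Pi.single_eq_of_ne (Finset.mem_Ioi.mp hl).ne' _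
    rw [hrow, hrow, crossSum_add_left, crossSum_add_right, crossSum_add_right,
      crossSum_single_left, crossSum_single_left, crossSum_single_right, h0, leftSum, rightSum]
    push_cast
    simp [add_assoc]
  simp only [quadForm, hcross, mul_add, Finset.sum_add_distrib, mul_ite, mul_zero,
    Finset.sum_ite_eq', Finset.mem_univ, if_true]
  congr 2
  rw [Finset.sum_comm]
  simp

/-- The weights of `dExp`. -/
def dWeight (i k : Fin (m + n)) : ℤ :=
  (if k < i then 1 else 0) + if k = i then (-1) ^ parity i else 0

/-- The weights of `hatSign`. -/
def hatWeight (i k : Fin (m + n)) : ℤ := if m ≤ k.val ∧ k < i then 1 else 0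

theorem dExp_eq (A : Matrix (Fin (m + n)) (Fin (m + n)) ℕ) : dExp A = quadForm dWeight A := by
  simp only [dExp, quadForm, dWeight, add_mul, Finset.sum_add_distrib, ite_mul, zero_mul,
    one_mul, Finset.sum_ite_eq', Finset.mem_univ, if_true]
  congr 1
  · refine Finset.sum_congr rfl fun i _ => Finset.sum_congr rfl fun k _ => ?_
    by_cases h : k < i <;> simp [h, crossSum]
  · refine Finset.sum_congr rfl fun i _ => ?_
    simp only [crossSum, Finset.mul_sum, mul_ite, mul_zero]

theorem hatSign_eq (A : Matrix (Fin (m + n)) (Fin (m + n)) ℕ) :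
    (hatSign A : ℤ) = quadForm hatWeight A := by
  simp only [hatSign, quadForm, hatWeight, ite_mul, zero_mul, one_mul]
  push_cast
  refine Finset.sum_congr rfl fun i _ => Finset.sum_congr rfl fun k _ => ?_
  by_cases h : m ≤ k.val ∧ k < i
  · simp [h, crossSum]
  · rw [if_neg h]
    exact Finset.sum_eq_zero fun j _ => Finset.sum_eq_zero fun l _ =>
      if_neg fun hc => h ⟨hc.1, hc.2.1⟩

/-- A move in the column `k` changes a quadratic form by a linear form in the partial row sums on
both sides of this column. -/
theorem quadForm_moveEntry {N : ℕ} (v : Fin N → Fin N → ℤ) {A : Matrix (Fin N) (Fin N) ℕ}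
    {t p k : Fin N} (h : 1 ≤ A p k) :
    quadForm v (moveEntry A t p k) = quadForm v A +
      (∑ i, (v i t - v i p) * (leftSum A k i : ℤ) +
        ∑ i, (v t i - v p i) * (rightSum A k i : ℤ)) := by
  have hl : leftSum (moveEntry A t p k) k = leftSum A k := by
    rw [← leftSum_add_single (moveEntry A t p k) p, moveEntry_add h, leftSum_add_single]
  have hr : rightSum (moveEntry A t p k) k = rightSum A k := by
    rw [← rightSum_add_single (moveEntry A t p k) p, moveEntry_add h, rightSum_add_single]
  have h1 := quadForm_add_single v (moveEntry A t p k) p k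
  rw [moveEntry_add h, quadForm_add_single, hl, hr] at h1
  simp only [sub_mul, Finset.sum_sub_distrib]
  linarith

theorem quadForm_diagonal_add_single {N : ℕ} (v : Fin N → Fin N → ℤ) (hv : ∀ i k, i < k → v i k = 0)
    (X : Fin N → ℕ) (t p : Fin N) :
    quadForm v (Matrix.diagonal X + Matrix.single t p 1) =
      ∑ i, ((if i < p then v i t else 0) + if p < i then v t i else 0) * (X i : ℤ) := by
  have hrow : ∀ i, (fun j => ((Matrix.diagonal X : Matrix _ _ ℕ) i j : ℤ)) =
      Pi.single i (X i : ℤ) := by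
    intro i
    ext j
    rw [Matrix.diagonal_apply, Pi.single_apply]
    by_cases h : i = j
    · subst h; simp
    · simp [h, Ne.symm h]
  have h0 : quadForm v (Matrix.diagonal X) = 0 := by
    refine Finset.sum_eq_zero fun i _ => Finset.sum_eq_zero fun k _ => ?_
    rw [hrow, hrow, crossSum_single_left]
    by_cases h : i < k
    · rw [hv i k h, zero_mul]
    · rw [Finset.sum_eq_zero, mul_zero, mul_zero]
      intro l hl
      refine Pi.single_eq_of_ne ?_ _
      rintro rfl
      exact h (Finset.mem_Ioi.mp hl)
  have hl : ∀ i, leftSum (Matrix.diagonal X) p i = if i < p then X i else 0 := by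
    intro i
    simp [leftSum, Matrix.diagonal_apply]
  have hr : ∀ i, rightSum (Matrix.diagonal X) p i = if p < i then X i else 0 := by
    intro i
    simp [rightSum, Matrix.diagonal_apply]
  rw [quadForm_add_single, h0, zero_add, ← Finset.sum_add_distrib]
  refine Finset.sum_congr rfl fun i _ => ?_
  rw [hl, hr]
  push_cast
  split_ifs <;> ring

theorem dWeight_eq_zero {i k : Fin (m + n)} (h : i < k) : dWeight i k = 0 := by
  simp [dWeight, h.not_gt, h.ne']

theorem hatWeight_eq_zero {i k : Fin (m + n)} (h : i < k) : hatWeight i k = 0 := by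
  simp [hatWeight, h.not_gt]

theorem dExp_diagonal_add_single (X : Fin (m + n) → ℕ) {t p : Fin (m + n)}
    (htp : Adjacent t p) :
    dExp (Matrix.diagonal X + Matrix.single t p 1) = (-1) ^ parity t * (X t : ℤ) := by
  rw [dExp_eq, quadForm_diagonal_add_single _ fun _ _ => dWeight_eq_zero, Finset.sum_eq_single t]
  · congr 1
    rcases htp with h | h
    · have : t < p := by rw [Fin.lt_def]; omega
      simp [this, this.not_gt, dWeight]
    · have : p < t := by rw [Fin.lt_def]; omega
      simp [this, this.not_gt, dWeight]
  · intro i _ hi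
    rw [mul_eq_zero]; left
    have hi' : i.val ≠ t.val := fun h => hi (Fin.ext h)
    unfold dWeight
    simp only [Fin.lt_def, Fin.ext_iff]
    rcases htp with h | h <;> grind
  · simp

theorem hatSign_diagonal_add_single (X : Fin (m + n) → ℕ) {t p : Fin (m + n)}
    (htp : Adjacent t p) : hatSign (Matrix.diagonal X + Matrix.single t p 1) = 0 := by
  zify
  rw [hatSign_eq, quadForm_diagonal_add_single _ fun _ _ => hatWeight_eq_zero]
  refine Finset.sum_eq_zero fun i _ => ?_
  rw [mul_eq_zero]; left
  unfold hatWeight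
  simp only [Fin.lt_def]
  rcases htp with h | h <;> grind

theorem sum_ite_add_ite_mul {N : ℕ} {t p : Fin N} (a b : ℤ) (f : Fin N → ℤ) :
    ∑ i, ((if i = t then a else 0) + if i = p then b else 0) * f i = a * f t + b * f p := by
  simp [add_mul, Finset.sum_add_distrib, ite_mul]

theorem dExp_moveEntry_succ {A : Matrix (Fin (m + n)) (Fin (m + n)) ℕ} {t p k : Fin (m + n)}
    (htp : p.val = t.val + 1) (h : 1 ≤ A p k) :
    dExp (moveEntry A t p k) = dExp A +
      ((-1) ^ parity t * leftSum A k t + (1 - (-1) ^ parity p) * leftSum A k p +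
        (((-1) ^ parity t - 1) * rightSum A k t + -(-1) ^ parity p * rightSum A k p)) := by
  have h1 : ∀ i, dWeight i t - dWeight i p = (if i = t then (-1) ^ parity t else 0) +
      if i = p then 1 - (-1) ^ parity p else 0 := by
    intro i
    unfold dWeight
    simp only [Fin.lt_def, Fin.ext_iff]
    have hi : i.val = t.val → i = t := Fin.ext
    have hi' : i.val = p.val → i = p := Fin.ext
    grind
  have h2 : ∀ i, dWeight t i - dWeight p i = (if i = t then (-1) ^ parity t - 1 else 0) +
      if i = p then -(-1) ^ parity p else 0 := by
    intro i
    unfold dWeight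
    simp only [Fin.lt_def, Fin.ext_iff]
    grind
  simp only [dExp_eq, quadForm_moveEntry _ h, h1, h2]
  rw [sum_ite_add_ite_mul _ _ fun i => (leftSum A k i : ℤ),
    sum_ite_add_ite_mul _ _ fun i => (rightSum A k i : ℤ)]

theorem dExp_moveEntry_pred {A : Matrix (Fin (m + n)) (Fin (m + n)) ℕ} {t p k : Fin (m + n)}
    (htp : t.val = p.val + 1) (h : 1 ≤ A p k) :
    dExp (moveEntry A t p k) = dExp A +
      (((-1) ^ parity t - 1) * leftSum A k t + -(-1) ^ parity p * leftSum A k p +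
        ((-1) ^ parity t * rightSum A k t + (1 - (-1) ^ parity p) * rightSum A k p)) := by
  have h1 : ∀ i, dWeight i t - dWeight i p = (if i = t then (-1) ^ parity t - 1 else 0) +
      if i = p then -(-1) ^ parity p else 0 := by
    intro i
    unfold dWeight
    simp only [Fin.lt_def, Fin.ext_iff]
    have hi : i.val = t.val → i = t := Fin.ext
    have hi' : i.val = p.val → i = p := Fin.ext
    grind
  have h2 : ∀ i, dWeight t i - dWeight p i = (if i = t then (-1) ^ parity t else 0) +
      if i = p then 1 - (-1) ^ parity p else 0 := by
    intro i
    unfold dWeight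
    simp only [Fin.lt_def, Fin.ext_iff]
    grind
  simp only [dExp_eq, quadForm_moveEntry _ h, h1, h2]
  rw [sum_ite_add_ite_mul _ _ fun i => (leftSum A k i : ℤ),
    sum_ite_add_ite_mul _ _ fun i => (rightSum A k i : ℤ)]

theorem hatSign_moveEntry_succ {A : Matrix (Fin (m + n)) (Fin (m + n)) ℕ} {t p k : Fin (m + n)}
    (htp : p.val = t.val + 1) (h : 1 ≤ A p k) :
    (hatSign (moveEntry A t p k) : ℤ) = hatSign A +
      ((if m ≤ t.val then (leftSum A k p : ℤ) - rightSum A k t else 0) +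
        if p.val = m then (leftSum A k p : ℤ) - epsSign A t k else 0) := by
  have heps : (epsSign A t k : ℤ) =
      if p.val = m then ∑ i : Fin (m + n), if m ≤ i.val then (leftSum A k i : ℤ) else 0 else 0 := by
    rw [epsSign, htp]
    split_ifs
    · rw [Finset.sum_filter]; simp only [leftSum]; push_cast; rfl
    · rfl
  rw [hatSign_eq, quadForm_moveEntry _ h, ← hatSign_eq, heps]
  congr 1
  have h1 : ∀ i : Fin (m + n), hatWeight i t - hatWeight i p =
      (if i = t then 0 else 0) + (if i = p then (if m ≤ t.val ∨ p.val = m then 1 else 0) else 0) -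
        if p.val = m ∧ m ≤ i.val then 1 else 0 := by
    intro i
    unfold hatWeight
    simp only [Fin.lt_def, Fin.ext_iff]
    grind
  have h2 : ∀ i : Fin (m + n), hatWeight t i - hatWeight p i =
      (if i = t then (if m ≤ t.val then -1 else 0) else 0) + if i = p then 0 else 0 := by
    intro i
    unfold hatWeight
    simp only [Fin.lt_def, Fin.ext_iff]
    grind
  simp only [h1, h2, sub_mul, Finset.sum_sub_distrib]
  rw [sum_ite_add_ite_mul _ _ fun i => (leftSum A k i : ℤ),
    sum_ite_add_ite_mul _ _ fun i => (rightSum A k i : ℤ)]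
  by_cases hm : p.val = m
  · have : ¬ m ≤ t.val := by omega
    simp [hm, this]
  · by_cases hm' : m ≤ t.val <;> simp [hm, hm', sub_eq_add_neg]

theorem hatSign_moveEntry_pred {A : Matrix (Fin (m + n)) (Fin (m + n)) ℕ} {t p k : Fin (m + n)}
    (htp : t.val = p.val + 1) (h : 1 ≤ A p k) :
    (hatSign (moveEntry A t p k) : ℤ) = hatSign A +
      ((if m ≤ p.val then (rightSum A k p : ℤ) - leftSum A k t else 0) +
        if t.val = m then (epsSign A p k : ℤ) - leftSum A k t else 0) := by
  have heps : (epsSign A p k : ℤ) =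
      if t.val = m then ∑ i : Fin (m + n), if m ≤ i.val then (leftSum A k i : ℤ) else 0 else 0 := by
    rw [epsSign, htp]
    split_ifs
    · rw [Finset.sum_filter]; simp only [leftSum]; push_cast; rfl
    · rfl
  rw [hatSign_eq, quadForm_moveEntry _ h, ← hatSign_eq, heps]
  congr 1
  have h1 : ∀ i : Fin (m + n), hatWeight i t - hatWeight i p =
      (if t.val = m ∧ m ≤ i.val then 1 else 0) - ((if i = t then
        (if m ≤ p.val ∨ t.val = m then 1 else 0) else 0) + (if i = p then 0 else 0)) := by
    intro i
    unfold hatWeight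
    simp only [Fin.lt_def, Fin.ext_iff]
    grind
  have h2 : ∀ i : Fin (m + n), hatWeight t i - hatWeight p i =
      (if i = t then 0 else 0) + if i = p then (if m ≤ p.val then 1 else 0) else 0 := by
    intro i
    unfold hatWeight
    simp only [Fin.lt_def, Fin.ext_iff]
    grind
  simp only [h1, h2, sub_mul, Finset.sum_sub_distrib]
  rw [sum_ite_add_ite_mul _ _ fun i => (leftSum A k i : ℤ),
    sum_ite_add_ite_mul _ _ fun i => (rightSum A k i : ℤ)]
  by_cases hm : t.val = m
  · have : ¬ m ≤ p.val := by omega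
    simp [hm, this]
  · by_cases hm' : m ≤ p.val <;> simp [hm, hm', neg_add_eq_sub]

theorem epsSign_eq_zero {A : Matrix (Fin (m + n)) (Fin (m + n)) ℕ} {h : Fin (m + n)}
    (hh : h.val + 1 ≠ m) (k : Fin (m + n)) : epsSign A h k = 0 := if_neg hh

theorem sum_Ici_eq {N : ℕ} (a : Fin N → ℕ) (k : Fin N) :
    ∑ j ∈ Finset.Ici k, a j = a k + ∑ j ∈ Finset.Ioi k, a j := by
  rw [← Finset.Ioi_insert, Finset.sum_insert (by simp)]

theorem sum_Iic_eq {N : ℕ} (a : Fin N → ℕ) (k : Fin N) :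
    ∑ j ∈ Finset.Iic k, a j = a k + ∑ j ∈ Finset.Iio k, a j := by
  rw [← Finset.Iio_insert, Finset.sum_insert (by simp)]

theorem ro_eq_leftSum_add_rightSum {N : ℕ} (A : Matrix (Fin N) (Fin N) ℕ) (k i : Fin N) :
    ro A i = leftSum A k i + A i k + rightSum A k i := by
  have h : (Finset.univ : Finset (Fin N)) = Finset.Iic k ∪ Finset.Ioi k := by
    ext j; simp [le_or_gt]
  rw [ro, h, Finset.sum_union, sum_Iic_eq, leftSum, rightSum, add_comm (A i k)]
  rw [Finset.disjoint_left]
  intro j hj hj'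
  exact absurd (Finset.mem_Iic.mp hj) (Finset.mem_Ioi.mp hj').not_ge

theorem fPlus_eq (A : Matrix (Fin (m + n)) (Fin (m + n)) ℕ) (h h' k : Fin (m + n)) :
    fPlus A h h' k = A h k + rightSum A k h -
      (-1) ^ parity h * ((-1) ^ parity h' * rightSum A k h') := by
  have := sum_Ici_eq (A h) k
  zify at this
  rw [fPlus, this, pow_add, mul_assoc, rightSum, rightSum]
  push_cast
  rfl

theorem fMinus_eq (A : Matrix (Fin (m + n)) (Fin (m + n)) ℕ) (h h' k : Fin (m + n)) :
    fMinus A h h' k = A h' k + leftSum A k h' -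
      (-1) ^ parity h * ((-1) ^ parity h' * leftSum A k h) := by
  have := sum_Iic_eq (A h') k
  zify at this
  rw [fMinus, this, pow_add, mul_assoc, leftSum, leftSum]
  push_cast
  rfl

end

section

variable {R : Type*} [CommRing R] {m n r : ℕ}

theorem upsilon_eq (υ : Rˣ) (t : Fin (m + n)) : upsilon υ t = υ ^ ((-1 : ℤ) ^ parity t) := by
  unfold upsilon parity
  split_ifs <;> simp

theorem invWeight_sq (υ : Rˣ) (p : Fin (m + n)) :
    invWeight (υ ^ 2) p = (-1) ^ (parity p : ℤ) * υ ^ (-2 * parity p : ℤ) := by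
  unfold invWeight parity
  split_ifs
  · simp
  · rw [← neg_inv, neg_eq_neg_one_mul, ← zpow_natCast, ← zpow_neg]
    simp

theorem heckeChar_sq (υ : Rˣ) (t : Fin (m + n)) :
    heckeChar (υ ^ 2) t = (-1) ^ (parity t : ℤ) * υ ^ (2 * (1 - parity t) : ℤ) := by
  unfold heckeChar parity
  split_ifs
  · simp only [Nat.cast_zero, zpow_zero, one_mul, sub_zero, mul_one]
    exact (zpow_natCast υ 2).symm
  · simp

theorem outerWeight_sq (υ : Rˣ) (A : Matrix (Fin (m + n)) (Fin (m + n)) ℕ)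
    {t p k : Fin (m + n)} {P Q : ℕ}
    (hP : ∑ j ∈ Finset.univ.filter (fun j => Before t p j k), A p j = P)
    (hQ : ∑ j ∈ Finset.univ.filter (fun j => Before t p k j), A t j = Q) :
    outerWeight (υ ^ 2) A t p k = (-1) ^ (parity p * P + parity t * Q : ℤ) *
      υ ^ (-2 * parity p * P + 2 * (1 - parity t) * Q : ℤ) := by
  rw [outerWeight, hP, hQ, invWeight_sq, heckeChar_sq]
  simp only [← zpow_natCast, mul_zpow, ← zpow_mul, zpow_add]
  exact mul_mul_mul_comm _ _ _ _

/-- A Gaussian integer is, up to a power of its parameter, its own image under the bar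
involution. -/
theorem gaussInt_sq_eq (u : Rˣ) (a : ℕ) :
    gaussInt ((u ^ 2 : Rˣ) : R) (a + 1) =
      ((u ^ (2 * a : ℤ) : Rˣ) : R) * gaussBar u (a + 1) := by
  rw [gaussBar, gaussInt, gaussInt, ← Finset.sum_range_reflect, Finset.mul_sum]
  refine Finset.sum_congr rfl fun i hi => ?_
  have hi' : i ≤ a := by simpa [Nat.lt_succ_iff] using hi
  rw [← Units.val_pow_eq_pow_val, ← Units.val_pow_eq_pow_val, ← Units.val_pow_eq_pow_val,
    ← Units.val_mul]
  congr 1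
  simp only [← zpow_natCast, ← zpow_mul, ← zpow_neg_one u, ← zpow_add]
  congr 1
  push_cast [Nat.cast_sub hi', Nat.add_sub_cancel]
  ring

theorem rowParam_sq (υ : Rˣ) (t : Fin (m + n)) : rowParam (υ ^ 2) t = upsilon υ t ^ 2 := by
  unfold rowParam upsilon
  split_ifs <;> simp

/-- The normalisation of `[A]`. -/
def brkUnit (υ : Rˣ) (A : Matrix (Fin (m + n)) (Fin (m + n)) ℕ) : Rˣ :=
  (-1) ^ (hatSign A : ℤ) * υ ^ (-dExp A)

theorem brk_eq (υ : Rˣ) (A : Matrix (Fin (m + n)) (Fin (m + n)) ℕ) :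
    brk υ r A = (brkUnit υ A : R) • phi (υ ^ 2) r A := by
  rw [brk, brkUnit, zpow_natCast]

theorem smul_mul_smul_eq_sum {M ι : Type*} [NonUnitalNonAssocSemiring M] [Module R M]
    [IsScalarTower R M M] [SMulCommClass R M M] {u v : R} {x y : M} {S : Finset ι} {a b w : ι → R}
    {z : ι → M} (hxy : x * y = ∑ i ∈ S, a i • z i) (h : ∀ i ∈ S, u * v * a i = b i * w i) :
    u • x * v • y = ∑ i ∈ S, b i • w i • z i := by
  rw [smul_mul_smul_comm, hxy, Finset.smul_sum]
  exact Finset.sum_congr rfl fun i hi => by rw [smul_smul, smul_smul, h i hi]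

/-- Multiplication by the matrix of an elementary move, with the normalisations moved through;
the hypothesis compares the units on both sides. -/
theorem brk_mul_brk (υ : Rˣ) {A : Matrix (Fin (m + n)) (Fin (m + n)) ℕ} (hA : A ∈ superMat m n r)
    {t p : Fin (m + n)} (htp : Adjacent t p) (X : Fin (m + n) → ℕ)
    (hD : Matrix.diagonal X + Matrix.single t p 1 ∈ superMat m n r)
    (hco : co (Matrix.diagonal X + Matrix.single t p 1) = ro A) (e f : Fin (m + n) → ℤ)
    (hu : ∀ k, 1 ≤ A p k → brkUnit υ (Matrix.diagonal X + Matrix.single t p 1) * brkUnit υ A *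
      (outerWeight (υ ^ 2) A t p k * upsilon υ t ^ (2 * A t k : ℤ)) =
        (-1) ^ e k * upsilon υ t ^ f k * brkUnit υ (moveEntry A t p k)) :
    brk υ r (Matrix.diagonal X + Matrix.single t p 1) * brk υ r A =
      ∑ k ∈ Finset.univ.filter fun k => 1 ≤ A p k,
        ((((-1) ^ e k * upsilon υ t ^ f k : Rˣ) : R) * gaussBar (upsilon υ t) (A t k + 1)) •
          brk υ r (moveEntry A t p k) := by
  rw [brk_eq, brk_eq, smul_mul_smul_eq_sum (phi_mul_phi _ hA htp X hD hco)
    (b := fun k => ((((-1) ^ e k * upsilon υ t ^ f k : Rˣ) : R) *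
      gaussBar (upsilon υ t) (A t k + 1))) (w := fun k => (brkUnit υ (moveEntry A t p k) : R))]
  · exact Finset.sum_congr rfl fun k _ => by rw [brk_eq]
  · intro k hk
    have h := congrArg (fun u : Rˣ => (u : R)) (hu k (Finset.mem_filter.mp hk).2)
    simp only [Units.val_mul] at h
    rw [moveCoeff, rowParam_sq, gaussInt_sq_eq, Units.val_mul]
    linear_combination gaussBar (upsilon υ t) (A t k + 1) * h

theorem parity_cases (t : Fin (m + n)) :
    (t.val < m ∧ parity t = 0) ∨ (m ≤ t.val ∧ parity t = 1) := by
  unfold parity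
  split_ifs with h
  · exact Or.inl ⟨h, rfl⟩
  · exact Or.inr ⟨not_lt.mp h, rfl⟩

/-- `d(D)` for the matrix `D` of an elementary move with `co(D) = ro(A)`: the diagonal entry of `D`
in the row `t` is the sum of the row `t` of `A`. -/
theorem dExp_elem {A : Matrix (Fin (m + n)) (Fin (m + n)) ℕ} {t p : Fin (m + n)}
    (htp : Adjacent t p) (X : Fin (m + n) → ℕ)
    (hco : co (Matrix.diagonal X + Matrix.single t p 1) = ro A) (k : Fin (m + n)) :
    dExp (Matrix.diagonal X + Matrix.single t p 1) =
      (-1) ^ parity t * ((leftSum A k t : ℤ) + A t k + rightSum A k t) := by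
  have h := congrFun hco t
  rw [co_diagonal_add_single, ro_eq_leftSum_add_rightSum A k, Pi.add_apply,
    Pi.single_eq_of_ne htp.ne, add_zero] at h
  rw [dExp_diagonal_add_single X htp, h]
  push_cast
  rfl

theorem sign_mul_power_congr (υ : Rˣ) {s₁ w₁ s₂ w₂ s₃ w₃ w₄ e w₅ s₆ w₆ : ℤ}
    (hs : Even (s₁ + s₂ + s₃ - (e + s₆))) (hw : w₁ + w₂ + (w₃ + w₄) = w₅ + w₆) :
    (-1 : Rˣ) ^ s₁ * υ ^ w₁ * ((-1) ^ s₂ * υ ^ w₂) * ((-1) ^ s₃ * υ ^ w₃ * υ ^ w₄) =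
      (-1) ^ e * υ ^ w₅ * ((-1) ^ s₆ * υ ^ w₆) := by
  have h : (-1 : Rˣ) ^ (s₁ + s₂ + s₃) = (-1) ^ (e + s₆) := by
    rw [← sub_add_cancel (s₁ + s₂ + s₃), zpow_add, hs.neg_one_zpow, one_mul]
  calc _ = (-1 : Rˣ) ^ s₁ * (-1) ^ s₂ * (-1) ^ s₃ *
        (υ ^ w₁ * υ ^ w₂ * (υ ^ w₃ * υ ^ w₄)) := by ac_rfl
    _ = (-1 : Rˣ) ^ e * (-1) ^ s₆ * (υ ^ w₅ * υ ^ w₆) := by simp only [← zpow_add, h, hw]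
    _ = _ := mul_mul_mul_comm _ _ _ _

/-- The comparison of the units in `[D][A]` for a move from the row `h + 1` to the row `h`. -/
theorem brkUnit_mul_succ (υ : Rˣ) {A : Matrix (Fin (m + n)) (Fin (m + n)) ℕ}
    {t p k : Fin (m + n)} (htp : p.val = t.val + 1) (X : Fin (m + n) → ℕ)
    (hco : co (Matrix.diagonal X + Matrix.single t p 1) = ro A) (hk : 1 ≤ A p k) :
    brkUnit υ (Matrix.diagonal X + Matrix.single t p 1) * brkUnit υ A *
      (outerWeight (υ ^ 2) A t p k * upsilon υ t ^ (2 * A t k : ℤ)) =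
        (-1) ^ (epsSign A t k : ℤ) * upsilon υ t ^ fPlus A t p k *
          brkUnit υ (moveEntry A t p k) := by
  have hlt : t < p := by rw [Fin.lt_def]; omega
  have hP : ∑ j ∈ Finset.univ.filter (fun j => Before t p j k), A p j = leftSum A k p := by
    refine Finset.sum_congr ?_ fun _ _ => rfl
    ext j; simp [Before, hlt]
  have hQ : ∑ j ∈ Finset.univ.filter (fun j => Before t p k j), A t j = rightSum A k t := by
    refine Finset.sum_congr ?_ fun _ _ => rfl
    ext j; simp [Before, hlt]
  rw [outerWeight_sq υ A hP hQ, upsilon_eq, brkUnit, brkUnit, brkUnit,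
    hatSign_diagonal_add_single X (Or.inl htp), dExp_elem (Or.inl htp) X hco k,
    dExp_moveEntry_succ htp hk, hatSign_moveEntry_succ htp hk, fPlus_eq, ← zpow_mul, ← zpow_mul]
  have heps : p.val ≠ m → epsSign A t k = 0 := fun hm => epsSign_eq_zero (by omega) k
  -- The two rows are both even, or on both sides of the boundary, or both odd.
  apply sign_mul_power_congr <;>
    rcases parity_cases t with ⟨ht, ht'⟩ | ⟨ht, ht'⟩ <;>
    rcases parity_cases p with ⟨hp, hp'⟩ | ⟨hp, hp'⟩ <;> rw [ht', hp']
  · rw [heps hp.ne, if_neg ht.not_ge, if_neg hp.ne]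
    exact ⟨0, by push_cast; ring⟩
  · rw [if_neg ht.not_ge, if_pos (by omega)]
    exact ⟨0, by push_cast; ring⟩
  · omega
  · rw [heps (by omega), if_pos ht, if_neg (by omega)]
    exact ⟨rightSum A k t, by push_cast; ring⟩
  · push_cast; ring
  · push_cast; ring
  · omega
  · push_cast; ring

/-- The comparison of the units in `[D][A]` for a move from the row `h` to the row `h + 1`. -/
theorem brkUnit_mul_pred (υ : Rˣ) {A : Matrix (Fin (m + n)) (Fin (m + n)) ℕ}
    {t p k : Fin (m + n)} (htp : t.val = p.val + 1) (X : Fin (m + n) → ℕ)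
    (hco : co (Matrix.diagonal X + Matrix.single t p 1) = ro A) (hk : 1 ≤ A p k) :
    brkUnit υ (Matrix.diagonal X + Matrix.single t p 1) * brkUnit υ A *
      (outerWeight (υ ^ 2) A t p k * upsilon υ t ^ (2 * A t k : ℤ)) =
        (-1) ^ (epsSign A p k : ℤ) * upsilon υ t ^ fMinus A p t k *
          brkUnit υ (moveEntry A t p k) := by
  have hlt : ¬ t < p := by rw [Fin.lt_def]; omega
  have hP : ∑ j ∈ Finset.univ.filter (fun j => Before t p j k), A p j = rightSum A k p := by
    refine Finset.sum_congr ?_ fun _ _ => rfl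
    ext j; simp [Before, hlt]
  have hQ : ∑ j ∈ Finset.univ.filter (fun j => Before t p k j), A t j = leftSum A k t := by
    refine Finset.sum_congr ?_ fun _ _ => rfl
    ext j; simp [Before, hlt]
  rw [outerWeight_sq υ A hP hQ, upsilon_eq, brkUnit, brkUnit, brkUnit,
    hatSign_diagonal_add_single X (Or.inr htp), dExp_elem (Or.inr htp) X hco k,
    dExp_moveEntry_pred htp hk, hatSign_moveEntry_pred htp hk, fMinus_eq, ← zpow_mul, ← zpow_mul]
  have heps : t.val ≠ m → epsSign A p k = 0 := fun hm => epsSign_eq_zero (by omega) k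
  -- The two rows are both even, or on both sides of the boundary, or both odd.
  apply sign_mul_power_congr <;>
    rcases parity_cases t with ⟨ht, ht'⟩ | ⟨ht, ht'⟩ <;>
    rcases parity_cases p with ⟨hp, hp'⟩ | ⟨hp, hp'⟩ <;> rw [ht', hp']
  · rw [heps ht.ne, if_neg hp.not_ge, if_neg ht.ne]
    exact ⟨0, by push_cast; ring⟩
  · omega
  · rw [if_neg hp.not_ge, if_pos (by omega)]
    exact ⟨leftSum A k t - epsSign A p k, by push_cast; ring⟩
  · rw [heps (by omega), if_pos hp, if_neg (by omega)]
    exact ⟨leftSum A k t, by push_cast; ring⟩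
  · push_cast; ring
  · omega
  · push_cast; ring
  · push_cast; ring

end

end QSchurSuper

theorem mainTheorem3 {R : Type*} [CommRing R] (υ : Rˣ) (m n r : ℕ) :
    (∀ A ∈ superMat m n r, IsPhiMat (υ ^ 2) A (phi (υ ^ 2) r A)) ∧
    ∀ A ∈ superMat m n r, ∀ h h' : Fin (m + n), h'.val = h.val + 1 →
      (∀ D ∈ superMat m n r, IsElem A D h h' →
        brk υ r D * brk υ r A =
          ∑ k ∈ Finset.univ.filter fun k => 1 ≤ A h' k,
            ((-1) ^ epsSign A h k * ((upsilon υ h ^ fPlus A h h' k : Rˣ) : R) *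
              gaussBar (upsilon υ h) (A h k + 1)) • brk υ r (moveEntry A h h' k)) ∧
      (∀ D ∈ superMat m n r, IsElem A D h' h →
        brk υ r D * brk υ r A =
          ∑ k ∈ Finset.univ.filter fun k => 1 ≤ A h k,
            ((-1) ^ epsSign A h k * ((upsilon υ h' ^ fMinus A h h' k : Rˣ) : R) *
              gaussBar (upsilon υ h') (A h' k + 1)) • brk υ r (moveEntry A h' h k)) := by
  refine ⟨fun A hA => isPhiMat_phi _ hA, fun A hA h h' hh => ⟨?_, ?_⟩⟩
  · rintro _ hD ⟨⟨X, rfl⟩, hco⟩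
    rw [brk_mul_brk υ hA (Or.inl hh) X hD hco (fun k => epsSign A h k) _
      fun k hk => brkUnit_mul_succ υ hh X hco hk]
    refine Finset.sum_congr rfl fun k _ => ?_
    simp
  · rintro _ hD ⟨⟨X, rfl⟩, hco⟩
    rw [brk_mul_brk υ hA (Or.inr hh) X hD hco (fun k => epsSign A h k) _
      fun k hk => brkUnit_mul_pred υ hh X hco hk]
    refine Finset.sum_congr rfl fun k _ => ?_
    simp
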